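/- Let $k$ be a commutative ring, let $r_1,\dots,r_s\ge 1$ be integers, and let $R=k[x_{i,j}: 1\le i\le s,\ 1\le j\le r_i]=\bigotimes_{i} k[\mathbf x_i]$, $\mathbf x_i=(x_{i,1},\dots,x_{i,r_i})$, be graded by $\mathbb Z^s$ with $\deg x_{i,j}=\mathbf e_i$. Put $\mathfrak a_i=(\mathbf x_i)R$, $B=\mathfrak a_1\cdots\mathfrak a_s$, and, for $\alpha\subseteq\{1,\dots,s\}$, $\mathfrak a_\alpha=\sum_{i\in\alpha}\mathfrak a_i$ and $|\alpha|=\sum_{i\in\alpha} r_i$. Let $$\check R_\alpha=\Big(\bigotimes_{i\in\alpha}\tfrac1{x_{i,1}\cdots x_{i,r_i}}k[x_{i,1}^{-1},\dots,x_{i,r_i}^{-1}]\Big)\otimes_k\Big(\bigotimes_{i\notin\alpha}k[\mathbf x_i]\Big),$$ the free $k$-module on the monomials $x^e$, $e_{i,j}\in\mathbb Z$, with $e_{i,j}\le -1$ for $i\in\alpha$ and $e_{i,j}\ge 0$ for $i\notin\alpha$; a monomial $x^m$ of $R$ sends $x^e$ to $x^{e+m}$ if this is again such a monomial, and to $0$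 otherwise. For an ideal $I$ of $R$ generated by finitely many homogeneous elements, the $\mathbb Z^s$-graded module $H^\ell_I(R)$ is the $\ell$-th cohomology of the Čech complex of $R$ on any finite sequence of homogeneous generators of $I$. For $\ell\ge 0$ let $\Lambda_\ell$ be the set of non-empty $\alpha\subseteq\{1,\dots,s\}$ with $|\alpha|-(\#\alpha-1)=\ell$. Then, for every $\ell\ge 0$, $$H^\ell_B(R)\;\cong\;\bigoplus_{\alpha\in\Lambda_\ell}H^{|\alpha|}_{\mathfrak a_\alpha}(R)\;\cong\;\bigoplus_{\alpha\in\Lambda_\ell}\check R_\alpha ,$$ where the first isomorphism is one of $\mathbb Z^s$-graded $k$-modules and the second one of $\mathbb Z^s$-graded $R$-modules. If $s=1$, or if $r_i\ge 2$ for all $i$, there is also a first isomorphism that is one of $\mathbb Z^s$-graded $R$-modules. (All isomorphisms are homogeneous of degree $0$.) Moreover, if $k\ne 0$, then for every $\alpha\subseteq\{1,\dots,s\}$ the support $\{a\in\mathbb Z^s:(\check R_\alpha)_a\neq 0\}$ is the shifted orthant $$Q_\alpha=\{a\in\mathbb Z^s:\ a_i\le -r_i \text{ for } i\in\alpha,\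 a_i\ge 0\text{ for } i\notin\alpha\}.$$ -/

import Mathlib

noncomputable section

open scoped DirectSum

/-! ### Cech cohomology of a finite sequence of elements of a commutative ring -/

namespace Cech

variable {A : Type*} [CommRing A] {N : ℕ}

/-- The localization `A_{f_σ}` at the product `f_σ = ∏_{i ∈ σ} f_i`. -/
abbrev Loc (f : Fin N → A) (σ : Finset (Fin N)) : Type _ :=
  Localization.Away (∏ i ∈ σ, f i)

/-- For `σ ⊆ τ`, the element `f_σ` becomes invertible in `A_{f_τ}`. -/
theorem isUnit_algebraMap (f : Fin N → A) {σ τ : Finset (Fin N)} (h : σ ⊆ τ) :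
    IsUnit (algebraMap A (Loc f τ) (∏ i ∈ σ, f i)) :=
  isUnit_of_dvd_unit (map_dvd (algebraMap A (Loc f τ)) (Finset.prod_dvd_prod_of_subset σ τ f h))
    (IsLocalization.Away.algebraMap_isUnit (∏ i ∈ τ, f i))

/-- The localization map `A_{f_σ} → A_{f_τ}` for `σ ⊆ τ`. -/
def res (f : Fin N → A) {σ τ : Finset (Fin N)} (h : σ ⊆ τ) : Loc f σ →ₐ[A] Loc f τ :=
  IsLocalization.Away.liftAlgHom (∏ i ∈ σ, f i) (f := Algebra.ofId A (Loc f τ))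
    (isUnit_algebraMap f h)

/-- Cech cochains of degree `p`: the product of the `A_{f_σ}` over all `σ ⊆ {1, …, N}` with
`p` elements. In particular the cochains of degree `0` are `A_1 = A`. -/
abbrev Cochain (f : Fin N → A) (p : ℕ) : Type _ :=
  (σ : {σ : Finset (Fin N) // σ.card = p}) → Loc f σ.1

/-- The Cech differential
`(d c)_τ = ∑_{i ∈ τ} (-1) ^ #{j ∈ τ | j < i} • (c_{τ ∖ i} restricted to A_{f_τ})`. -/
def d (f : Fin N → A) (p : ℕ) : Cochain f p →ₗ[A] Cochain f (p + 1) :=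
  LinearMap.pi fun τ => ∑ i : {i // i ∈ τ.1},
    ((-1 : A) ^ (τ.1.filter (· < i.1)).card) •
      ((res f (Finset.erase_subset i.1 τ.1)).toLinearMap ∘ₗ
        LinearMap.proj (⟨τ.1.erase i.1, by rw [Finset.card_erase_of_mem i.2, τ.2]; rfl⟩ :
          {σ : Finset (Fin N) // σ.card = p}))

/-- Cech cocycles of degree `p`. -/
def cocycles (f : Fin N → A) (p : ℕ) : Submodule A (Cochain f p) :=
  LinearMap.ker (d f p)

/-- Cech coboundaries of degree `p`. -/
def coboundaries (f : Fin N → A) : (p : ℕ) → Submodule A (Cochain f p)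
  | 0 => ⊥
  | p + 1 => LinearMap.range (d f p)

/-- The `p`-th Cech cohomology module of `A` with respect to `f`, that is, the local cohomology
module `H^p_{(f_1, …, f_N)}(A)`. -/
abbrev Cohomology (f : Fin N → A) (p : ℕ) : Type _ :=
  cocycles f p ⧸ (coboundaries f p).submoduleOf (cocycles f p)

end Cech

/-! ### Multigraded polynomial rings -/

namespace Multigraded

variable (k : Type*) [CommRing k] {s : ℕ} (r : Fin s → ℕ)

/-- The variables `x_{i,j}` with `1 ≤ i ≤ s` and `1 ≤ j ≤ r_i`. -/
abbrev Var : Type := (i : Fin s) × Fin (r i)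

/-- The polynomial ring `R = k[x_{i,j}] = k[𝐱_1] ⊗ ⋯ ⊗ k[𝐱_s]`. -/
abbrev Ring : Type _ := MvPolynomial (Var r) k

/-- The part `R_a` of multidegree `a ∈ ℤ^s`, where `x_{i,j}` has degree the `i`-th unit vector. -/
def part (a : Fin s → ℤ) : Submodule k (Ring k r) :=
  MvPolynomial.weightedHomogeneousSubmodule k (fun v : Var r => (Pi.single v.1 1 : Fin s → ℤ)) a

/-- The ideal `𝔞_i` generated by the `i`-th block of variables. -/
def blockIdeal (i : Fin s) : Ideal (Ring k r) :=
  Ideal.span (Set.range fun j : Fin (r i) => MvPolynomial.X (⟨i, j⟩ : Var r))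

/-- `B = 𝔞_1 ⋯ 𝔞_s`. -/
def irrelevantIdeal : Ideal (Ring k r) := ∏ i, blockIdeal k r i

/-- `𝔞_α = ∑_{i ∈ α} 𝔞_i`. -/
def sumIdeal (α : Finset (Fin s)) : Ideal (Ring k r) := ∑ i ∈ α, blockIdeal k r i

/-- A finite sequence of multihomogeneous generators of an ideal `I` of `R`. -/
structure HomogeneousGenerators (I : Ideal (Ring k r)) where
  /-- the number of generators -/
  num : ℕ
  /-- the generators -/
  gen : Fin num → Ring k r
  homogeneous : ∀ i, ∃ a, gen i ∈ part k r a
  span_eq : Ideal.span (Set.range gen) = I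

variable {k r}

/-- The part of degree `a` of a localization `R_g` at a multihomogeneous element `g`, consisting of
the fractions `x / u` with `u` a power of `g`, with `x ∈ R_b` and `u ∈ R_c`, and `a = b - c`. -/
def locPart (g : Ring k r) (a : Fin s → ℤ) : Submodule k (Localization.Away g) :=
  Submodule.span k {z | ∃ (b c : Fin s → ℤ) (x : Ring k r) (u : Submonoid.powers g),
    x ∈ part k r b ∧ (u : Ring k r) ∈ part k r c ∧ a = b - c ∧ z = Localization.mk x u}

/-- The part of degree `a` of the module of Cech cochains. -/
def cochainPart {N : ℕ} (f : Fin N → Ring k r) (p : ℕ) (a : Fin s → ℤ) :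
    Submodule k (Cech.Cochain f p) :=
  Submodule.pi Set.univ fun σ => locPart (∏ i ∈ σ.1, f i) a

namespace HomogeneousGenerators

variable {I : Ideal (Ring k r)}

/-- The local cohomology module `H^p_I(R)`, computed by the Cech complex on `G`. -/
def LocalCohomology (G : HomogeneousGenerators k r I) (p : ℕ) : Type _ :=
  Cech.Cohomology G.gen p

instance (G : HomogeneousGenerators k r I) (p : ℕ) : AddCommGroup (G.LocalCohomology p) :=
  inferInstanceAs (AddCommGroup (Cech.Cohomology G.gen p))

instance (G : HomogeneousGenerators k r I) (p : ℕ) : Module (Ring k r) (G.LocalCohomology p) :=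
  inferInstanceAs (Module (Ring k r) (Cech.Cohomology G.gen p))

instance (G : HomogeneousGenerators k r I) (p : ℕ) : Module k (G.LocalCohomology p) :=
  inferInstanceAs (Module k (Cech.Cohomology G.gen p))

instance (G : HomogeneousGenerators k r I) (p : ℕ) :
    IsScalarTower k (Ring k r) (G.LocalCohomology p) :=
  inferInstanceAs (IsScalarTower k (Ring k r) (Cech.Cohomology G.gen p))

/-- The map that sends a cocycle to its class. -/
def cls (G : HomogeneousGenerators k r I) (p : ℕ) :
    Cech.cocycles G.gen p →ₗ[Ring k r] G.LocalCohomology p :=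
  ((Cech.coboundaries G.gen p).submoduleOf (Cech.cocycles G.gen p)).mkQ

/-- The part `H^p_I(R)_a` of degree `a`: the classes of the cocycles of degree `a`. -/
def localCohomologyPart (G : HomogeneousGenerators k r I) (p : ℕ) (a : Fin s → ℤ) :
    Submodule k (G.LocalCohomology p) :=
  ((cochainPart G.gen p a).comap ((Cech.cocycles G.gen p).subtype.restrictScalars k)).map
    ((G.cls p).restrictScalars k)

end HomogeneousGenerators

/-! ### The modules of inverse-monomial terms -/

/-- The exponents `e` of the monomials of `Ř_α`: negative at the variables of the blocks in `α`,
non-negative at the other variables. -/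
def IsInvExponent (α : Finset (Fin s)) (e : Var r → ℤ) : Prop :=
  ∀ v : Var r, (v.1 ∈ α → e v ≤ -1) ∧ (v.1 ∉ α → 0 ≤ e v)

variable (k r)

/-- `Ř_α = (⨂_{i ∈ α} (x_{i,1} ⋯ x_{i,r_i})⁻¹ k[𝐱_i⁻¹]) ⊗ (⨂_{i ∉ α} k[𝐱_i])`, as the free
`k`-module on its monomials. -/
def InvModule (α : Finset (Fin s)) : Type _ :=
  {e : Var r → ℤ // IsInvExponent α e} →₀ k

namespace InvModule

variable (α : Finset (Fin s))

instance : AddCommGroup (InvModule k r α) :=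
  inferInstanceAs (AddCommGroup ({e : Var r → ℤ // IsInvExponent α e} →₀ k))

instance : Module k (InvModule k r α) :=
  inferInstanceAs (Module k ({e : Var r → ℤ // IsInvExponent α e} →₀ k))

variable {k r α}

/-- The term `c x^e` of `Ř_α`. -/
def term (e : {e : Var r → ℤ // IsInvExponent α e}) (c : k) : InvModule k r α :=
  Finsupp.single e c

variable (k)

/-- The monomial `x^e`, read as `0` if it is not a monomial of `Ř_α`. -/
def monomialOrZero (e : Var r → ℤ) : InvModule k r α :=
  open Classical in
  if h : IsInvExponent α e then term ⟨e, h⟩ 1 else 0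

/-- The product `x^m * x^e`: it is `x^(e + m)` if that is a monomial of `Ř_α`, and `0` otherwise. -/
def mulTerm (m : Var r →₀ ℕ) (e : {e : Var r → ℤ // IsInvExponent α e}) : InvModule k r α :=
  monomialOrZero k fun v => e.1 v + (m v : ℤ)

/-- Multiplication by the monomial `x^m` on `Ř_α`. -/
def mulMonomial (m : Var r →₀ ℕ) : InvModule k r α →ₗ[k] InvModule k r α :=
  Finsupp.linearCombination k (mulTerm k m)

theorem mulMonomial_term (m : Var r →₀ ℕ) (e : {e : Var r → ℤ // IsInvExponent α e}) (c : k) :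
    mulMonomial k m (term e c) = c • mulTerm k m e :=
  Finsupp.linearCombination_single k c e

theorem hom_ext {M : Type*} [AddCommMonoid M] [Module k M] {φ ψ : InvModule k r α →ₗ[k] M}
    (h : ∀ e, φ (term e 1) = ψ (term e 1)) : φ = ψ :=
  Finsupp.lhom_ext' fun e => LinearMap.ext_ring (h e)

theorem mulMonomial_zero : (mulMonomial k 0 : InvModule k r α →ₗ[k] InvModule k r α) = 1 := by
  refine hom_ext k fun e => ?_
  rw [mulMonomial_term, one_smul, mulTerm, monomialOrZero, dif_pos (by simpa using e.2)]
  simp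

theorem mulMonomial_add (m m' : Var r →₀ ℕ) :
    (mulMonomial k (m + m') : InvModule k r α →ₗ[k] InvModule k r α) =
      mulMonomial k m * mulMonomial k m' := by
  refine hom_ext k fun e => ?_
  rw [Module.End.mul_apply, mulMonomial_term, mulMonomial_term, one_smul, one_smul]
  have hv : (fun v => e.1 v + ((m + m') v : ℤ)) = fun v => e.1 v + (m' v : ℤ) + (m v : ℤ) := by
    funext v
    simp only [Finsupp.add_apply, Nat.cast_add]
    ring
  rw [mulTerm, mulTerm, hv]
  by_cases h' : IsInvExponent α (fun v => e.1 v + (m' v : ℤ))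
  · rw [monomialOrZero.eq_def k (fun v => e.1 v + (m' v : ℤ)), dif_pos h', mulMonomial_term,
      one_smul, mulTerm]
  · have h : ¬ IsInvExponent α (fun v => e.1 v + (m' v : ℤ) + (m v : ℤ)) := by
      intro h
      refine h' fun v => ⟨fun hv => ?_, fun hv => ?_⟩
      · have := (h v).1 hv
        simp only at this ⊢
        omega
      · have := (e.2 v).2 hv
        simp only
        omega
    rw [monomialOrZero, dif_neg h, monomialOrZero, dif_neg h', map_zero]

variable (r α)

/-- The ring homomorphism from `R` to the `k`-linear endomorphisms of `Ř_α` that sends a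
monomial `x^m` to the multiplication by `x^m`. -/
def action : Ring k r →ₐ[k] Module.End k (InvModule k r α) :=
  AddMonoidAlgebra.lift k (Module.End k (InvModule k r α)) (Var r →₀ ℕ)
    { toFun := fun m => mulMonomial k m.toAdd
      map_one' := mulMonomial_zero k
      map_mul' := fun m m' => mulMonomial_add k m.toAdd m'.toAdd }

/-- The `R`-module structure of `Ř_α`. -/
instance : Module (Ring k r) (InvModule k r α) :=
  Module.compHom (InvModule k r α) (action k r α).toRingHom

variable {r α}

theorem monomial_smul (m : Var r →₀ ℕ) (c : k) (z : InvModule k r α) :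
    (MvPolynomial.monomial m c : Ring k r) • z = c • mulMonomial k m z := by
  change action k r α (MvPolynomial.monomial m c) z = _
  have : action k r α (MvPolynomial.monomial m c) = c • mulMonomial k m :=
    AddMonoidAlgebra.lift_single _ _ _
  rw [this]; rfl

instance : IsScalarTower k (Ring k r) (InvModule k r α) where
  smul_assoc c p z := by
    change action k r α (c • p) z = c • action k r α p z
    rw [map_smul]; rfl

variable (r α)

/-- The part of `Ř_α` of multidegree `a`, spanned by the monomials of multidegree `a`. -/
def part (a : Fin s → ℤ) : Submodule k (InvModule k r α) :=
  Submodule.span k {z | ∃ e : {e : Var r → ℤ // IsInvExponent α e},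
    (∀ i, ∑ j : Fin (r i), e.1 ⟨i, j⟩ = a i) ∧ z = term e 1}

end InvModule

/-! ### Graded isomorphisms, supports, orthants -/

/-- The part of degree `a` of a direct sum of graded modules. -/
def directSumPart {ι D : Type*} {k : Type*} [CommRing k] {M : ι → Type*}
    [∀ i, AddCommGroup (M i)] [∀ i, Module k (M i)] (P : ∀ i, D → Submodule k (M i)) (a : D) :
    Submodule k (⨁ i, M i) where
  carrier := {z | ∀ i, z i ∈ P i a}
  zero_mem' := fun i => (P i a).zero_mem
  add_mem' := fun hx hy i => by
    rw [DirectSum.add_apply]; exact (P i a).add_mem (hx i) (hy i)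
  smul_mem' := fun c x hx i => by
    rw [DirectSum.smul_apply]; exact (P i a).smul_mem c (hx i)

/-- There is an `S`-linear isomorphism, homogeneous of degree `0`, between the modules `M` and `M'`
with graded parts `P` and `P'`. -/
def GradedIso (S : Type*) [Semiring S] {D : Type*} {k : Type*} [CommRing k] {M M' : Type*}
    [AddCommGroup M] [AddCommGroup M'] [Module k M] [Module k M'] [Module S M] [Module S M']
    (P : D → Submodule k M) (P' : D → Submodule k M') : Prop :=
  ∃ φ : M ≃ₗ[S] M', ∀ a z, z ∈ P a ↔ φ z ∈ P' a

/-- The support of a graded module: the degrees in which it is not zero. -/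
def gradedSupport {D : Type*} {k : Type*} [CommRing k] {M : Type*} [AddCommGroup M] [Module k M]
    (P : D → Submodule k M) : Set D :=
  {a | P a ≠ ⊥}

/-- The shifted orthant `Q_α ⊆ ℤ^s`: the factor at `i` is `-ℕ - r_i` for `i ∈ α` and `ℕ` for
`i ∉ α`. -/
def orthant (r : Fin s → ℕ) (α : Finset (Fin s)) : Set (Fin s → ℤ) :=
  {a | ∀ i, (i ∈ α → a i ≤ -(r i : ℤ)) ∧ (i ∉ α → 0 ≤ a i)}

/-- The index set of the summands in cohomological degree `ℓ`: the non-empty `α` with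
`∑_{i ∈ α} r_i - (#α - 1) = ℓ`. -/
abbrev Summand (r : Fin s → ℕ) (ℓ : ℕ) : Type :=
  {α : Finset (Fin s) // α.Nonempty ∧ (∑ i ∈ α, (r i : ℤ)) - ((α.card : ℤ) - 1) = (ℓ : ℤ)}

end Multigraded

end

noncomputable section

/-! ### Localizations away from one element and complexes of such localizations -/

namespace LocComplex

variable {A : Type*} [CommRing A]

/-! Cohomology with support in B is computed by a complex smaller than the Čech complex of
generators of B. For a set τ of variables let x_τ be its product. The complex X (`blockSystem`) has
R in degree 0 and a summand R_{x_τ} in degree #τ + 1 - s for every τ that meets all s blocks. It is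
the shifted tensor product of the Čech complexes of the blocks without their terms of degree 0,
augmented by the maps R → R_{x_τ} for the τ with exactly one variable from each block.

Let C be the Čech complex of an arbitrary generating sequence g of B. It is compared with X through
the total complex of C ⊗ X. Each x_τ lies in B, so C becomes exact when x_τ is inverted, and the
projection of the total complex to C ⊗ R = C is a quasi-isomorphism (`prCech_quasiIso`). Conversely,
the cohomology of X is torsion for powers of every g_i, so X becomes exact when a product of some of
the g_i, at least one, is inverted, and the projection to X is a quasi-isomorphism
(`prCoeff_quasiIso`).

All localizations in X are at monomials, so X splits over Laurent exponents e. Let M be the set of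
variables at which e is negative. The strand of X at e is the simplicial cochain complex on those τ
⊇ M that meet every block, together with the augmentation term if M is empty. If M contains a block
only partially, the strand is exact (`exists_bd_eq_of_partial`). Otherwise M is the union of the
blocks in some α. Homotopies, one for each block outside α, then deform a cocycle into a constant
function on the critical sets, which consist of M and one variable from each other block
(`exists_sub_bd_critical`). So the strand has cohomology k, in degree |α| + (s - #α) + 1 - s = |α| -
(#α - 1); for empty α the augmentation kills this class. The exponents that belong to α are the
monomials of Ř_α, and reading coefficients at a critical set gives `exists_cohomology_equiv`.

Taking all variables of the blocks in α as one single block, the same statement gives H^{|α|} with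
support in 𝔞_α as Ř_α. The first isomorphism of the theorem is obtained by passing through the
modules Ř_α.

Reading at a critical set can fail to commute with x_v only if x_v carries a term with a pole at
x_v, where the block of v lies outside α, to a term without that pole. A critical set has one
variable in this block. If the block has a second variable, the first term thus lies in an exact
strand, and cocycles read as zero there (`evalAt_X_smul`). If there is only one block, no block lies
outside a non-empty α. -/

/-- The canonical map `A_a → A_b` if `a ∣ b`, and `0` otherwise. -/
def tr (a b : A) : Localization.Away a →ₗ[A] Localization.Away b :=
  open Classical in
  if h : a ∣ b then
    (IsLocalization.Away.liftAlgHom a (f := Algebra.ofId A (Localization.Away b))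
      (isUnit_of_dvd_unit (map_dvd (algebraMap A (Localization.Away b)) h)
        (IsLocalization.Away.algebraMap_isUnit b))).toLinearMap
  else 0

theorem tr_algebraMap {a b : A} (h : a ∣ b) (x : A) :
    tr a b (algebraMap A _ x) = algebraMap A _ x := by
  rw [tr, dif_pos h]
  rw [AlgHom.toLinearMap_apply, AlgHom.commutes]

theorem exists_pow_smul (a : A) (z : Localization.Away a) :
    ∃ (n : ℕ) (x : A), a ^ n • z = algebraMap A _ x := by
  obtain ⟨n, x, h⟩ := IsLocalization.Away.surj a z
  exact ⟨n, x, by rw [Algebra.smul_def, map_pow, mul_comm, h]⟩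

theorem smul_bijective {u a : A} (h : u ∣ a) :
    Function.Bijective fun z : Localization.Away a => u • z := by
  have hu : IsUnit (algebraMap A (Localization.Away a) u) :=
    isUnit_of_dvd_unit (map_dvd _ h) (IsLocalization.Away.algebraMap_isUnit a)
  simp only [Algebra.smul_def]
  exact IsUnit.isUnit_iff_mulLeft_bijective.1 hu

theorem pow_smul_injective {u a : A} (h : u ∣ a) (n : ℕ) {z z' : Localization.Away a}
    (hz : u ^ n • z = u ^ n • z') : z = z' := by
  induction n with
  | zero => simpa using hz
  | succ n ih =>
    rw [pow_succ', mul_smul, mul_smul] at hz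
    exact ih ((smul_bijective h).1 hz)

theorem pow_smul_surjective {u a : A} (h : u ∣ a) (n : ℕ) (z : Localization.Away a) :
    ∃ z', u ^ n • z' = z := by
  induction n with
  | zero => exact ⟨z, by simp⟩
  | succ n ih =>
    obtain ⟨z', rfl⟩ := ih
    obtain ⟨y, rfl⟩ := (smul_bijective h).2 z'
    exact ⟨y, by rw [pow_succ, mul_smul]⟩

theorem linearMap_ext_away {a : A} {M : Type*} [AddCommGroup M] [Module A M]
    (hM : ∀ m m' : M, a • m = a • m' → m = m') {φ ψ : Localization.Away a →ₗ[A] M}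
    (h : ∀ x, φ (algebraMap A _ x) = ψ (algebraMap A _ x)) : φ = ψ := by
  ext z
  obtain ⟨n, x, hx⟩ := exists_pow_smul a z
  have key : a ^ n • φ z = a ^ n • ψ z := by rw [← map_smul, ← map_smul, hx, h]
  clear hx
  induction n with
  | zero => simpa using key
  | succ n ih =>
    rw [pow_succ', mul_smul, mul_smul] at key
    exact ih (hM _ _ key)

theorem tr_comp_tr {a b c : A} (hab : a ∣ b) (hbc : b ∣ c) : tr b c ∘ₗ tr a b = tr a c := by
  refine linearMap_ext_away (fun m m' => fun h => (smul_bijective (hab.trans hbc)).1 h) fun x => ?_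
  rw [LinearMap.comp_apply, tr_algebraMap hab, tr_algebraMap hbc, tr_algebraMap (hab.trans hbc)]

theorem tr_tr {a b c : A} (hab : a ∣ b) (hbc : b ∣ c) (z : Localization.Away a) :
    tr b c (tr a b z) = tr a c z := by
  rw [← tr_comp_tr hab hbc, LinearMap.comp_apply]

theorem tr_self (a : A) : tr a a = LinearMap.id := by
  refine linearMap_ext_away (fun m m' => fun h => (smul_bijective dvd_rfl).1 h) fun x => ?_
  rw [tr_algebraMap dvd_rfl, LinearMap.id_apply]

theorem tr_self_apply (a : A) (z : Localization.Away a) : tr a a z = z := by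
  rw [tr_self, LinearMap.id_apply]

theorem tr_injective {a b : A} (hab : a ∣ b) (hba : b ∣ a) : Function.Injective (tr a b) :=
  Function.LeftInverse.injective (g := tr b a) fun z => by rw [tr_tr hab hba, tr_self_apply]

/-- `A_b` is the localization of `A_a` at `u`: only the `u`-part of a denominator has to be cleared.
-/
theorem exists_pow_smul_eq_tr {u a b : A} (hb : b = u * a) (z : Localization.Away b) :
    ∃ n : ℕ, ∃ y, u ^ n • z = tr a b y := by
  obtain ⟨n, x, hx⟩ := exists_pow_smul b z
  have hab : a ∣ b := ⟨u, by rw [hb, mul_comm]⟩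
  obtain ⟨y, hy⟩ := pow_smul_surjective (dvd_refl a) n (algebraMap A (Localization.Away a) x)
  refine ⟨n, y, pow_smul_injective hab n ?_⟩
  rw [← map_smul, hy, tr_algebraMap hab, ← hx, smul_smul, ← mul_pow, mul_comm, ← hb]

/-- The kernel of `A_a → (A_a)_u` is `u`-power torsion. -/
theorem exists_pow_smul_eq_zero {u a b : A} (hb : b = u * a) {y : Localization.Away a}
    (hy : tr a b y = 0) : ∃ n : ℕ, u ^ n • y = 0 := by
  obtain ⟨n, x, hx⟩ := exists_pow_smul a y
  have hab : a ∣ b := ⟨u, by rw [hb, mul_comm]⟩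
  have h1 : algebraMap A (Localization.Away b) x = algebraMap A _ 0 := by
    rw [← tr_algebraMap hab, ← hx, map_smul, hy, smul_zero, map_zero]
  obtain ⟨l, hl⟩ := IsLocalization.Away.exists_of_eq b h1
  refine ⟨l, pow_smul_injective (dvd_refl a) n (pow_smul_injective (dvd_refl a) l ?_)⟩
  rw [smul_zero, smul_zero, smul_comm _ (u ^ l), hx, smul_smul, ← mul_pow, mul_comm a u, ← hb,
    Algebra.smul_def, ← map_mul, hl, mul_zero, map_zero]

/-- A finite complex of localizations `A_{f_j}`, with differential given by incidence numbers. -/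
structure LocSystem (A : Type*) [CommRing A] (J : Type*) [Fintype J] where
  /-- the elements `f_j` -/
  el : J → A
  /-- the incidence numbers -/
  inc : J → J → ℤ
  /-- the cohomological degree -/
  deg : J → ℕ
  dvd : ∀ {i j}, inc i j ≠ 0 → el i ∣ el j
  deg_eq : ∀ {i j}, inc i j ≠ 0 → deg j = deg i + 1
  sq : ∀ i l, ∑ j, inc i j * inc j l = 0

namespace LocSystem

variable {J : Type*} [Fintype J] (X : LocSystem A J)

/-- The cochains, in all degrees at once. -/
abbrev Cochain : Type _ := (j : J) → Localization.Away (X.el j)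

/-- The differential. -/
def d : X.Cochain →ₗ[A] X.Cochain :=
  LinearMap.pi fun j => ∑ i, (X.inc i j : A) • (tr (X.el i) (X.el j) ∘ₗ LinearMap.proj i)

theorem d_apply (c : X.Cochain) (j : J) :
    X.d c j = ∑ i, (X.inc i j : A) • tr (X.el i) (X.el j) (c i) := by
  simp [d]

theorem d_d (c : X.Cochain) : X.d (X.d c) = 0 := by
  ext l
  simp only [d_apply, map_sum, Pi.zero_apply]
  have : ∀ j i, (X.inc j l : A) •
      tr (X.el j) (X.el l) ((X.inc i j : A) • tr (X.el i) (X.el j) (c i)) =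
      ((X.inc i j * X.inc j l : ℤ) : A) • tr (X.el i) (X.el l) (c i) := by
    intro j i
    -- Where an incidence number is zero, `tr` may be only its default value `0`; those terms are
    -- removed before functoriality of `tr` is used.
    rcases eq_or_ne (X.inc i j) 0 with h | h
    · simp [h]
    rcases eq_or_ne (X.inc j l) 0 with h' | h'
    · simp [h']
    rw [map_smul, tr_tr (X.dvd h) (X.dvd h'), smul_smul, mul_comm, Int.cast_mul]
  simp only [Finset.smul_sum, this]
  rw [Finset.sum_comm]
  simp only [← Finset.sum_smul, ← Int.cast_sum, X.sq, Int.cast_zero, zero_smul, Finset.sum_const_zero]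

/-- The projection to the cochains of degree `n`. -/
def comp (n : ℕ) : X.Cochain →ₗ[A] X.Cochain :=
  LinearMap.pi fun j => if X.deg j = n then LinearMap.proj j else 0

theorem comp_apply (n : ℕ) (c : X.Cochain) (j : J) :
    X.comp n c j = if X.deg j = n then c j else 0 := by
  rw [comp, LinearMap.pi_apply]
  split_ifs <;> rfl

theorem comp_d (n : ℕ) (c : X.Cochain) : X.comp (n + 1) (X.d c) = X.d (X.comp n c) := by
  ext j
  simp only [comp_apply, d_apply]
  split_ifs with h
  · refine Finset.sum_congr rfl fun i _ => ?_
    rcases eq_or_ne (X.inc i j) 0 with h0 | h0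
    · simp [h0]
    · rw [if_pos (by have := X.deg_eq h0; omega)]
  · symm
    refine Finset.sum_eq_zero fun i _ => ?_
    rcases eq_or_ne (X.inc i j) 0 with h0 | h0
    · simp [h0]
    · rw [if_neg (by have := X.deg_eq h0; omega), map_zero, smul_zero]

theorem comp_zero_d (c : X.Cochain) : X.comp 0 (X.d c) = 0 := by
  ext j
  simp only [comp_apply, d_apply, Pi.zero_apply]
  split_ifs with h
  · refine Finset.sum_eq_zero fun i _ => ?_
    rcases eq_or_ne (X.inc i j) 0 with h0 | h0
    · simp [h0]
    · have := X.deg_eq h0; omega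
  · rfl

theorem comp_comp (n : ℕ) (c : X.Cochain) : X.comp n (X.comp n c) = X.comp n c := by
  ext j
  simp only [comp_apply]
  split_ifs <;> rfl

theorem d_comp_eq_zero (n : ℕ) {c : X.Cochain} (hc : X.d c = 0) : X.d (X.comp n c) = 0 := by
  rw [← comp_d, hc, map_zero]

/-- The complex obtained by inverting one more element. -/
@[reducible] def twist (u : A) (b : J → A) (hb : ∀ j, b j = u * X.el j) : LocSystem A J where
  el := b
  inc := X.inc
  deg := X.deg
  dvd h := by rw [hb, hb]; exact mul_dvd_mul_left u (X.dvd h)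
  deg_eq := X.deg_eq
  sq := X.sq

/-- There are finitely many components, so the sum of their exponents works for all of them. -/
theorem exists_pow_smul_eq {ι : Type*} [Finite ι] {u : A} {a b : ι → A}
    (hb : ∀ j, b j = u * a j) (w : ∀ j, Localization.Away (b j)) :
    ∃ n : ℕ, ∃ m : ∀ j, Localization.Away (a j), ∀ j, u ^ n • w j = tr (a j) (b j) (m j) := by
  cases nonempty_fintype ι
  choose n y h using fun j => exists_pow_smul_eq_tr (hb j) (w j)
  refine ⟨∑ j, n j, fun j => u ^ (∑ i, n i - n j) • y j, fun j => ?_⟩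
  rw [map_smul, ← h j, smul_smul, ← pow_add,
    Nat.sub_add_cancel (Finset.single_le_sum (fun _ _ => Nat.zero_le _) (Finset.mem_univ j))]

theorem exists_pow_smul_zero {ι : Type*} [Finite ι] {u : A} {a b : ι → A}
    (hb : ∀ j, b j = u * a j) (m : ∀ j, Localization.Away (a j))
    (hm : ∀ j, tr (a j) (b j) (m j) = 0) : ∃ n : ℕ, u ^ n • m = 0 := by
  cases nonempty_fintype ι
  choose n h using fun j => exists_pow_smul_eq_zero (hb j) (hm j)
  refine ⟨∑ j, n j, funext fun j => ?_⟩
  rw [Pi.smul_apply, ← Nat.sub_add_cancel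
    (Finset.single_le_sum (fun _ _ => Nat.zero_le _) (Finset.mem_univ j) : n j ≤ _),
    pow_add, mul_smul, h j, smul_zero, Pi.zero_apply]

variable {u : A} {b : J → A}

theorem dvd_twist (hb : ∀ j, b j = u * X.el j) (j : J) : X.el j ∣ b j :=
  ⟨u, by rw [hb, mul_comm]⟩

variable (hb : ∀ j, b j = u * X.el j)

theorem twist_d_tr (c : X.Cochain) (j : J) :
    (X.twist u b hb).d (fun i => tr (X.el i) (b i) (c i)) j = tr (X.el j) (b j) (X.d c j) := by
  rw [d_apply, d_apply, map_sum]
  refine Finset.sum_congr rfl fun i _ => ?_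
  rcases eq_or_ne (X.inc i j) 0 with h0 | h0
  · simp [h0]
  · rw [tr_tr (X.dvd_twist hb i) ((X.twist u b hb).dvd h0), map_smul,
      tr_tr (X.dvd h0) (X.dvd_twist hb j)]

/-- Localization at `u` kills `u`-power torsion cohomology. A power of `u` lifts the cocycle `w` to
a cochain `m` of `X`, a second one makes `m` a cocycle, a third one makes it a coboundary; all three
are divided out again, `u` being invertible in the twisted complex. -/
theorem twist_exact (h : ∀ c, X.d c = 0 → ∃ n : ℕ, u ^ n • c ∈ LinearMap.range X.d)
    (w : (X.twist u b hb).Cochain) (hw : (X.twist u b hb).d w = 0) :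
    ∃ y, (X.twist u b hb).d y = w := by
  obtain ⟨n, m, hm⟩ := exists_pow_smul_eq hb w
  have hd : ∀ j, tr (X.el j) (b j) (X.d m j) = 0 := by
    intro j
    rw [← twist_d_tr X hb, ← funext hm]
    change (X.twist u b hb).d (u ^ n • w) j = 0
    rw [map_smul, hw, smul_zero, Pi.zero_apply]
  obtain ⟨l, hl⟩ := exists_pow_smul_zero hb (X.d m) hd
  obtain ⟨q, y, hy⟩ := h (u ^ l • m) (by rw [map_smul, hl])
  have hu : ∀ j, u ∣ b j := fun j => ⟨_, hb j⟩
  choose y' hy' using fun j => pow_smul_surjective (hu j) (q + l + n) (tr (X.el j) (b j) (y j))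
  refine ⟨y', funext fun j => pow_smul_injective (hu j) (q + l + n) ?_⟩
  rw [← Pi.smul_apply, ← map_smul, show u ^ (q + l + n) • y' = _ from funext hy',
    twist_d_tr X hb, hy]
  change tr (X.el j) (b j) (u ^ q • u ^ l • m j) = _
  rw [map_smul, map_smul, ← hm, smul_smul, smul_smul, pow_add, pow_add]

end LocSystem

/-- Acyclicity from a finite filtration with acyclic quotients. -/
theorem exists_of_filtration {M : Type*} [AddCommGroup M] (D : M →+ M) (hD : ∀ w, D (D w) = 0)
    (F : ℕ → AddSubgroup M) (n : ℕ) (hn : F n = ⊥)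
    (hF : ∀ q w, w ∈ F q → D w = 0 → ∃ b ∈ F q, w - D b ∈ F (q + 1))
    (hanti : ∀ q, F (q + 1) ≤ F q) {q : ℕ} (hq : q ≤ n) {w : M} (hw : w ∈ F q)
    (hDw : D w = 0) : ∃ b ∈ F q, D b = w := by
  obtain ⟨l, rfl⟩ := Nat.exists_eq_add_of_le hq
  clear hq
  induction l generalizing q w with
  | zero =>
    rw [Nat.add_zero] at hn
    refine ⟨0, (F q).zero_mem, ?_⟩
    rw [hn, AddSubgroup.mem_bot] at hw
    rw [hw, map_zero]
  | succ l ih =>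
    obtain ⟨b, hb, hwb⟩ := hF q w hw hDw
    obtain ⟨b', hb', h⟩ := ih (q := q + 1) hwb (by rw [map_sub, hD, hDw, sub_zero])
      (by rw [← hn]; congr 1; omega)
    exact ⟨b + b', (F q).add_mem hb (hanti q hb'), by rw [map_add, h]; abel⟩

end LocComplex

end

noncomputable section

namespace LocComplex

/-! ### Signed incidence of finite subsets -/

section Incidence

variable {ι : Type*} [LinearOrder ι]

/-- The sign with which `τ ∖ w` occurs in the boundary of `τ`. -/
def sgn (τ : Finset ι) (w : ι) : ℤ := (-1) ^ (τ.filter (· < w)).card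

theorem sgn_mul_self (τ : Finset ι) (w : ι) : sgn τ w * sgn τ w = 1 := by
  rw [sgn, ← pow_add, ← two_mul, pow_mul, neg_one_sq, one_pow]

theorem sgn_erase_of_lt {τ : Finset ι} {v w : ι} (h : w < v) : sgn (τ.erase v) w = sgn τ w := by
  have : (τ.erase v).filter (· < w) = τ.filter (· < w) := by
    ext x
    simp only [Finset.mem_filter, Finset.mem_erase]
    exact ⟨fun hx => ⟨hx.1.2, hx.2⟩, fun hx => ⟨⟨(hx.2.trans h).ne, hx.1⟩, hx.2⟩⟩
  rw [sgn, sgn, this]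

theorem sgn_erase_of_gt {τ : Finset ι} {v w : ι} (hv : v ∈ τ) (h : v < w) :
    sgn (τ.erase v) w = -sgn τ w := by
  have : (τ.erase v).filter (· < w) = (τ.filter (· < w)).erase v := by
    ext x
    simp only [Finset.mem_filter, Finset.mem_erase]
    tauto
  have hm : v ∈ τ.filter (· < w) := Finset.mem_filter.2 ⟨hv, h⟩
  rw [sgn, sgn, this, ← Finset.card_erase_add_one hm, pow_succ]
  ring

/-- Removing the smaller of two elements shifts the position of the larger by one, but not the other
way round. -/
theorem sgn_antisymm {τ : Finset ι} {v w : ι} (hv : v ∈ τ) (hw : w ∈ τ) (h : v ≠ w) :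
    sgn τ v * sgn (τ.erase v) w = -(sgn τ w * sgn (τ.erase w) v) := by
  rcases lt_or_gt_of_ne h with h | h
  · rw [sgn_erase_of_gt hv h, sgn_erase_of_lt h]; ring
  · rw [sgn_erase_of_gt hw h, sgn_erase_of_lt h]; ring

/-- The incidence number of two finite sets. -/
def incidence (σ τ : Finset ι) : ℤ := ∑ w ∈ τ, if σ = τ.erase w then sgn τ w else 0

theorem exists_of_incidence_ne_zero {σ τ : Finset ι} (h : incidence σ τ ≠ 0) :
    ∃ w ∈ τ, σ = τ.erase w := by
  obtain ⟨w, hw, h'⟩ := Finset.exists_ne_zero_of_sum_ne_zero h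
  exact ⟨w, hw, by by_contra hne; exact h' (if_neg hne)⟩

/-- Translates between the matrix form of a differential, used for `LocSystem`, and the alternating
sum over faces. -/
theorem sum_incidence_smul [Fintype ι] {A M : Type*} [CommRing A] [AddCommGroup M] [Module A M]
    (f : Finset ι → M) (τ : Finset ι) :
    ∑ σ, (incidence σ τ : A) • f σ = ∑ w ∈ τ, (sgn τ w : A) • f (τ.erase w) := by
  simp only [incidence, Int.cast_sum, Finset.sum_smul]
  rw [Finset.sum_comm]
  refine Finset.sum_congr rfl fun w _ => ?_
  rw [Finset.sum_eq_single (τ.erase w)]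
  · rw [if_pos rfl]
  · intro σ _ hσ
    rw [if_neg hσ, Int.cast_zero, zero_smul]
  · simp

theorem incidence_sq [Fintype ι] (σ υ : Finset ι) :
    ∑ τ, incidence σ τ * incidence τ υ = 0 := by
  have h1 := sum_incidence_smul (A := ℤ) (fun τ => incidence σ τ) υ
  simp only [Int.cast_id, smul_eq_mul] at h1
  simp only [mul_comm (incidence σ _), h1]
  -- `F w v` is the contribution of removing `w` and then `v`. It is antisymmetric, so the double
  -- sum equals its own negative, and `ℤ` has no 2-torsion.
  let F : ι → ι → ℤ := fun w v =>
    if w ∈ υ ∧ v ∈ υ ∧ w ≠ v ∧ σ = (υ.erase w).erase v then sgn υ w * sgn (υ.erase w) v else 0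
  have hF : ∀ w v, F w v = -F v w := by
    intro w v
    simp only [F]
    rw [Finset.erase_right_comm]
    by_cases h : w ∈ υ ∧ v ∈ υ ∧ w ≠ v ∧ σ = (υ.erase v).erase w
    · rw [if_pos h, if_pos ⟨h.2.1, h.1, h.2.2.1.symm, h.2.2.2⟩, sgn_antisymm h.1 h.2.1 h.2.2.1]
    · rw [if_neg h, if_neg (fun h' => h ⟨h'.2.1, h'.1, h'.2.2.1.symm, h'.2.2.2⟩), neg_zero]
  have hS : ∑ w ∈ υ, sgn υ w * incidence σ (υ.erase w) = ∑ w, ∑ v, F w v := by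
    rw [← Finset.sum_subset (Finset.subset_univ υ)]
    · refine Finset.sum_congr rfl fun w hw => ?_
      rw [incidence, Finset.mul_sum, ← Finset.sum_subset (Finset.subset_univ (υ.erase w))]
      · refine Finset.sum_congr rfl fun v hv => ?_
        simp only [F]
        rw [Finset.mem_erase] at hv
        by_cases h : σ = (υ.erase w).erase v
        · rw [if_pos h, if_pos ⟨hw, hv.2, hv.1.symm, h⟩]
        · rw [if_neg h, if_neg (fun h' => h h'.2.2.2), mul_zero]
      · intro v _ hv
        exact if_neg fun h' => hv (Finset.mem_erase.2 ⟨h'.2.2.1.symm, h'.2.1⟩)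
    · intro w _ hw
      exact Finset.sum_eq_zero fun v _ => if_neg fun h' => hw h'.1
  have hneg : ∑ w, ∑ v, F w v = -∑ w, ∑ v, F w v := by
    conv_lhs => rw [Finset.sum_comm]
    rw [← Finset.sum_neg_distrib]
    refine Finset.sum_congr rfl fun w _ => ?_
    rw [← Finset.sum_neg_distrib]
    exact Finset.sum_congr rfl fun v _ => hF v w
  rw [hS]
  omega

end Incidence

/-! ### The Cech complex -/

variable {A : Type*} [CommRing A] {ι : Type*} [LinearOrder ι] [Fintype ι]

/-- The Cech complex of a finite family of elements. -/
@[reducible] def cech (f : ι → A) : LocSystem A (Finset ι) where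
  el σ := ∏ i ∈ σ, f i
  inc := incidence
  deg := Finset.card
  dvd h := by
    obtain ⟨w, _, rfl⟩ := exists_of_incidence_ne_zero h
    exact Finset.prod_dvd_prod_of_subset _ _ _ (Finset.erase_subset _ _)
  deg_eq h := by
    obtain ⟨w, hw, rfl⟩ := exists_of_incidence_ne_zero h
    exact (Finset.card_erase_add_one hw).symm
  sq := incidence_sq

theorem cech_d_apply (f : ι → A) (c : (cech f).Cochain) (τ : Finset ι) :
    (cech f).d c τ = ∑ w ∈ τ, (sgn τ w : A) •
      tr (∏ i ∈ τ.erase w, f i) (∏ i ∈ τ, f i) (c (τ.erase w)) := by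
  rw [LocSystem.d_apply]
  exact sum_incidence_smul (fun σ => tr (∏ i ∈ σ, f i) (∏ i ∈ τ, f i) (c σ)) τ

/-- All faces of `insert j σ` other than `σ` contain `j`. -/
theorem cech_d_insert {f : ι → A} {j : ι} {c : (cech f).Cochain} (hc : ∀ σ, j ∈ σ → c σ = 0)
    {σ : Finset ι} (hσ : j ∉ σ) :
    (cech f).d c (insert j σ) = (sgn (insert j σ) j : A) •
      tr (∏ i ∈ σ, f i) (∏ i ∈ insert j σ, f i) (c σ) := by
  rw [cech_d_apply, Finset.sum_eq_single j]
  · rw [Finset.erase_insert hσ]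
  · intro w _ hw
    rw [hc _ (Finset.mem_erase.2 ⟨hw.symm, Finset.mem_insert_self _ _⟩), map_zero, smul_zero]
  · exact fun h => absurd (Finset.mem_insert_self _ _) h

omit [Fintype ι] in
theorem sgn_smul_sgn_smul {M : Type*} [AddCommGroup M] [Module A M] (τ : Finset ι) (w : ι)
    (m : M) : (sgn τ w : A) • (sgn τ w : A) • m = m := by
  rw [smul_smul, ← Int.cast_mul, sgn_mul_self, Int.cast_one, one_smul]

/-- Subtracting the coboundary of a lift of the components at sets containing `j`, possible after
multiplication by a power of `f j`, leaves a cocycle `c'` supported on sets without `j`. The cocycle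
condition at `insert j σ` then says that `c' σ` dies when `f j` is inverted, so a further power
kills it. -/
theorem cech_torsion (f : ι → A) {c : (cech f).Cochain} (hc : (cech f).d c = 0) (j : ι) :
    ∃ n : ℕ, f j ^ n • c ∈ LinearMap.range (cech f).d := by
  have hel : ∀ σ : {σ : Finset ι // j ∉ σ},
      ∏ i ∈ insert j σ.1, f i = f j * ∏ i ∈ σ.1, f i := fun σ => Finset.prod_insert σ.2
  obtain ⟨n, m, hm⟩ := LocSystem.exists_pow_smul_eq hel fun σ => c (insert j σ.1)
  let b : (cech f).Cochain := fun σ =>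
    if h : j ∉ σ then (sgn (insert j σ) j : A) • m ⟨σ, h⟩ else 0
  have hb : ∀ σ, j ∈ σ → b σ = 0 := fun σ h => dif_neg (not_not.2 h)
  let c' := f j ^ n • c - (cech f).d b
  have hc'0 : ∀ σ, j ∈ σ → c' σ = 0 := by
    intro σ hσ
    obtain ⟨τ, hτ, rfl⟩ : ∃ τ, j ∉ τ ∧ σ = insert j τ :=
      ⟨σ.erase j, Finset.notMem_erase _ _, (Finset.insert_erase hσ).symm⟩
    simp only [c', Pi.sub_apply, Pi.smul_apply]
    rw [cech_d_insert hb hτ, sub_eq_zero, hm ⟨τ, hτ⟩]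
    simp only [b, dif_pos hτ]
    rw [map_smul, sgn_smul_sgn_smul]
  have hc'd : (cech f).d c' = 0 := by
    simp only [c']
    rw [map_sub, map_smul, hc, smul_zero, LocSystem.d_d, sub_zero]
  obtain ⟨l, hl⟩ := LocSystem.exists_pow_smul_zero hel (fun σ => c' σ.1) fun σ => by
    have h := congrFun hc'd (insert j σ.1)
    rw [cech_d_insert hc'0 σ.2] at h
    rw [← sgn_smul_sgn_smul (A := A) (insert j σ.1) j (tr _ _ (c' σ.1)), h, Pi.zero_apply,
      smul_zero]
  have hl' : f j ^ l • c' = 0 := by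
    ext σ
    by_cases hσ : j ∈ σ
    · rw [Pi.smul_apply, hc'0 σ hσ, smul_zero, Pi.zero_apply]
    · exact congrFun hl ⟨σ, hσ⟩
  refine ⟨l + n, f j ^ l • b, ?_⟩
  rw [map_smul, pow_add, mul_smul, ← sub_eq_zero, ← smul_sub, ← neg_eq_zero, ← smul_neg, neg_sub]
  exact hl'

/-- The radical of the annihilator of an element modulo a submodule contains an ideal as soon as
it contains generators. -/
theorem exists_pow_smul_mem_of_mem_radical {M : Type*} [AddCommGroup M] [Module A M]
    (N : Submodule A M) (c : M) {S : Set A} (hS : ∀ a ∈ S, ∃ n : ℕ, a ^ n • c ∈ N) {h : A}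
    (hh : h ∈ (Ideal.span S).radical) : ∃ n : ℕ, h ^ n • c ∈ N := by
  let I : Ideal A := N.comap (LinearMap.toSpanSingleton A M c)
  have hI : Ideal.span S ≤ I.radical := Ideal.span_le.2 fun a ha => hS a ha
  exact (Ideal.radical_le_radical_iff.2 hI) hh

end LocComplex

end

/-! ### Exactness by levels and total complexes -/

noncomputable section

namespace LocComplex

variable {A : Type*} [CommRing A]

namespace LocSystem

/-- The spectral sequence argument for a filtered complex in elementary form. The differential never
lowers the level, and cochains vanishing on `S` form a subcomplex. It is then enough to solve the
equation one level at a time, with only the level-preserving part of the differential involved. -/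
theorem exact_of_levels {J : Type*} [Fintype J] (Y : LocSystem A J) (lev : J → ℕ)
    (hlev : ∀ {i j}, Y.inc i j ≠ 0 → lev i ≤ lev j) (S : J → Prop)
    (hS : ∀ {i j}, Y.inc i j ≠ 0 → S j → S i)
    (hex : ∀ q (w : Y.Cochain), (∀ j, lev j ≠ q → w j = 0) → (∀ j, S j → w j = 0) →
      (∀ j, lev j = q → Y.d w j = 0) → ∃ b : Y.Cochain, (∀ j, S j → b j = 0) ∧
        (∀ j, lev j < q → b j = 0) ∧ ∀ j, lev j = q → Y.d b j = w j)
    {w : Y.Cochain} (hw : ∀ j, S j → w j = 0) (hd : Y.d w = 0) :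
    ∃ b : Y.Cochain, (∀ j, S j → b j = 0) ∧ Y.d b = w := by
  classical
  let F : ℕ → AddSubgroup Y.Cochain := fun q =>
    { carrier := {w | (∀ j, S j → w j = 0) ∧ ∀ j, lev j < q → w j = 0}
      zero_mem' := ⟨fun _ _ => rfl, fun _ _ => rfl⟩
      add_mem' := fun {x y} hx hy =>
        ⟨fun j hj => by rw [Pi.add_apply, hx.1 j hj, hy.1 j hj, add_zero],
          fun j hj => by rw [Pi.add_apply, hx.2 j hj, hy.2 j hj, add_zero]⟩
      neg_mem' := fun {x} hx =>
        ⟨fun j hj => by rw [Pi.neg_apply, hx.1 j hj, neg_zero],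
          fun j hj => by rw [Pi.neg_apply, hx.2 j hj, neg_zero]⟩ }
  have hDF : ∀ q b, b ∈ F q → Y.d b ∈ F q := by
    intro q b hb
    refine ⟨fun j hj => ?_, fun j hj => ?_⟩ <;> rw [d_apply] <;>
      refine Finset.sum_eq_zero fun i _ => ?_ <;>
      rcases eq_or_ne (Y.inc i j) 0 with h0 | h0
    · simp [h0]
    · rw [hb.1 i (hS h0 hj), map_zero, smul_zero]
    · simp [h0]
    · rw [hb.2 i ((hlev h0).trans_lt hj), map_zero, smul_zero]
  obtain ⟨b, hb, h⟩ := exists_of_filtration Y.d.toAddMonoidHom Y.d_d F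
    -- This number exceeds every level, so the filtration is zero from there on.
    ((∑ j, lev j) + 1) ((AddSubgroup.eq_bot_iff_forall _).2 fun w hw => funext fun j =>
      hw.2 j (Nat.lt_succ_of_le
        (Finset.single_le_sum (fun _ _ => Nat.zero_le _) (Finset.mem_univ j))))
    (fun q w hw hDw => by
      -- The part of `w` in the lowest level; its differential agrees with that of `w` in level `q`,
      -- because `w` has nothing below and higher levels do not map down.
      let w' : Y.Cochain := fun j => if lev j = q then w j else 0
      obtain ⟨b, hbS, hbq, hb⟩ := hex q w' (fun j hj => if_neg hj)
        (fun j hj => by simp only [w']; split_ifs; exacts [hw.1 j hj, rfl])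
        (fun j hj => by
          have h : Y.d w j = 0 := congrFun hDw j
          rw [d_apply] at h ⊢
          rw [← h]
          refine Finset.sum_congr rfl fun i _ => ?_
          rcases eq_or_ne (Y.inc i j) 0 with h0 | h0
          · simp [h0]
          · simp only [w']
            split_ifs with hi
            · rfl
            · rw [hw.2 i (lt_of_le_of_ne (hj ▸ hlev h0) hi)])
      have hbF : b ∈ F q := ⟨hbS, hbq⟩
      refine ⟨b, hbF, ((F q).sub_mem hw (hDF q b hbF)).1, fun j hj => ?_⟩
      rcases Nat.lt_succ_iff_lt_or_eq.1 hj with hj | hj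
      · exact ((F q).sub_mem hw (hDF q b hbF)).2 j hj
      · change w j - Y.d b j = 0
        rw [hb j hj]
        simp only [w', if_pos hj, sub_self])
    (fun q w hw => ⟨hw.1, fun j hj => hw.2 j (Nat.lt_succ_of_lt hj)⟩)
    (Nat.zero_le _) (w := w) ⟨hw, fun j hj => absurd hj (Nat.not_lt_zero _)⟩ hd
  exact ⟨b, hb.1, h⟩

end LocSystem

/-! ### The Cech complex with coefficients in a complex of localizations -/

section Tot

variable {ι : Type*} [LinearOrder ι] [Fintype ι] {I : Type*} [Fintype I]

open Classical in
/-- The incidence numbers of the total complex. -/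
def totInc (X : LocSystem A I) (p q : Finset ι × I) : ℤ :=
  (if p.2 = q.2 then incidence p.1 q.1 else 0) +
    (if p.1 = q.1 then (-1) ^ p.1.card * X.inc p.2 q.2 else 0)

omit [Fintype ι] in
theorem totInc_ne_zero {X : LocSystem A I} {p q : Finset ι × I} (h : totInc X p q ≠ 0) :
    (p.2 = q.2 ∧ incidence p.1 q.1 ≠ 0) ∨ (p.1 = q.1 ∧ X.inc p.2 q.2 ≠ 0) := by
  by_contra! hc
  refine h ?_
  rw [totInc]
  split_ifs with h1 h2 h2
  · rw [hc.1 h1, hc.2 h2, mul_zero, add_zero]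
  · rw [hc.1 h1, add_zero]
  · rw [hc.2 h2, mul_zero, add_zero]
  · rw [add_zero]

theorem sum_totInc_smul (X : LocSystem A I) {B M : Type*} [CommRing B] [AddCommGroup M]
    [Module B M] (f : Finset ι × I → M) (q : Finset ι × I) :
    ∑ p, (totInc X p q : B) • f p =
      ∑ σ, (incidence σ q.1 : B) • f (σ, q.2) +
        (-1 : B) ^ q.1.card • ∑ i, (X.inc i q.2 : B) • f (q.1, i) := by
  classical
  simp only [totInc, Int.cast_add, add_smul, Finset.sum_add_distrib]
  congr 1
  · rw [Fintype.sum_prod_type]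
    refine Finset.sum_congr rfl fun σ _ => ?_
    rw [Finset.sum_eq_single q.2]
    · simp
    · intro i _ hi
      simp [hi]
    · simp
  · rw [Fintype.sum_prod_type_right, Finset.smul_sum]
    refine Finset.sum_congr rfl fun i _ => ?_
    rw [Finset.sum_eq_single q.1]
    · simp only [if_true]
      rw [Int.cast_mul, mul_smul, Int.cast_pow, Int.cast_neg, Int.cast_one]
    · intro σ _ hσ
      simp [hσ]
    · simp

/-- The total complex. -/
@[reducible] def tot (f : ι → A) (X : LocSystem A I) : LocSystem A (Finset ι × I) where
  el p := (∏ i ∈ p.1, f i) * X.el p.2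
  inc := totInc X
  deg p := p.1.card + X.deg p.2
  dvd {p q} h := by
    rcases totInc_ne_zero h with ⟨h1, h2⟩ | ⟨h1, h2⟩
    · rw [h1]; exact mul_dvd_mul_right ((cech f).dvd h2) _
    · rw [h1]; exact mul_dvd_mul_left _ (X.dvd h2)
  deg_eq {p q} h := by
    rcases totInc_ne_zero h with ⟨h1, h2⟩ | ⟨h1, h2⟩
    · rw [h1, show q.1.card = p.1.card + 1 from (cech f).deg_eq h2]; ring
    · rw [h1, X.deg_eq h2]; ring
  sq p r := by
    classical
    have h := sum_totInc_smul X (B := ℤ) (fun q => totInc X p q) r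
    simp only [smul_eq_mul, Int.cast_id] at h
    simp only [mul_comm (totInc X p _), h]
    have h1 : ∑ σ, incidence σ r.1 * totInc X p (σ, r.2) =
        incidence p.1 r.1 * ((-1) ^ p.1.card * X.inc p.2 r.2) := by
      simp only [totInc, mul_add, Finset.sum_add_distrib, mul_ite, mul_zero]
      rw [Finset.sum_ite_eq Finset.univ p.1, if_pos (Finset.mem_univ _), add_eq_right]
      split_ifs
      · simp only [mul_comm (incidence _ r.1), incidence_sq]
      · exact Finset.sum_const_zero
    have h2 : ∑ i, X.inc i r.2 * totInc X p (r.1, i) = X.inc p.2 r.2 * incidence p.1 r.1 := by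
      simp only [totInc, mul_add, Finset.sum_add_distrib, mul_ite, mul_zero]
      rw [Finset.sum_ite_eq Finset.univ p.2, if_pos (Finset.mem_univ _), add_eq_left]
      split_ifs
      · simp only [mul_left_comm (X.inc _ r.2), mul_comm (X.inc _ r.2), ← Finset.mul_sum, X.sq,
          mul_zero]
      · exact Finset.sum_const_zero
    rw [h1, h2]
    -- Only the two mixed terms remain. They cancel because the sign `(-1) ^ card` changes when the
    -- first component gains an element.
    rcases eq_or_ne (incidence p.1 r.1) 0 with h0 | h0
    · simp [h0]
    · rw [show r.1.card = p.1.card + 1 from (cech f).deg_eq h0, pow_succ]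
      ring

variable (f : ι → A) (X : LocSystem A I)

theorem tot_d_apply (w : (tot f X).Cochain) (σ : Finset ι) (i : I) :
    (tot f X).d w (σ, i) =
      ∑ σ', (incidence σ' σ : A) • tr ((∏ i ∈ σ', f i) * X.el i) ((∏ i ∈ σ, f i) * X.el i)
        (w (σ', i)) +
      (-1 : A) ^ σ.card • ∑ i', (X.inc i' i : A) •
        tr ((∏ i ∈ σ, f i) * X.el i') ((∏ i ∈ σ, f i) * X.el i) (w (σ, i')) := by
  rw [LocSystem.d_apply]
  exact sum_totInc_smul X
    (fun p => tr ((∏ i ∈ p.1, f i) * X.el p.2) ((∏ i ∈ σ, f i) * X.el i) (w p)) (σ, i)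

/-- The row of the total complex at `i`. -/
@[reducible] def row (i : I) : LocSystem A (Finset ι) :=
  (cech f).twist (X.el i) (fun σ => (∏ i ∈ σ, f i) * X.el i) fun _ => mul_comm _ _

/-- The column of the total complex at `σ`. -/
@[reducible] def col (σ : Finset ι) : LocSystem A I :=
  X.twist (∏ i ∈ σ, f i) (fun i => (∏ i ∈ σ, f i) * X.el i) fun _ => rfl

theorem tot_d_apply' (w : (tot f X).Cochain) (σ : Finset ι) (i : I) :
    (tot f X).d w (σ, i) = (row f X i).d (fun σ => w (σ, i)) σ +
      (-1 : A) ^ σ.card • (col f X σ).d (fun i => w (σ, i)) i := by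
  rw [tot_d_apply, LocSystem.d_apply, LocSystem.d_apply]

theorem neg_one_pow_smul_smul {M : Type*} [AddCommGroup M] [Module A M] (n : ℕ) (m : M) :
    ((-1 : A) ^ n) • ((-1 : A) ^ n) • m = m := by
  rw [smul_smul, ← mul_pow, neg_one_mul, neg_neg, one_pow, one_smul]

variable {f X} {o : I}

/-- The total complex is exact away from a column with exact rows. -/
theorem tot_exact_of_rows (ho : X.deg o = 0)
    (hrow : ∀ i, i ≠ o → ∀ w, (row f X i).d w = 0 → ∃ b, (row f X i).d b = w)
    {w : (tot f X).Cochain} (hw : ∀ σ, w (σ, o) = 0) (hd : (tot f X).d w = 0) :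
    ∃ b : (tot f X).Cochain, (∀ σ, b (σ, o) = 0) ∧ (tot f X).d b = w := by
  classical
  -- No arrow ends in degree 0, so the cochains that vanish over `o` are closed under the
  -- differential.
  have hinc : ∀ i, X.inc i o = 0 := by
    intro i
    by_contra h
    have := X.deg_eq h
    omega
  -- With the degree in `X` as level, the level-preserving part of the differential is the row
  -- differential.
  obtain ⟨b, hb, h⟩ := (tot f X).exact_of_levels (fun p => X.deg p.2)
    (fun {p q} h => by
      rcases totInc_ne_zero h with ⟨h1, h2⟩ | ⟨h1, h2⟩
      · rw [h1]
      · rw [X.deg_eq h2]; omega)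
    (fun p => p.2 = o)
    (fun {p q} h hq => by
      rcases totInc_ne_zero h with ⟨h1, h2⟩ | ⟨h1, h2⟩
      · rw [h1]; exact hq
      · rw [hq] at h2; exact absurd (hinc _) h2)
    (fun q w hwq hwS hwd => by
      have hcol : ∀ (y : (tot f X).Cochain), (∀ p : Finset ι × I, X.deg p.2 < q → y p = 0) →
          ∀ σ i, X.deg i ≤ q → (col f X σ).d (fun i => y (σ, i)) i = 0 := by
        intro y hy σ i hi
        rw [LocSystem.d_apply]
        refine Finset.sum_eq_zero fun i' _ => ?_
        rcases eq_or_ne (X.inc i' i) 0 with h0 | h0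
        · simp [h0]
        · rw [hy (σ, i') (by have := X.deg_eq h0; simp only; omega), map_zero, smul_zero]
      have hr : ∀ i, ∃ b, X.deg i = q → i ≠ o → (row f X i).d b = fun σ => w (σ, i) := by
        intro i
        by_cases hi : X.deg i = q ∧ i ≠ o
        · obtain ⟨b, hb⟩ := hrow i hi.2 (fun σ => w (σ, i)) (funext fun σ => by
            have := hwd (σ, i) hi.1
            rw [tot_d_apply', hcol w (fun p hp => hwq p hp.ne) σ i hi.1.le, smul_zero,
              add_zero] at this
            exact this)
          exact ⟨b, fun _ _ => hb⟩
        · exact ⟨0, fun h1 h2 => absurd ⟨h1, h2⟩ hi⟩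
      choose b hb using hr
      let y : (tot f X).Cochain := fun p => if X.deg p.2 = q ∧ p.2 ≠ o then b p.2 p.1 else 0
      have hyq : ∀ p : Finset ι × I, X.deg p.2 < q → y p = 0 :=
        fun p hp => if_neg fun h => hp.ne h.1
      refine ⟨y, fun p hp => if_neg fun h => h.2 hp, hyq, fun p hp => ?_⟩
      obtain ⟨σ, i⟩ := p
      rw [tot_d_apply', hcol y hyq σ i hp.le, smul_zero, add_zero]
      by_cases hi : i = o
      · have : (fun σ => y (σ, i)) = (0 : (row f X i).Cochain) :=
          funext fun σ => if_neg fun h => h.2 hi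
        rw [this, map_zero, Pi.zero_apply, hwS (σ, i) hi]
      · have : (fun σ => y (σ, i)) = b i := funext fun σ => if_pos ⟨hp, hi⟩
        rw [this, hb i hp hi])
    (w := w) (fun p hp => by
      obtain ⟨σ, i⟩ := p
      obtain rfl : i = o := hp
      exact hw σ) hd
  exact ⟨b, fun σ => hb (σ, o) rfl, h⟩

omit [Fintype ι] in
theorem incidence_empty (σ : Finset ι) : incidence σ ∅ = 0 := by
  rw [incidence, Finset.sum_empty]

/-- The total complex is exact away from the row `σ = ∅` if the other columns are exact. -/
theorem tot_exact_of_cols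
    (hcol : ∀ σ, σ ≠ ∅ → ∀ w, (col f X σ).d w = 0 → ∃ b, (col f X σ).d b = w)
    {w : (tot f X).Cochain} (hw : ∀ i, w (∅, i) = 0) (hd : (tot f X).d w = 0) :
    ∃ b : (tot f X).Cochain, (∀ i, b (∅, i) = 0) ∧ (tot f X).d b = w := by
  classical
  -- With the size of `σ` as level, the level-preserving part is the column differential up to sign.
  obtain ⟨b, hb, h⟩ := (tot f X).exact_of_levels (fun p => p.1.card)
    (fun {p q} h => by
      rcases totInc_ne_zero h with ⟨h1, h2⟩ | ⟨h1, h2⟩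
      · rw [show q.1.card = p.1.card + 1 from (cech f).deg_eq h2]; omega
      · rw [h1])
    (fun p => p.1 = ∅)
    (fun {p q} h hq => by
      rcases totInc_ne_zero h with ⟨h1, h2⟩ | ⟨h1, h2⟩
      · rw [hq, incidence_empty] at h2; exact absurd rfl h2
      · rw [h1]; exact hq)
    (fun q w hwq hwS hwd => by
      have hrow : ∀ (y : (tot f X).Cochain), (∀ p : Finset ι × I, p.1.card < q → y p = 0) →
          ∀ σ i, σ.card ≤ q → (row f X i).d (fun σ => y (σ, i)) σ = 0 := by
        intro y hy σ i hi
        rw [LocSystem.d_apply]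
        refine Finset.sum_eq_zero fun σ' _ => ?_
        rcases eq_or_ne (incidence σ' σ) 0 with h0 | h0
        · simp [h0]
        · rw [hy (σ', i) (by have : σ.card = _ := (cech f).deg_eq h0; simp only at this ⊢; omega),
            map_zero, smul_zero]
      have hr : ∀ σ, ∃ b, σ.card = q → σ ≠ ∅ → (col f X σ).d b = fun i => w (σ, i) := by
        intro σ
        by_cases hi : σ.card = q ∧ σ ≠ ∅
        · obtain ⟨b, hb⟩ := hcol σ hi.2 (fun i => w (σ, i)) (funext fun i => by
            have := hwd (σ, i) hi.1
            rw [tot_d_apply', hrow w (fun p hp => hwq p hp.ne) σ i hi.1.le, zero_add] at this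
            rw [← neg_one_pow_smul_smul (A := A) σ.card ((col f X σ).d (fun i => w (σ, i)) i), this,
              smul_zero]
            rfl)
          exact ⟨b, fun _ _ => hb⟩
        · exact ⟨0, fun h1 h2 => absurd ⟨h1, h2⟩ hi⟩
      choose b hb using hr
      -- The sign compensates the one in front of the column differential.
      let y : (tot f X).Cochain := fun p =>
        if p.1.card = q ∧ p.1 ≠ ∅ then ((-1 : A) ^ p.1.card) • b p.1 p.2 else 0
      have hyq : ∀ p : Finset ι × I, p.1.card < q → y p = 0 :=
        fun p hp => if_neg fun h => hp.ne h.1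
      refine ⟨y, fun p hp => if_neg fun h => h.2 hp, hyq, fun p hp => ?_⟩
      obtain ⟨σ, i⟩ := p
      rw [tot_d_apply', hrow y hyq σ i hp.le, zero_add]
      by_cases hi : σ = ∅
      · have : (fun i => y (σ, i)) = (0 : (col f X σ).Cochain) :=
          funext fun σ => if_neg fun h => h.2 hi
        rw [this, map_zero, Pi.zero_apply, smul_zero, hwS (σ, i) hi]
      · have : (fun i => y (σ, i)) = ((-1 : A) ^ σ.card) • b σ := funext fun i => if_pos ⟨hp, hi⟩
        rw [this, map_smul, Pi.smul_apply, neg_one_pow_smul_smul, hb σ hp hi])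
    (w := w) (fun p hp => by
      obtain ⟨σ, i⟩ := p
      obtain rfl : σ = ∅ := hp
      exact hw i) hd
  exact ⟨b, fun i => hb (∅, i) rfl, h⟩

end Tot

end LocComplex

end

/-! ### The two projections of the total complex and Čech cohomology -/

noncomputable section

namespace LocComplex

/-- A surjective chain map with acyclic kernel is a quasi-isomorphism. -/
theorem lift_cocycle {A T X : Type*} [CommRing A] [AddCommGroup T] [AddCommGroup X] [Module A T]
    [Module A X] (D : T →ₗ[A] T) (d : X →ₗ[A] X) (pr : T →ₗ[A] X)
    (hpr : ∀ w, pr (D w) = d (pr w)) (hsurj : Function.Surjective pr) (hDD : ∀ w, D (D w) = 0)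
    (hker : ∀ w, pr w = 0 → D w = 0 → ∃ b, pr b = 0 ∧ D b = w) :
    (∀ z, d z = 0 → ∃ w, D w = 0 ∧ pr w = z) ∧
      ∀ w, D w = 0 → (pr w ∈ LinearMap.range d ↔ w ∈ LinearMap.range D) := by
  refine ⟨fun z hz => ?_, fun w hw => ⟨?_, ?_⟩⟩
  · obtain ⟨w, rfl⟩ := hsurj z
    obtain ⟨b, hb, hbw⟩ := hker (D w) (by rw [hpr, hz]) (hDD w)
    exact ⟨w - b, by rw [map_sub, hbw, sub_self], by rw [map_sub, hb, sub_zero]⟩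
  · rintro ⟨y, hy⟩
    obtain ⟨v, rfl⟩ := hsurj y
    obtain ⟨b, -, hbw⟩ := hker (w - D v) (by rw [map_sub, hpr, hy, sub_self])
      (by rw [map_sub, hw, hDD, sub_zero])
    exact ⟨v + b, by rw [map_add, hbw, add_sub_cancel]⟩
  · rintro ⟨b, rfl⟩
    exact ⟨pr b, (hpr b).symm⟩

variable {A : Type*} [CommRing A]

namespace LocSystem

variable {J : Type*} [Fintype J] (X : LocSystem A J)

/-- The cocycles of degree `p`. -/
def cocycles (p : ℕ) : Submodule A X.Cochain :=
  LinearMap.ker X.d ⊓ LinearMap.eqLocus (X.comp p) LinearMap.id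

variable {X}

theorem mem_cocycles {p : ℕ} {c : X.Cochain} : c ∈ X.cocycles p ↔ X.d c = 0 ∧ X.comp p c = c :=
  Iff.rfl

end LocSystem

section Comparison

variable {ι : Type*} [LinearOrder ι] [Fintype ι] {I : Type*} [Fintype I]
variable (f : ι → A) (X : LocSystem A I) (o : I)

/-- The projection of the total complex to the Cech complex. -/
def prCech : (tot f X).Cochain →ₗ[A] (cech f).Cochain :=
  LinearMap.pi fun σ => tr ((∏ i ∈ σ, f i) * X.el o) (∏ i ∈ σ, f i) ∘ₗ LinearMap.proj (σ, o)

/-- The projection of the total complex to the complex of coefficients. -/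
def prCoeff : (tot f X).Cochain →ₗ[A] X.Cochain :=
  LinearMap.pi fun i => tr ((∏ i ∈ ∅, f i) * X.el i) (X.el i) ∘ₗ LinearMap.proj (∅, i)

theorem prCech_apply (w : (tot f X).Cochain) (σ : Finset ι) :
    prCech f X o w σ = tr ((∏ i ∈ σ, f i) * X.el o) (∏ i ∈ σ, f i) (w (σ, o)) := rfl

theorem prCoeff_apply (w : (tot f X).Cochain) (i : I) :
    prCoeff f X w i = tr ((∏ i ∈ ∅, f i) * X.el i) (X.el i) (w (∅, i)) := rfl

variable {f X o}

theorem LocSystem.inc_eq_zero_of_deg (ho : X.deg o = 0) (i : I) : X.inc i o = 0 := by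
  by_contra h
  have := X.deg_eq h
  omega

theorem prCech_d (h1 : X.el o = 1) (ho : X.deg o = 0) (w : (tot f X).Cochain) :
    prCech f X o ((tot f X).d w) = (cech f).d (prCech f X o w) := by
  have hd : ∀ σ : Finset ι, (∏ i ∈ σ, f i) * X.el o ∣ ∏ i ∈ σ, f i := fun σ => by rw [h1, mul_one]
  have hd' : ∀ σ : Finset ι, (∏ i ∈ σ, f i) ∣ (∏ i ∈ σ, f i) * X.el o := fun σ => by
    rw [h1, mul_one]
  ext σ
  rw [prCech_apply, tot_d_apply, LocSystem.d_apply]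
  simp only [X.inc_eq_zero_of_deg ho, Int.cast_zero, zero_smul, Finset.sum_const_zero, smul_zero,
    add_zero]
  rw [map_sum]
  refine Finset.sum_congr rfl fun σ' _ => ?_
  rcases eq_or_ne (incidence σ' σ) 0 with h0 | h0
  · simp [h0]
  · have := (cech f).dvd h0
    rw [map_smul, prCech_apply, tr_tr (mul_dvd_mul_right this _) (hd σ), tr_tr (hd σ') this]

omit [LinearOrder ι] [Fintype ι] in
theorem prod_empty_mul_dvd (a : A) : (∏ i ∈ ∅, f i) * a ∣ a := by rw [Finset.prod_empty, one_mul]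

omit [LinearOrder ι] [Fintype ι] in
theorem dvd_prod_empty_mul (a : A) : a ∣ (∏ i ∈ ∅, f i) * a := by rw [Finset.prod_empty, one_mul]

theorem prCoeff_d (w : (tot f X).Cochain) :
    prCoeff f X ((tot f X).d w) = X.d (prCoeff f X w) := by
  ext i
  rw [prCoeff_apply, tot_d_apply, LocSystem.d_apply]
  simp only [incidence_empty, Int.cast_zero, zero_smul, Finset.sum_const_zero, zero_add,
    Finset.card_empty, pow_zero, one_smul]
  rw [map_sum]
  refine Finset.sum_congr rfl fun i' _ => ?_
  rcases eq_or_ne (X.inc i' i) 0 with h0 | h0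
  · simp only [h0, Int.cast_zero, zero_smul, map_zero]
  · have := X.dvd h0
    rw [map_smul, prCoeff_apply, tr_tr (mul_dvd_mul_left _ this) (prod_empty_mul_dvd _),
      tr_tr (prod_empty_mul_dvd _) this]

theorem prCech_comp (ho : X.deg o = 0) (p : ℕ) (w : (tot f X).Cochain) :
    prCech f X o ((tot f X).comp p w) = (cech f).comp p (prCech f X o w) := by
  ext σ
  simp only [prCech_apply, LocSystem.comp_apply, ho, add_zero]
  split_ifs <;> simp

theorem prCoeff_comp (p : ℕ) (w : (tot f X).Cochain) :
    prCoeff f X ((tot f X).comp p w) = X.comp p (prCoeff f X w) := by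
  ext σ
  simp only [prCoeff_apply, LocSystem.comp_apply, Finset.card_empty, zero_add]
  split_ifs
  · rfl
  · rw [map_zero]

variable (htors : ∀ c, X.d c = 0 → ∀ j, ∃ n : ℕ, f j ^ n • c ∈ LinearMap.range X.d)
  (h1 : X.el o = 1) (ho : X.deg o = 0)
  (hrad : ∀ i, i ≠ o → X.el i ∈ (Ideal.span (Set.range f)).radical)

include h1 ho hrad in
-- The kernel of the projection lives on the rows with `i ≠ o`. Such a row is the Čech complex with
-- `X.el i` inverted; by `cech_torsion` its cohomology was torsion for each `f j`, hence for `X.el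
-- i`, which lies in the radical, so the row is exact.
theorem prCech_quasiIso :
    (∀ z, (cech f).d z = 0 → ∃ w, (tot f X).d w = 0 ∧ prCech f X o w = z) ∧
      ∀ w, (tot f X).d w = 0 →
        (prCech f X o w ∈ LinearMap.range (cech f).d ↔ w ∈ LinearMap.range (tot f X).d) := by
  classical
  have hd : ∀ σ : Finset ι, (∏ i ∈ σ, f i) * X.el o ∣ ∏ i ∈ σ, f i := fun σ => by rw [h1, mul_one]
  have hd' : ∀ σ : Finset ι, (∏ i ∈ σ, f i) ∣ (∏ i ∈ σ, f i) * X.el o := fun σ => by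
    rw [h1, mul_one]
  refine lift_cocycle _ _ _ (prCech_d h1 ho) (fun z => ?_) (tot f X).d_d fun w hw hDw => ?_
  · refine ⟨fun p => if h : p.2 = o then tr (∏ i ∈ p.1, f i) _ (z p.1) else 0, funext fun σ => ?_⟩
    rw [prCech_apply, dif_pos rfl, tr_tr (hd' σ) (hd σ), tr_self_apply]
  · have hw' : ∀ σ, w (σ, o) = 0 := fun σ => tr_injective (hd σ) (hd' σ) (by
      rw [map_zero]
      exact congrFun hw σ)
    obtain ⟨b, hb, hbw⟩ := tot_exact_of_rows ho (fun i hi =>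
      LocSystem.twist_exact _ _ fun c hc => by
        refine exists_pow_smul_mem_of_mem_radical _ c ?_ (hrad i hi)
        rintro _ ⟨j, rfl⟩
        exact cech_torsion f hc j) hw' hDw
    exact ⟨b, funext fun σ => by rw [prCech_apply, hb, map_zero, Pi.zero_apply], hbw⟩

include htors in
-- The kernel of the projection lives on the columns with `σ ≠ ∅`. Such a column is `X` with some `f
-- j` inverted, and the cohomology of `X` is torsion for `f j`.
theorem prCoeff_quasiIso :
    (∀ z, X.d z = 0 → ∃ w, (tot f X).d w = 0 ∧ prCoeff f X w = z) ∧
      ∀ w, (tot f X).d w = 0 →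
        (prCoeff f X w ∈ LinearMap.range X.d ↔ w ∈ LinearMap.range (tot f X).d) := by
  classical
  refine lift_cocycle _ _ _ prCoeff_d (fun z => ?_) (tot f X).d_d fun w hw hDw => ?_
  · refine ⟨fun p => if h : p.1 = ∅ then tr (X.el p.2) _ (z p.2) else 0, funext fun i => ?_⟩
    rw [prCoeff_apply, dif_pos rfl, tr_tr (dvd_prod_empty_mul _) (prod_empty_mul_dvd _),
      tr_self_apply]
  · have hw' : ∀ i, w (∅, i) = 0 := fun i =>
      tr_injective (prod_empty_mul_dvd _) (dvd_prod_empty_mul _) (by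
        rw [map_zero]
        exact congrFun hw i)
    obtain ⟨b, hb, hbw⟩ := tot_exact_of_cols (fun σ hσ =>
      LocSystem.twist_exact _ _ fun c hc => by
        obtain ⟨j, hj⟩ := Finset.nonempty_iff_ne_empty.2 hσ
        obtain ⟨n, hn⟩ := htors c hc j
        obtain ⟨q, hq⟩ := Finset.dvd_prod_of_mem f hj
        refine ⟨n, ?_⟩
        rw [hq, mul_pow, mul_comm, mul_smul]
        exact Submodule.smul_mem _ _ hn) hw' hDw
    exact ⟨b, funext fun σ => by rw [prCoeff_apply, hb, map_zero, Pi.zero_apply], hbw⟩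

include htors in
/-- Cocycles of the complex of coefficients lift to the total complex. -/
theorem prCoeff_surjective_on_cocycles {p : ℕ} {z : X.Cochain} (hz : z ∈ X.cocycles p) :
    ∃ w ∈ (tot f X).cocycles p, prCoeff f X w = z := by
  obtain ⟨w, hw, rfl⟩ := (prCoeff_quasiIso htors).1 z hz.1
  exact ⟨(tot f X).comp p w, ⟨LocSystem.d_comp_eq_zero _ _ hw, LocSystem.comp_comp _ _ _⟩, by
    rw [prCoeff_comp]; exact hz.2⟩

theorem prCoeff_mem_cocycles {p : ℕ} {w : (tot f X).Cochain} (hw : w ∈ (tot f X).cocycles p) :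
    prCoeff f X w ∈ X.cocycles p := by
  refine ⟨?_, ?_⟩
  · change X.d _ = 0
    rw [← prCoeff_d, LinearMap.mem_ker.1 hw.1, map_zero]
  · change X.comp p _ = _
    rw [← prCoeff_comp, (LocSystem.mem_cocycles.1 hw).2]
    rfl

end Comparison

/-! ### Cech cohomology from the total complex -/

section Frozen

variable {N : ℕ} (f : Fin N → A)

/-- The part of degree `p` of a cochain. -/
def restr (p : ℕ) : (cech f).Cochain →ₗ[A] Cech.Cochain f p :=
  LinearMap.pi fun σ => LinearMap.proj σ.1

theorem restr_apply (p : ℕ) (c : (cech f).Cochain) (σ : {σ : Finset (Fin N) // σ.card = p}) :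
    restr f p c σ = c σ.1 := rfl

/-- Extension of a cochain of degree `p` by zero. -/
def extend (p : ℕ) (c : Cech.Cochain f p) : (cech f).Cochain :=
  fun σ => if h : σ.card = p then c ⟨σ, h⟩ else 0

theorem restr_extend (p : ℕ) (c : Cech.Cochain f p) : restr f p (extend f p c) = c :=
  funext fun σ => dif_pos σ.2

theorem comp_extend (p : ℕ) (c : Cech.Cochain f p) :
    (cech f).comp p (extend f p c) = extend f p c := by
  ext σ
  rw [LocSystem.comp_apply]
  split_ifs with h
  · rfl
  · rw [extend, dif_neg h]

theorem eq_of_restr_eq {p : ℕ} {c c' : (cech f).Cochain} (hc : (cech f).comp p c = c)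
    (hc' : (cech f).comp p c' = c') (h : restr f p c = restr f p c') : c = c' := by
  ext σ
  rw [← hc, ← hc', LocSystem.comp_apply, LocSystem.comp_apply]
  split_ifs with hσ
  · exact congrFun h ⟨σ, hσ⟩
  · rfl

/-- Connects `Cech.d`, which is given degree by degree, with the differential of `cech f`, which
acts on all degrees at once. -/
theorem restr_d (p : ℕ) (c : (cech f).Cochain) :
    restr f (p + 1) ((cech f).d c) = Cech.d f p (restr f p c) := by
  ext τ
  rw [restr_apply, cech_d_apply, Cech.d, LinearMap.pi_apply, LinearMap.sum_apply,
    ← Finset.sum_coe_sort]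
  refine Finset.sum_congr rfl fun i _ => ?_
  rw [LinearMap.smul_apply, LinearMap.comp_apply, LinearMap.proj_apply, restr_apply, sgn, tr,
    dif_pos (Finset.prod_dvd_prod_of_subset _ _ _ (Finset.erase_subset _ _)), Int.cast_pow,
    Int.cast_neg, Int.cast_one]
  rfl

variable {f} {I : Type*} [Fintype I] {X : LocSystem A I} {o : I}

theorem restr_prCech_mem (h1 : X.el o = 1) (ho : X.deg o = 0) {p : ℕ} {w : (tot f X).Cochain}
    (hw : w ∈ (tot f X).cocycles p) : restr f p (prCech f X o w) ∈ Cech.cocycles f p := by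
  rw [Cech.cocycles, LinearMap.mem_ker, ← restr_d, ← prCech_d h1 ho, LinearMap.mem_ker.1 hw.1,
    map_zero, map_zero]

/-- The map from cocycles of the total complex to Cech cocycles. -/
def toCechCocycles (h1 : X.el o = 1) (ho : X.deg o = 0) (p : ℕ) :
    (tot f X).cocycles p →ₗ[A] Cech.cocycles f p :=
  ((restr f p ∘ₗ prCech f X o) ∘ₗ ((tot f X).cocycles p).subtype).codRestrict _
    fun w => restr_prCech_mem h1 ho w.2

theorem toCechCocycles_surjective (h1 : X.el o = 1) (ho : X.deg o = 0)
    (hrad : ∀ i, i ≠ o → X.el i ∈ (Ideal.span (Set.range f)).radical) (p : ℕ) :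
    Function.Surjective (toCechCocycles (f := f) h1 ho p) := by
  rintro ⟨z, hz⟩
  have hd : (cech f).d (extend f p z) = 0 := by
    refine eq_of_restr_eq f (p := p + 1) ?_ (map_zero _) ?_
    · rw [LocSystem.comp_d, comp_extend]
    · rw [restr_d, restr_extend, map_zero]
      exact hz
  obtain ⟨w, hw, hwz⟩ := (prCech_quasiIso h1 ho hrad).1 _ hd
  refine ⟨⟨(tot f X).comp p w, LocSystem.d_comp_eq_zero _ _ hw, LocSystem.comp_comp _ _ _⟩,
    Subtype.ext ?_⟩
  change restr f p (prCech f X o ((tot f X).comp p w)) = z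
  rw [prCech_comp ho, hwz, comp_extend, restr_extend]

theorem toCechCocycles_mem_coboundaries (h1 : X.el o = 1) (ho : X.deg o = 0)
    (hrad : ∀ i, i ≠ o → X.el i ∈ (Ideal.span (Set.range f)).radical) (p : ℕ)
    (w : (tot f X).cocycles p) :
    (toCechCocycles (f := f) h1 ho p w : Cech.Cochain f p) ∈ Cech.coboundaries f p ↔
      w.1 ∈ LinearMap.range (tot f X).d := by
  rw [← (prCech_quasiIso h1 ho hrad).2 w.1 w.2.1]
  change restr f p (prCech f X o w.1) ∈ _ ↔ _
  have hc : (cech f).comp p (prCech f X o w.1) = prCech f X o w.1 := by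
    rw [← prCech_comp ho, (LocSystem.mem_cocycles.1 w.2).2]
  -- In degree 0 the coboundaries are zero by definition, in accordance with `comp_zero_d`.
  cases p with
  | zero =>
    change restr f 0 (prCech f X o w.1) ∈ (⊥ : Submodule A _) ↔ _
    rw [Submodule.mem_bot]
    constructor
    · intro h
      rw [eq_of_restr_eq f hc (map_zero _) (h.trans (map_zero _).symm)]
      exact Submodule.zero_mem _
    · rintro ⟨b, hb⟩
      rw [← hc, ← hb, LocSystem.comp_zero_d, map_zero]
  | succ p =>
    change restr f (p + 1) (prCech f X o w.1) ∈ LinearMap.range (Cech.d f p) ↔ _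
    constructor
    · rintro ⟨y, hy⟩
      refine ⟨extend f p y, ?_⟩
      refine eq_of_restr_eq f (p := p + 1) ?_ hc ?_
      · rw [LocSystem.comp_d, comp_extend]
      · rw [restr_d, restr_extend, hy]
    · rintro ⟨b, hb⟩
      exact ⟨restr f p b, by rw [← restr_d, hb]⟩

end Frozen

end LocComplex

end

noncomputable section

namespace LocComplex

/-! ### Cochains on the finite sets that meet every block -/

section Blocks

variable {Q : Type*} [LinearOrder Q] {W : Type*} [AddCommGroup W]

/-- The simplicial coboundary. -/
def bd (c : Finset Q → W) (τ : Finset Q) : W := ∑ w ∈ τ, sgn τ w • c (τ.erase w)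

theorem bd_sub (c c' : Finset Q → W) (τ : Finset Q) :
    bd (fun τ => c τ - c' τ) τ = bd c τ - bd c' τ := by
  simp [bd, smul_sub]

theorem bd_add (c c' : Finset Q → W) (τ : Finset Q) :
    bd (fun τ => c τ + c' τ) τ = bd c τ + bd c' τ := by
  simp [bd, smul_add, Finset.sum_add_distrib]

theorem map_bd {W' : Type*} [AddCommGroup W'] (φ : W →+ W') (c : Finset Q → W) (τ : Finset Q) :
    φ (bd c τ) = bd (fun τ => φ (c τ)) τ := by
  simp [bd, map_sum]

theorem bd_bd [Fintype Q] (c : Finset Q → W) (τ : Finset Q) : bd (bd c) τ = 0 := by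
  have h : ∀ (c : Finset Q → W) τ, bd c τ = ∑ σ, incidence σ τ • c σ := by
    intro c τ
    have := sum_incidence_smul (A := ℤ) c τ
    simp only [Int.cast_id] at this
    rw [this, bd]
  simp only [h, Finset.smul_sum, smul_smul]
  rw [Finset.sum_comm]
  simp only [mul_comm (incidence _ τ), ← Finset.sum_smul, incidence_sq, zero_smul,
    Finset.sum_const_zero]

variable {β : Type*} [DecidableEq β] (b : Q → β)

/-- The finite sets that meet every block. -/
def MeetsAll (τ : Finset Q) : Prop := ∀ i, ∃ q ∈ τ, b q = i

/-- The blocks are intervals for the linear order. -/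
def Contiguous : Prop := ∀ q q' x, b q = b q' → b x ≠ b q → (x < q ↔ x < q')

variable {b}

omit [LinearOrder Q] [DecidableEq β] in
theorem MeetsAll.mono {σ τ : Finset Q} (hσ : MeetsAll b σ) (h : σ ⊆ τ) : MeetsAll b τ :=
  fun i => (hσ i).imp fun _ hq => ⟨h hq.1, hq.2⟩

/-- No element of another block separates `j` from `w`, and `T` contains no third element of their
block, so `j` and `w` are neighbours in `T`. -/
theorem sgn_eq_neg_of_lt (hb : Contiguous b) {T : Finset Q} {j w : Q} (hjw : j < w)
    (hj : j ∈ T) (hbjw : b j = b w) (h : ∀ x ∈ T, b x = b j → x = j ∨ x = w) :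
    sgn T w = -sgn T j := by
  have : T.filter (· < w) = insert j (T.filter (· < j)) := by
    ext x
    simp only [Finset.mem_filter, Finset.mem_insert]
    constructor
    · rintro ⟨hx, hxw⟩
      by_cases hbx : b x = b j
      · rcases h x hx hbx with rfl | rfl
        · exact Or.inl rfl
        · exact absurd hxw (lt_irrefl _)
      · exact Or.inr ⟨hx, (hb j w x hbjw hbx).2 hxw⟩
    · rintro (rfl | ⟨hx, hxj⟩)
      · exact ⟨hj, hjw⟩
      · exact ⟨hx, hxj.trans hjw⟩
  rw [sgn, sgn, this, Finset.card_insert_of_notMem (by simp), pow_succ]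
  ring

theorem sgn_mul_sgn_eq (hb : Contiguous b) {T : Finset Q} {j w : Q} (hjw : j ≠ w)
    (hj : j ∈ T) (hw : w ∈ T) (hbjw : b j = b w) (h : ∀ x ∈ T, b x = b j → x = j ∨ x = w) :
    sgn T w = -sgn T j := by
  rcases lt_or_gt_of_ne hjw with hlt | hlt
  · exact sgn_eq_neg_of_lt hb hlt hj hbjw h
  · rw [sgn_eq_neg_of_lt hb hlt hw hbjw.symm fun x hx hxw => (h x hx (hxw.trans hbjw.symm)).symm,
      neg_neg]

theorem sgn_smul_sgn_smul' (τ : Finset Q) (w : Q) (m : W) : sgn τ w • sgn τ w • m = m := by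
  rw [smul_smul, sgn_mul_self, one_smul]

variable (b) in
open Classical in
/-- The homotopy that removes `j`. -/
def htpy (j : Q) (c : Finset Q → W) (τ : Finset Q) : W :=
  if j ∉ τ ∧ MeetsAll b τ then sgn (insert j τ) j • c (insert j τ) else 0

omit [DecidableEq β] in
theorem meetsAll_erase_iff {τ : Finset Q} (hτ : MeetsAll b τ) {w : Q} :
    MeetsAll b (τ.erase w) ↔ ∃ x ∈ τ, x ≠ w ∧ b x = b w := by
  constructor
  · intro h
    obtain ⟨x, hx, hxw⟩ := h (b w)
    exact ⟨x, Finset.mem_of_mem_erase hx, Finset.ne_of_mem_erase hx, hxw⟩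
  · rintro ⟨x, hx, hxw, hbx⟩ i
    obtain ⟨q, hq, hqi⟩ := hτ i
    by_cases h : q = w
    · exact ⟨x, Finset.mem_erase.2 ⟨hxw, hx⟩, by rw [hbx, ← h, hqi]⟩
    · exact ⟨q, Finset.mem_erase.2 ⟨h, hq⟩, hqi⟩

/-- Inserting `j` would be a contracting homotopy if every face still met all blocks. The defect
sits at the `τ` with a single element `w` in the block of `j`, as removing `w` is not allowed there.
What remains at such a `τ` is the value of `c` with `w` replaced by `j`; contiguity of the blocks
makes its sign positive. -/
theorem sub_bd_htpy (hb : Contiguous b) (j : Q) {c : Finset Q → W}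
    (hc : ∀ τ, ¬ MeetsAll b τ → c τ = 0) (hd : ∀ τ, bd c τ = 0) {τ : Finset Q}
    (hτ : MeetsAll b τ) :
    c τ - bd (htpy b j c) τ =
      if (τ.filter (b · = b j)).card = 1 then c (insert j (τ.filter (b · ≠ b j))) else 0 := by
  classical
  by_cases hj : j ∈ τ
  · have h1 : bd (htpy b j c) τ = if MeetsAll b (τ.erase j) then c τ else 0 := by
      rw [bd, Finset.sum_eq_single j]
      · rw [htpy]
        by_cases h : MeetsAll b (τ.erase j)
        · rw [if_pos ⟨Finset.notMem_erase _ _, h⟩, if_pos h, Finset.insert_erase hj,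
            sgn_smul_sgn_smul']
        · rw [if_neg fun h' => h h'.2, if_neg h, smul_zero]
      · intro w _ hw
        rw [htpy, if_neg (fun h => h.1 (Finset.mem_erase.2 ⟨hw.symm, hj⟩)), smul_zero]
      · exact fun h => absurd hj h
    rw [h1]
    by_cases hcard : (τ.filter (b · = b j)).card = 1
    · obtain ⟨w, hw⟩ := Finset.card_eq_one.1 hcard
      have hmem : ∀ x, x ∈ τ → b x = b j → x = w := fun x hx hbx => by
        have : x ∈ τ.filter (b · = b j) := Finset.mem_filter.2 ⟨hx, hbx⟩
        rwa [hw, Finset.mem_singleton] at this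
      have hjw := hmem j hj rfl
      rw [if_neg, if_pos hcard, sub_zero]
      · congr 1
        ext x
        simp only [Finset.mem_insert, Finset.mem_filter]
        constructor
        · intro hx
          by_cases hbx : b x = b j
          · exact Or.inl ((hmem x hx hbx).trans hjw.symm)
          · exact Or.inr ⟨hx, hbx⟩
        · rintro (rfl | h)
          exacts [hj, h.1]
      · rw [meetsAll_erase_iff hτ]
        rintro ⟨x, hx, hxj, hbx⟩
        exact hxj ((hmem x hx hbx).trans hjw.symm)
    · rw [if_neg hcard, if_pos, sub_self]
      rw [meetsAll_erase_iff hτ]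
      by_contra! h
      refine hcard (Finset.card_eq_one.2 ⟨j, ?_⟩)
      ext x
      simp only [Finset.mem_filter, Finset.mem_singleton]
      exact ⟨fun hx => by_contra fun hne => h x hx.1 hne hx.2, by rintro rfl; exact ⟨hj, rfl⟩⟩
  · set T := insert j τ with hT
    have hjT : j ∈ T := Finset.mem_insert_self _ _
    have hne : ∀ w ∈ τ, w ≠ j := fun w hw h => hj (h ▸ hw)
    have hTe : T.erase j = τ := Finset.erase_insert hj
    have hTw : ∀ w ∈ τ, insert j (τ.erase w) = T.erase w := fun w hw => by
      rw [hT, Finset.erase_insert_of_ne (hne w hw).symm]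
    -- The cocycle condition at `T`, solved for the face `τ` opposite to `j`.
    have h1 : c τ = ∑ w ∈ τ, (-(sgn T j * sgn T w)) • c (T.erase w) := by
      have h := hd T
      rw [bd, hT, Finset.sum_insert hj, ← hT, hTe] at h
      rw [← sgn_smul_sgn_smul' T j (c τ), eq_neg_of_add_eq_zero_left h, smul_neg,
        Finset.smul_sum, ← Finset.sum_neg_distrib]
      refine Finset.sum_congr rfl fun w _ => ?_
      rw [smul_smul, neg_smul]
    have h2 : bd (htpy b j c) τ = ∑ w ∈ τ,
        if MeetsAll b (τ.erase w) then (-(sgn T j * sgn T w)) • c (T.erase w) else 0 := by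
      refine Finset.sum_congr rfl fun w hw => ?_
      rw [htpy]
      by_cases h : MeetsAll b (τ.erase w)
      · rw [if_pos ⟨fun h' => hj (Finset.mem_of_mem_erase h'), h⟩, if_pos h, hTw w hw, smul_smul]
        congr 1
        have ha := sgn_antisymm hjT (Finset.mem_insert_of_mem hw) (hne w hw).symm
        rw [hTe] at ha
        have e1 := sgn_mul_self T j
        have e2 := sgn_mul_self T w
        have e3 : sgn τ w = -(sgn T j * sgn T w * sgn (T.erase w) j) := by
          calc sgn τ w = sgn T j * (sgn T j * sgn τ w) := by rw [← mul_assoc, e1, one_mul]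
            _ = _ := by rw [ha]; ring
        rw [e3, neg_mul, mul_assoc, sgn_mul_self, mul_one]
      · rw [if_neg fun h' => h h'.2, if_neg h, smul_zero]
    rw [h2]
    nth_rewrite 1 [h1]
    rw [← Finset.sum_sub_distrib]
    -- If removing `w` loses a block, inserting `j` repairs this only when the block is that of `j`;
    -- otherwise `c` vanishes at `T.erase w` as well.
    have h3 : ∀ w ∈ τ, ¬ MeetsAll b (τ.erase w) → c (T.erase w) ≠ 0 → b w = b j := by
      intro w hw hnm hc0
      by_contra hbw
      have hm : MeetsAll b (T.erase w) := by
        by_contra h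
        exact hc0 (hc _ h)
      refine hnm fun i => ?_
      obtain ⟨q, hq, hqi⟩ := hm i
      rw [← hTw w hw, Finset.mem_insert] at hq
      rcases hq with rfl | hq
      · obtain ⟨x, hx, hxi⟩ := hτ i
        refine ⟨x, Finset.mem_erase.2 ⟨?_, hx⟩, hxi⟩
        rintro rfl
        exact hbw (hxi.trans hqi.symm)
      · exact ⟨q, hq, hqi⟩
    by_cases hcard : (τ.filter (b · = b j)).card = 1
    · obtain ⟨w, hw⟩ := Finset.card_eq_one.1 hcard
      have hmem : ∀ x, x ∈ τ → b x = b j → x = w := fun x hx hbx => by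
        have : x ∈ τ.filter (b · = b j) := Finset.mem_filter.2 ⟨hx, hbx⟩
        rwa [hw, Finset.mem_singleton] at this
      have hwτ : w ∈ τ ∧ b w = b j := Finset.mem_filter.1 (hw ▸ Finset.mem_singleton_self w)
      rw [if_pos hcard, Finset.sum_eq_single w]
      · rw [if_neg, sub_zero]
        · have hs := sgn_mul_sgn_eq hb (hne w hwτ.1).symm hjT (Finset.mem_insert_of_mem hwτ.1)
            hwτ.2.symm (fun x hx hbx => by
              rcases Finset.mem_insert.1 hx with h | h
              · exact Or.inl h
              · exact Or.inr (hmem x h hbx))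
          rw [hs, mul_neg, sgn_mul_self, neg_neg, one_smul, ← hTw w hwτ.1]
          congr 2
          ext x
          simp only [Finset.mem_erase, Finset.mem_filter]
          constructor
          · rintro ⟨h1, h2⟩
            exact ⟨h2, fun h => h1 (hmem x h2 h)⟩
          · rintro ⟨h1, h2⟩
            exact ⟨fun h => h2 (h ▸ hwτ.2), h1⟩
        · rw [meetsAll_erase_iff hτ]
          rintro ⟨x, hx, hxw, hbx⟩
          exact hxw (hmem x hx (hbx.trans hwτ.2))
      · intro x hx hxw
        split_ifs with hm
        · exact sub_self _
        · rw [sub_zero]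
          by_contra h0
          exact hxw (hmem x hx (h3 x hx hm (right_ne_zero_of_smul h0)))
      · exact fun h => absurd hwτ.1 h
    · rw [if_neg hcard]
      refine Finset.sum_eq_zero fun w hw => ?_
      split_ifs with hm
      · exact sub_self _
      · rw [sub_zero]
        by_contra h0
        have hbw := h3 w hw hm (right_ne_zero_of_smul h0)
        refine hcard (Finset.card_eq_one.2 ⟨w, ?_⟩)
        ext x
        simp only [Finset.mem_filter, Finset.mem_singleton]
        refine ⟨fun hx => ?_, by rintro rfl; exact ⟨hw, hbw⟩⟩
        by_contra hxw
        exact hm ((meetsAll_erase_iff hτ).2 ⟨x, hx.1, hxw, hx.2.trans hbw.symm⟩)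

/-- The cochain is supported on the finite sets that meet every block and contain `N`. -/
def SupportedOn (b : Q → β) (N : Finset Q) (c : Finset Q → W) : Prop :=
  ∀ τ, ¬ (MeetsAll b τ ∧ N ⊆ τ) → c τ = 0

omit [DecidableEq β] in
theorem SupportedOn.bd {N : Finset Q} {c : Finset Q → W} (hc : SupportedOn b N c) :
    SupportedOn b N (bd c) := by
  intro τ hτ
  refine Finset.sum_eq_zero fun w _ => ?_
  rw [hc, smul_zero]
  exact fun h => hτ ⟨h.1.mono (Finset.erase_subset _ _), h.2.trans (Finset.erase_subset _ _)⟩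

/-- The homotopy of `sub_bd_htpy` is applied to the blocks of `D` in turn. Since the inserted
element `j i` is not in `N`, a set that contains `N` after the insertion contained `N` before, and
supports are preserved. -/
theorem exists_sub_bd (hb : Contiguous b) {N : Finset Q} (j : β → Q) (hj : ∀ i, b (j i) = i)
    (D : Finset β) (hD : ∀ i ∈ D, j i ∉ N) {c : Finset Q → W} [Fintype Q]
    (hc : SupportedOn b N c) (hd : ∀ τ, bd c τ = 0) :
    ∃ y : Finset Q → W, SupportedOn b N y ∧ ∀ τ, MeetsAll b τ → c τ - bd y τ =
      if ∀ i ∈ D, (τ.filter (b · = i)).card = 1 then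
        c (τ.filter (b · ∉ D) ∪ D.image j) else 0 := by
  classical
  induction D using Finset.induction_on with
  | empty => exact ⟨0, fun _ _ => rfl, fun τ hτ => by simp [bd]⟩
  | insert i D hi ih =>
    obtain ⟨y, hy, hcy⟩ := ih fun i hi => hD i (Finset.mem_insert_of_mem hi)
    let c1 : Finset Q → W := fun τ => c τ - bd y τ
    have hc1 : SupportedOn b N c1 := fun τ hτ => by
      simp only [c1]; rw [hc τ hτ, hy.bd τ hτ, sub_zero]
    have hd1 : ∀ τ, bd c1 τ = 0 := fun τ => by
      simp only [c1]; rw [bd_sub, hd, bd_bd, sub_zero]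
    refine ⟨fun τ => y τ + htpy b (j i) c1 τ, fun τ hτ => ?_, fun τ hτ => ?_⟩
    · change y τ + htpy b (j i) c1 τ = 0
      rw [hy τ hτ, zero_add, htpy]
      split_ifs with h
      · rw [hc1, smul_zero]
        refine fun h' => hτ ⟨h.2, fun q hq => ?_⟩
        rcases Finset.mem_insert.1 (h'.2 hq) with rfl | h''
        · exact absurd hq (hD i (Finset.mem_insert_self _ _))
        · exact h''
      · rfl
    · rw [bd_add, ← sub_sub]
      change c1 τ - _ = _
      rw [sub_bd_htpy hb (j i) (fun τ hτ => hc1 τ fun h => hτ h.1) hd1 hτ, hj]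
      simp only [Finset.forall_mem_insert]
      by_cases hcard : (τ.filter (b · = i)).card = 1
      · rw [if_pos hcard]
        simp only [hcard, true_and]
        have hm : MeetsAll b (insert (j i) (τ.filter (b · ≠ i))) := by
          intro i'
          by_cases hii : i' = i
          · exact ⟨j i, Finset.mem_insert_self _ _, (hj i).trans hii.symm⟩
          · obtain ⟨q, hq, rfl⟩ := hτ i'
            exact ⟨q, Finset.mem_insert_of_mem (Finset.mem_filter.2 ⟨hq, hii⟩), rfl⟩
        simp only [c1]
        rw [hcy _ hm]
        have e1 : ∀ i' ∈ D, (insert (j i) (τ.filter (b · ≠ i))).filter (b · = i') =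
            τ.filter (b · = i') := by
          intro i' hi'
          have hii : i' ≠ i := fun h => hi (h ▸ hi')
          ext x
          simp only [Finset.mem_filter, Finset.mem_insert]
          constructor
          · rintro ⟨rfl | h, h'⟩
            · exact absurd (h'.symm.trans (hj i)) hii
            · exact ⟨h.1, h'⟩
          · rintro ⟨h, rfl⟩
            exact ⟨Or.inr ⟨h, hii⟩, rfl⟩
        have e2 : (insert (j i) (τ.filter (b · ≠ i))).filter (b · ∉ D) ∪ D.image j =
            τ.filter (b · ∉ insert i D) ∪ (insert i D).image j := by
          ext x
          simp only [Finset.mem_union, Finset.mem_filter, Finset.mem_insert, Finset.mem_image,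
            not_or]
          constructor
          · rintro (⟨rfl | h, h'⟩ | ⟨i', h, rfl⟩)
            · exact Or.inr ⟨i, Or.inl rfl, rfl⟩
            · exact Or.inl ⟨h.1, h.2, h'⟩
            · exact Or.inr ⟨i', Or.inr h, rfl⟩
          · rintro (⟨h1, h2, h3⟩ | ⟨i', rfl | h, rfl⟩)
            · exact Or.inl ⟨Or.inr ⟨h1, h2⟩, h3⟩
            · exact Or.inl ⟨Or.inl rfl, by rwa [hj]⟩
            · exact Or.inr ⟨i', h, rfl⟩
        rw [e2]
        refine if_congr (forall₂_congr fun i' hi' => ?_) rfl rfl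
        rw [e1 i' hi']
      · rw [if_neg hcard, if_neg fun h => hcard h.1]

/-- The finite sets that contain the blocks outside `D` and one element of each block in `D`. -/
def IsCritical (b : Q → β) (D : Finset β) (τ : Finset Q) : Prop :=
  (∀ q, b q ∉ D → q ∈ τ) ∧ ∀ i ∈ D, (τ.filter (b · = i)).card = 1

omit [LinearOrder Q] in
theorem IsCritical.meetsAll {D : Finset β} {τ : Finset Q} (h : IsCritical b D τ)
    (hb : Function.Surjective b) : MeetsAll b τ := by
  intro i
  by_cases hi : i ∈ D
  · obtain ⟨q, hq⟩ := Finset.card_pos.1 ((h.2 i hi).symm ▸ Nat.one_pos)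
    exact ⟨q, Finset.mem_filter.1 hq⟩
  · obtain ⟨q, rfl⟩ := hb i
    exact ⟨q, h.1 q hi, rfl⟩

/-- The standard critical set. -/
def critical [Fintype Q] (b : Q → β) (j : β → Q) (D : Finset β) : Finset Q :=
  Finset.univ.filter (b · ∉ D) ∪ D.image j

theorem isCritical_critical [Fintype Q] {j : β → Q} (hj : ∀ i, b (j i) = i) (D : Finset β) :
    IsCritical b D (critical b j D) := by
  refine ⟨fun q hq => Finset.mem_union_left _ (Finset.mem_filter.2 ⟨Finset.mem_univ _, hq⟩),
    fun i hi => Finset.card_eq_one.2 ⟨j i, ?_⟩⟩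
  ext x
  simp only [critical, Finset.mem_filter, Finset.mem_union, Finset.mem_univ, true_and,
    Finset.mem_image, Finset.mem_singleton]
  constructor
  · rintro ⟨h | ⟨i', _, rfl⟩, rfl⟩
    · exact absurd hi h
    · rw [hj]
  · rintro rfl
    exact ⟨Or.inr ⟨i, hi, rfl⟩, hj i⟩

theorem card_critical [Fintype Q] {j : β → Q} (hj : ∀ i, b (j i) = i) (D : Finset β) :
    (critical b j D).card = (Finset.univ.filter (b · ∉ D)).card + D.card := by
  rw [critical, Finset.card_union_of_disjoint, Finset.card_image_of_injective _
    (Function.LeftInverse.injective hj)]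
  rw [Finset.disjoint_left]
  intro x hx hx'
  obtain ⟨i, hi, rfl⟩ := Finset.mem_image.1 hx'
  exact (Finset.mem_filter.1 hx).2 (by rwa [hj])

open Classical in
/-- A cocycle is determined up to coboundaries by its value at one critical set. -/
theorem exists_sub_bd_critical [Fintype Q] (hb : Contiguous b) {N : Finset Q} (j : β → Q)
    (hj : ∀ i, b (j i) = i) (D : Finset β) (hD : ∀ i ∈ D, j i ∉ N)
    (hN : ∀ q, b q ∉ D → q ∈ N) {c : Finset Q → W}
    (hc : SupportedOn b N c) (hd : ∀ τ, bd c τ = 0) :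
    ∃ y : Finset Q → W, SupportedOn b N y ∧ ∀ τ, c τ - bd y τ =
      if IsCritical b D τ then c (critical b j D) else 0 := by
  obtain ⟨y, hy, h⟩ := exists_sub_bd hb j hj D hD hc hd
  refine ⟨y, hy, fun τ => ?_⟩
  by_cases hτ : MeetsAll b τ
  · rw [h τ hτ]
    by_cases hK : IsCritical b D τ
    · rw [if_pos hK, if_pos hK.2, critical]
      congr 2
      ext q
      simp only [Finset.mem_filter, Finset.mem_univ, true_and, and_iff_right_iff_imp]
      exact hK.1 q
    · rw [if_neg hK]
      split_ifs with hcard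
      · refine hc _ fun h' => hK ⟨fun q hq => ?_, hcard⟩
        rcases Finset.mem_union.1 (h'.2 (hN q hq)) with h'' | h''
        · exact (Finset.mem_filter.1 h'').1
        · obtain ⟨i, hi, rfl⟩ := Finset.mem_image.1 h''
          exact absurd (hN _ hq) (hD i hi)
      · rfl
  · rw [hc _ fun h => hτ h.1, hy.bd _ fun h => hτ h.1, sub_zero, if_neg]
    exact fun hK => hτ (hK.meetsAll (Function.RightInverse.surjective hj))

/-- No face of a critical set is in the support: removing an element either empties a block of `D`
or removes an element of `N`. -/
theorem bd_eq_zero_of_isCritical {D : Finset β} {σ N : Finset Q} (hσ : IsCritical b D σ)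
    (hN : ∀ q, b q ∉ D → q ∈ N) {y : Finset Q → W} (hy : SupportedOn b N y) : bd y σ = 0 := by
  refine Finset.sum_eq_zero fun w hw => ?_
  rw [hy, smul_zero]
  rintro ⟨h1, h2⟩
  by_cases hbw : b w ∈ D
  · obtain ⟨x, hx⟩ := Finset.card_eq_one.1 (hσ.2 _ hbw)
    obtain ⟨q, hq, hqw⟩ := h1 (b w)
    have e1 : w ∈ σ.filter (b · = b w) := Finset.mem_filter.2 ⟨hw, rfl⟩
    have e2 : q ∈ σ.filter (b · = b w) := Finset.mem_filter.2 ⟨Finset.mem_of_mem_erase hq, hqw⟩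
    rw [hx, Finset.mem_singleton] at e1 e2
    exact Finset.ne_of_mem_erase hq (e2.trans e1.symm)
  · exact Finset.notMem_erase _ _ (h2 (hN w hbw))

open Classical in
-- A set with a critical face has exactly two of them: one block of `D` contains two elements, and
-- either may be removed. By contiguity the two signs are opposite.
theorem bd_critical (hb : Contiguous b) (D : Finset β) (y : W) (τ : Finset Q) :
    bd (fun τ => if IsCritical b D τ then y else 0) τ = 0 := by
  by_cases h : ∃ w ∈ τ, IsCritical b D (τ.erase w)
  swap
  · push Not at h
    refine Finset.sum_eq_zero fun w hw => ?_
    simp only [if_neg (h w hw), smul_zero]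
  obtain ⟨w, hw, hK⟩ := h
  have hbw : b w ∈ D := by
    by_contra h
    exact Finset.notMem_erase _ _ (hK.1 w h)
  obtain ⟨v, hv⟩ := Finset.card_eq_one.1 (hK.2 _ hbw)
  have hv' : v ∈ (τ.erase w).filter (b · = b w) := hv ▸ Finset.mem_singleton_self v
  simp only [Finset.mem_filter, Finset.mem_erase] at hv'
  have hmem : ∀ x ∈ τ, b x = b w → x = w ∨ x = v := by
    intro x hx hbx
    by_cases hxw : x = w
    · exact Or.inl hxw
    · have : x ∈ (τ.erase w).filter (b · = b w) :=
        Finset.mem_filter.2 ⟨Finset.mem_erase.2 ⟨hxw, hx⟩, hbx⟩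
      rw [hv, Finset.mem_singleton] at this
      exact Or.inr this
  have hKv : IsCritical b D (τ.erase v) := by
    refine ⟨fun q hq => Finset.mem_erase.2 ⟨?_, Finset.mem_of_mem_erase (hK.1 q hq)⟩,
      fun i hi => ?_⟩
    · rintro rfl
      exact hq (hv'.2 ▸ hbw)
    · by_cases hiw : i = b w
      · refine Finset.card_eq_one.2 ⟨w, ?_⟩
        ext x
        simp only [Finset.mem_filter, Finset.mem_erase, Finset.mem_singleton, hiw]
        constructor
        · rintro ⟨⟨h1, h2⟩, h3⟩
          exact (hmem x h2 h3).resolve_right h1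
        · rintro rfl
          exact ⟨⟨hv'.1.1.symm, hw⟩, rfl⟩
      · rw [← hK.2 i hi]
        congr 1
        ext x
        simp only [Finset.mem_filter, Finset.mem_erase]
        constructor
        · rintro ⟨⟨_, h2⟩, h3⟩
          exact ⟨⟨by rintro rfl; exact hiw h3.symm, h2⟩, h3⟩
        · rintro ⟨⟨_, h2⟩, h3⟩
          exact ⟨⟨by rintro rfl; exact hiw (h3.symm.trans hv'.2), h2⟩, h3⟩
  have hK' : ∀ x ∈ τ, x ≠ w → x ≠ v → ¬ IsCritical b D (τ.erase x) := by
    intro x hx hxw hxv hKx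
    obtain ⟨u, hu⟩ := Finset.card_eq_one.1 (hKx.2 _ hbw)
    have e1 : w ∈ (τ.erase x).filter (b · = b w) := by simp [hw, hxw.symm]
    have e2 : v ∈ (τ.erase x).filter (b · = b w) := by simp [hv', hxv.symm]
    rw [hu, Finset.mem_singleton] at e1 e2
    exact hv'.1.1 (e2.trans e1.symm)
  have hs := sgn_mul_sgn_eq hb hv'.1.1.symm hw hv'.1.2 hv'.2.symm hmem
  rw [bd, ← Finset.sum_subset (s₁ := {w, v})]
  · rw [Finset.sum_pair hv'.1.1.symm]
    simp only [if_pos hK, if_pos hKv, hs, neg_smul, add_neg_cancel]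
  · intro x hx
    rcases Finset.mem_insert.1 hx with rfl | hx
    · exact hw
    · rw [Finset.mem_singleton.1 hx]; exact hv'.1.2
  · intro x hx hx'
    simp only [Finset.mem_insert, Finset.mem_singleton, not_or] at hx'
    simp only [if_neg (hK' x hx hx'.1 hx'.2), smul_zero]

end Blocks

end LocComplex

end

noncomputable section

namespace LocComplex

open MvPolynomial

/-! ### Multigradings of localizations -/

section Grading

variable {k : Type*} [CommRing k] {V : Type*} {D : Type*} [AddCommGroup D] (w : V → D)

/-- The coaction `x_v ↦ t^{w v} x_v`. -/
def coaction (S : Type*) [CommRing S] [Algebra k S] [Algebra (MvPolynomial V k) S] :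
    MvPolynomial V k →ₐ[k] AddMonoidAlgebra S D :=
  aeval fun v => AddMonoidAlgebra.single (w v) (algebraMap (MvPolynomial V k) S (X v))

section

variable {S : Type*} [CommRing S] [Algebra k S] [Algebra (MvPolynomial V k) S]
  [IsScalarTower k (MvPolynomial V k) S]

theorem coaction_monomial (m : V →₀ ℕ) (c : k) :
    coaction w S (monomial m c) =
      AddMonoidAlgebra.single (Finsupp.weight w m) (algebraMap _ S (monomial m c)) := by
  rw [coaction, aeval_monomial, Finsupp.prod]
  simp only [AddMonoidAlgebra.single_pow, AddMonoidAlgebra.prod_single]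
  rw [monomial_eq, map_mul, Finsupp.prod, map_prod, Finsupp.weight_apply, Finsupp.sum,
    AddMonoidAlgebra.coe_algebraMap, Function.comp_apply, AddMonoidAlgebra.single_mul_single,
    zero_add]
  simp only [map_pow]
  rw [← MvPolynomial.algebraMap_eq, ← IsScalarTower.algebraMap_apply]

theorem coeff_coaction (p : MvPolynomial V k) (a : D) :
    (coaction w S p).coeff a = algebraMap _ S (weightedHomogeneousComponent w a p) := by
  classical
  induction p using MvPolynomial.induction_on' with
  | monomial m c =>
    rw [coaction_monomial, AddMonoidAlgebra.coeff_single, Finsupp.single_apply]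
    split_ifs with h
    · rw [weightedHomogeneousComponent_of_mem (isWeightedHomogeneous_monomial w m c h), if_pos rfl]
    · rw [weightedHomogeneousComponent_of_mem (isWeightedHomogeneous_monomial w m c rfl),
        if_neg (Ne.symm h), map_zero]
  | add p q hp hq =>
    rw [map_add, AddMonoidAlgebra.coeff_add, Finsupp.add_apply, hp, hq, map_add, map_add]

theorem coaction_of_isWeightedHomogeneous {p : MvPolynomial V k} {c : D}
    (hp : IsWeightedHomogeneous w p c) :
    coaction w S p = AddMonoidAlgebra.single c (algebraMap _ S p) := by
  classical
  ext a
  rw [coeff_coaction, weightedHomogeneousComponent_of_mem hp, AddMonoidAlgebra.coeff_single,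
    Finsupp.single_apply]
  split_ifs with h1 h2 h2
  · rfl
  · exact absurd h1.symm h2
  · exact absurd h2.symm h1
  · exact map_zero _

end

variable {w}
variable {u : MvPolynomial V k} (hu : ∃ c, IsWeightedHomogeneous w u c)

/-- A homogeneous `u` goes to `t^c u`, with both factors invertible; this lets the coaction, and
with it the grading, extend to the localization. -/
theorem isUnit_coaction (hu : ∃ c, IsWeightedHomogeneous w u c) :
    IsUnit (coaction w (Localization.Away u) u) := by
  obtain ⟨c, hc⟩ := hu
  rw [coaction_of_isWeightedHomogeneous w hc]
  obtain ⟨y, hy⟩ := (IsLocalization.Away.algebraMap_isUnit (S := Localization.Away u) u).exists_right_inv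
  refine IsUnit.of_mul_eq_one (AddMonoidAlgebra.single (-c) y) ?_
  rw [AddMonoidAlgebra.single_mul_single, hy, add_neg_cancel]
  rfl

/-- The coaction on a localization. -/
def coactionAway : Localization.Away u →ₐ[k] AddMonoidAlgebra (Localization.Away u) D :=
  IsLocalization.Away.liftAlgHom u (f := coaction w (Localization.Away u)) (isUnit_coaction hu)

theorem coactionAway_algebraMap (p : MvPolynomial V k) :
    coactionAway hu (algebraMap _ _ p) = coaction w (Localization.Away u) p :=
  IsLocalization.Away.lift_eq u (isUnit_coaction hu) p

/-- The projection of a localization to its part of degree `a`. -/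
def proj (a : D) : Localization.Away u →ₗ[k] Localization.Away u :=
  Finsupp.lapply a ∘ₗ (AddMonoidAlgebra.coeffLinearEquiv k).toLinearMap ∘ₗ
    (coactionAway hu).toLinearMap

theorem proj_apply (a : D) (z : Localization.Away u) :
    proj hu a z = (coactionAway hu z).coeff a := rfl

theorem proj_algebraMap (a : D) (p : MvPolynomial V k) :
    proj hu a (algebraMap _ _ p) = algebraMap _ _ (weightedHomogeneousComponent w a p) := by
  rw [← coeff_coaction, proj_apply, coactionAway_algebraMap]

theorem proj_smul {p : MvPolynomial V k} {c : D} (hp : IsWeightedHomogeneous w p c) (a : D)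
    (z : Localization.Away u) : proj hu (c + a) (p • z) = p • proj hu a z := by
  rw [proj_apply, proj_apply, Algebra.smul_def, map_mul, coactionAway_algebraMap,
    coaction_of_isWeightedHomogeneous w hp, AddMonoidAlgebra.coeff_single_mul_apply,
    neg_add_cancel_left, Algebra.smul_def]

theorem proj_tr {v : MvPolynomial V k} (hv : ∃ c, IsWeightedHomogeneous w v c) (huv : u ∣ v)
    (a : D) (z : Localization.Away u) : proj hv a (tr u v z) = tr u v (proj hu a z) := by
  obtain ⟨c, hc⟩ := id hu
  obtain ⟨n, x, hx⟩ := exists_pow_smul u z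
  refine pow_smul_injective huv n ?_
  rw [← proj_smul hv (hc.pow n), ← map_smul, ← map_smul, ← proj_smul hu (hc.pow n), hx,
    proj_algebraMap, tr_algebraMap huv, tr_algebraMap huv, proj_algebraMap]

theorem exists_pow_smul_proj (a : D) (z : Localization.Away u) :
    ∃ (n : ℕ) (c : D) (x : MvPolynomial V k), IsWeightedHomogeneous w (u ^ n) c ∧
      u ^ n • z = algebraMap _ _ x ∧
      u ^ n • proj hu a z = algebraMap _ _ (weightedHomogeneousComponent w (c + a) x) := by
  obtain ⟨c, hc⟩ := id hu
  obtain ⟨n, x, hx⟩ := exists_pow_smul u z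
  exact ⟨n, n • c, x, hc.pow n, hx, by
    rw [← proj_smul hu (hc.pow n), hx, proj_algebraMap]⟩

theorem proj_eq_self {p y : MvPolynomial V k} {b c : D} (hp : IsWeightedHomogeneous w p b) {n : ℕ}
    (hy : IsWeightedHomogeneous w y c) (hyn : y = u ^ n) {z : Localization.Away u}
    (hz : y • z = algebraMap _ _ p) : proj hu (b - c) z = z := by
  classical
  subst hyn
  refine pow_smul_injective dvd_rfl n ?_
  rw [← proj_smul hu hy, hz, proj_algebraMap, add_sub_cancel,
    weightedHomogeneousComponent_of_mem hp, if_pos rfl]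

end Grading

section CochainGrading

variable {k : Type*} [CommRing k] {V : Type*} {D : Type*} [AddCommGroup D] {w : V → D}
variable {J : Type*} [Fintype J] {X : LocSystem (MvPolynomial V k) J}
  (hX : ∀ j, ∃ c, IsWeightedHomogeneous w (X.el j) c)

/-- The projection of the cochains to their part of multidegree `a`. -/
def projCochain (a : D) : X.Cochain →ₗ[k] X.Cochain :=
  LinearMap.pi fun j => proj (hX j) a ∘ₗ LinearMap.proj j

theorem projCochain_apply (a : D) (c : X.Cochain) (j : J) :
    projCochain hX a c j = proj (hX j) a (c j) := rfl

theorem projCochain_d (a : D) (c : X.Cochain) :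
    projCochain hX a (X.d c) = X.d (projCochain hX a c) := by
  ext j
  rw [projCochain_apply, LocSystem.d_apply, LocSystem.d_apply, map_sum]
  refine Finset.sum_congr rfl fun i _ => ?_
  rcases eq_or_ne (X.inc i j) 0 with h0 | h0
  · simp [h0]
  · rw [projCochain_apply, ← proj_tr (hX i) (hX j) (X.dvd h0), Int.cast_smul_eq_zsmul,
      Int.cast_smul_eq_zsmul, map_zsmul]

theorem projCochain_comp (a : D) (p : ℕ) (c : X.Cochain) :
    projCochain hX a (X.comp p c) = X.comp p (projCochain hX a c) := by
  ext j
  simp only [projCochain_apply, LocSystem.comp_apply]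
  split_ifs
  · rfl
  · exact map_zero _

theorem projCochain_mem_cocycles (a : D) {p : ℕ} {c : X.Cochain} (hc : c ∈ X.cocycles p) :
    projCochain hX a c ∈ X.cocycles p := by
  rw [LocSystem.mem_cocycles] at hc ⊢
  rw [← projCochain_d, hc.1, map_zero, ← projCochain_comp, hc.2]
  exact ⟨rfl, rfl⟩

end CochainGrading

end LocComplex

end

noncomputable section

namespace LocComplex

open MvPolynomial

set_option linter.unusedSectionVars false

/-! ### Laurent expansions -/

section Laurent

variable {k : Type*} [CommRing k] {V : Type*} [Fintype V] [DecidableEq V]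

/-- An exponent vector with integral entries. -/
def castExp (m : V →₀ ℕ) : V → ℤ := fun v => (m v : ℤ)

theorem castExp_injective : Function.Injective (castExp : (V →₀ ℕ) → V → ℤ) := by
  intro m m' h
  ext v
  exact Nat.cast_injective (R := ℤ) (congrFun h v)

theorem castExp_nonneg (m : V →₀ ℕ) (v : V) : 0 ≤ castExp m v := Nat.cast_nonneg _

theorem exists_castExp {e : V → ℤ} (he : ∀ v, 0 ≤ e v) : ∃ m : V →₀ ℕ, castExp m = e :=
  ⟨Finsupp.equivFunOnFinite.symm fun v => (e v).toNat, funext fun v => Int.toNat_of_nonneg (he v)⟩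

variable (k V) in
/-- The inclusion of the polynomial ring into the ring of Laurent polynomials. -/
def toLaurent : MvPolynomial V k →ₐ[k] AddMonoidAlgebra k (V → ℤ) :=
  aeval fun v => AddMonoidAlgebra.single (Pi.single v 1) 1

theorem toLaurent_monomial (m : V →₀ ℕ) (c : k) :
    toLaurent k V (monomial m c) = AddMonoidAlgebra.single (castExp m) c := by
  rw [toLaurent, aeval_monomial, Finsupp.prod]
  simp only [AddMonoidAlgebra.single_pow, AddMonoidAlgebra.prod_single]
  rw [AddMonoidAlgebra.coe_algebraMap, Function.comp_apply, AddMonoidAlgebra.single_mul_single,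
    zero_add]
  congr 1
  · ext v
    rw [Finset.sum_apply]
    simp only [Pi.smul_apply, Pi.single_apply, castExp]
    rw [Finset.sum_eq_single v]
    · simp
    · intro v' _ hv'
      simp [hv'.symm]
    · intro hv
      simp [Finsupp.notMem_support_iff.1 hv]
  · simp

theorem coeff_toLaurent (p : MvPolynomial V k) (m : V →₀ ℕ) :
    (toLaurent k V p).coeff (castExp m) = coeff m p := by
  induction p using MvPolynomial.induction_on' with
  | monomial m' c =>
    rw [toLaurent_monomial, AddMonoidAlgebra.coeff_single, coeff_monomial, Finsupp.single_apply]
    exact if_congr castExp_injective.eq_iff rfl rfl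
  | add p q hp hq =>
    rw [map_add, AddMonoidAlgebra.coeff_add, Finsupp.add_apply, hp, hq, coeff_add]

theorem nonneg_of_coeff_toLaurent_ne_zero {p : MvPolynomial V k} {e : V → ℤ}
    (h : (toLaurent k V p).coeff e ≠ 0) : ∀ v, 0 ≤ e v := by
  induction p using MvPolynomial.induction_on' with
  | monomial m c =>
    rw [toLaurent_monomial, AddMonoidAlgebra.coeff_single, Finsupp.single_apply] at h
    split_ifs at h with h'
    · subst h'; exact castExp_nonneg m
    · exact absurd rfl h
  | add p q hp hq =>
    rw [map_add, AddMonoidAlgebra.coeff_add, Finsupp.add_apply] at h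
    by_cases hp0 : (toLaurent k V p).coeff e = 0
    · rw [hp0, zero_add] at h
      exact hq h
    · exact hp hp0

theorem toLaurent_injective : Function.Injective (toLaurent k V) := by
  intro p q h
  ext m
  rw [← coeff_toLaurent, h, coeff_toLaurent]

/-- Monomials are invertible Laurent polynomials. -/
theorem isUnit_toLaurent_monomial (m : V →₀ ℕ) :
    IsUnit (toLaurent k V (monomial m 1)) := by
  rw [toLaurent_monomial]
  refine IsUnit.of_mul_eq_one (AddMonoidAlgebra.single (-castExp m) 1) ?_
  rw [AddMonoidAlgebra.single_mul_single, add_neg_cancel, one_mul]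
  rfl

variable {u : MvPolynomial V k} (hu : IsUnit (toLaurent k V u))

/-- The Laurent expansion of a fraction. -/
def laurentAway : Localization.Away u →ₐ[k] AddMonoidAlgebra k (V → ℤ) :=
  IsLocalization.Away.liftAlgHom u (f := toLaurent k V) hu

theorem laurentAway_algebraMap (p : MvPolynomial V k) :
    laurentAway hu (algebraMap _ _ p) = toLaurent k V p :=
  IsLocalization.Away.lift_eq u hu p

/-- The coefficients of the Laurent expansion of a fraction. -/
def expansion : Localization.Away u →ₗ[k] (V → ℤ) →₀ k :=
  (AddMonoidAlgebra.coeffLinearEquiv k).toLinearMap ∘ₗ (laurentAway hu).toLinearMap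

theorem expansion_apply (z : Localization.Away u) :
    expansion hu z = (laurentAway hu z).coeff := rfl

theorem expansion_algebraMap (p : MvPolynomial V k) :
    expansion hu (algebraMap _ _ p) = (toLaurent k V p).coeff := by
  rw [expansion_apply, laurentAway_algebraMap]

theorem expansion_monomial_smul (m : V →₀ ℕ) (z : Localization.Away u) (e : V → ℤ) :
    expansion hu ((monomial m 1 : MvPolynomial V k) • z) e = expansion hu z (e - castExp m) := by
  rw [expansion_apply, expansion_apply, Algebra.smul_def, map_mul, laurentAway_algebraMap,
    toLaurent_monomial, AddMonoidAlgebra.coeff_single_mul_apply, one_mul, neg_add_eq_sub]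

/-- After clearing a denominator this is injectivity of polynomials into Laurent polynomials. -/
theorem expansion_injective : Function.Injective (expansion hu) := by
  rw [injective_iff_map_eq_zero]
  intro z hz
  have hz' : laurentAway hu z = 0 := (AddMonoidAlgebra.coeffLinearEquiv k).injective (by
    rw [map_zero]; exact hz)
  obtain ⟨n, p, hp⟩ := exists_pow_smul u z
  have h1 : toLaurent k V p = 0 := by
    rw [← laurentAway_algebraMap hu, ← hp, Algebra.smul_def, map_mul, hz', mul_zero]
  rw [toLaurent_injective (h1.trans (map_zero _).symm), map_zero] at hp
  exact pow_smul_injective dvd_rfl n (hp.trans (smul_zero _).symm)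

theorem expansion_tr {v : MvPolynomial V k} (hv : IsUnit (toLaurent k V v)) (huv : u ∣ v)
    (z : Localization.Away u) : expansion hv (tr u v z) = expansion hu z := by
  obtain ⟨n, p, hp⟩ := exists_pow_smul u z
  have h : laurentAway hv (tr u v z) = laurentAway hu z := by
    refine (hu.pow n).mul_left_cancel ?_
    have h1 : laurentAway hv (u ^ n • tr u v z) = toLaurent k V u ^ n * laurentAway hv (tr u v z) := by
      rw [Algebra.smul_def, map_mul, laurentAway_algebraMap, map_pow]
    have h2 : laurentAway hu (u ^ n • z) = toLaurent k V u ^ n * laurentAway hu z := by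
      rw [Algebra.smul_def, map_mul, laurentAway_algebraMap, map_pow]
    rw [← h1, ← h2, ← map_smul, hp, tr_algebraMap huv, laurentAway_algebraMap,
      laurentAway_algebraMap]
  rw [expansion_apply, expansion_apply, h]

variable {D : Type*} [AddCommGroup D] (w : V → D)

/-- The multidegree of a Laurent monomial. -/
def expDeg (e : V → ℤ) : D := ∑ v, e v • w v

theorem expDeg_add (e e' : V → ℤ) : expDeg w (e + e') = expDeg w e + expDeg w e' := by
  simp only [expDeg, Pi.add_apply, add_smul, Finset.sum_add_distrib]

theorem expDeg_castExp (m : V →₀ ℕ) : expDeg w (castExp m) = Finsupp.weight w m := by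
  rw [expDeg, Finsupp.weight_apply, Finsupp.sum_fintype m (fun i c => c • w i) (fun i => zero_smul ℕ _)]
  simp only [castExp, natCast_zsmul]

open Classical in
theorem coeff_toLaurent_component (p : MvPolynomial V k) (a : D) (e : V → ℤ) :
    (toLaurent k V (weightedHomogeneousComponent w a p)).coeff e =
      if expDeg w e = a then (toLaurent k V p).coeff e else 0 := by
  by_cases he : ∀ v, 0 ≤ e v
  · obtain ⟨m, rfl⟩ := exists_castExp he
    rw [coeff_toLaurent, coeff_toLaurent, coeff_weightedHomogeneousComponent, expDeg_castExp]
  · have h0 : ∀ p : MvPolynomial V k, (toLaurent k V p).coeff e = 0 := fun p => by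
      by_contra h
      exact he (nonneg_of_coeff_toLaurent_ne_zero h)
    rw [h0, h0, ite_self]

variable {w}

open Classical in
theorem expansion_proj (m : V →₀ ℕ) (hum : u = monomial m 1)
    (hw : ∃ c, IsWeightedHomogeneous w u c) (a : D)
    (z : Localization.Away u) (e : V → ℤ) :
    expansion hu (proj hw a z) e = if expDeg w e = a then expansion hu z e else 0 := by
  obtain ⟨n, x, hx⟩ := exists_pow_smul u z
  have hun : u ^ n = monomial (n • m) 1 := by rw [hum, monomial_pow, one_pow]
  have hc : IsWeightedHomogeneous w (u ^ n) (Finsupp.weight w (n • m)) := by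
    rw [hun]; exact isWeightedHomogeneous_monomial _ _ _ rfl
  have h1 : ∀ z', expansion hu z' e = expansion hu (u ^ n • z') (e + castExp (n • m)) := by
    intro z'
    rw [hun, expansion_monomial_smul, add_sub_cancel_right]
  rw [h1, h1, ← proj_smul hw hc, hx, proj_algebraMap, expansion_algebraMap, expansion_algebraMap,
    coeff_toLaurent_component, expDeg_add, expDeg_castExp, add_comm (expDeg w e)]
  exact if_congr (add_right_inj _) rfl rfl

theorem nonneg_of_expansion_ne_zero {m : V →₀ ℕ} (hum : u = monomial m 1)
    {z : Localization.Away u} {e : V → ℤ} (h : expansion hu z e ≠ 0) {v : V} (hv : m v = 0) :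
    0 ≤ e v := by
  obtain ⟨n, x, hx⟩ := exists_pow_smul u z
  have hun : u ^ n = monomial (n • m) 1 := by rw [hum, monomial_pow, one_pow]
  have h1 : expansion hu (u ^ n • z) (e + castExp (n • m)) ≠ 0 := by
    rwa [hun, expansion_monomial_smul, add_sub_cancel_right]
  rw [hx, expansion_algebraMap] at h1
  have := nonneg_of_coeff_toLaurent_ne_zero h1 v
  simpa [castExp, hv] using this

/-- Inverting `x^m` permits arbitrary poles along the variables that occur in `x^m`, and no others.
-/
theorem exists_expansion_eq {m : V →₀ ℕ} (hum : u = monomial m 1) (F : (V → ℤ) →₀ k)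
    (hF : ∀ e, F e ≠ 0 → ∀ v, m v = 0 → 0 ≤ e v) : ∃ z, expansion hu z = F := by
  have hmem : F ∈ Finsupp.supported k k {e : V → ℤ | ∀ v, m v = 0 → 0 ≤ e v} := by
    intro e he
    exact hF e (Finsupp.mem_support_iff.1 he)
  rw [Finsupp.supported_eq_span_single] at hmem
  have hle : Submodule.span k ((fun e => Finsupp.single e (1 : k)) ''
      {e : V → ℤ | ∀ v, m v = 0 → 0 ≤ e v}) ≤ LinearMap.range (expansion hu) := by
    rw [Submodule.span_le]
    rintro _ ⟨e, he, rfl⟩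
    -- Large enough for `e + n • m` to be non-negative: `m v ≥ 1` wherever `e v` may be negative.
    let n : ℕ := ∑ v, (e v).natAbs
    have hn : ∀ v, -(n : ℤ) ≤ e v := fun v => by
      have : (e v).natAbs ≤ n := Finset.single_le_sum (f := fun v => (e v).natAbs)
        (fun _ _ => Nat.zero_le _) (Finset.mem_univ v)
      omega
    obtain ⟨m', hm'⟩ := exists_castExp (e := e + castExp (n • m)) (fun v => by
      simp only [Pi.add_apply, castExp, Finsupp.smul_apply, smul_eq_mul, Nat.cast_mul]
      by_cases hv : m v = 0
      · rw [hv]; simpa using he v hv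
      · have h1 : (1 : ℤ) ≤ m v := by exact_mod_cast Nat.one_le_iff_ne_zero.2 hv
        have h2 := hn v
        nlinarith [Nat.cast_nonneg (α := ℤ) n])
    obtain ⟨z, hz⟩ := pow_smul_surjective (dvd_refl u) n
      (algebraMap _ (Localization.Away u) (monomial m' (1 : k)))
    refine ⟨z, ?_⟩
    have hun : u ^ n = monomial (n • m) 1 := by rw [hum, monomial_pow, one_pow]
    ext e'
    have h1 : expansion hu z e' = expansion hu (u ^ n • z) (e' + castExp (n • m)) := by
      rw [hun, expansion_monomial_smul, add_sub_cancel_right]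
    rw [h1, hz, expansion_algebraMap, toLaurent_monomial, AddMonoidAlgebra.coeff_single, hm']
    simp only [Finsupp.single_apply, add_left_inj]
  exact hle hmem

end Laurent

end LocComplex

end

noncomputable section

namespace LocComplex

open MvPolynomial

set_option linter.unusedSectionVars false

/-! ### The product of the Cech complexes of the blocks -/

section BlockSystem

variable (k : Type*) [CommRing k] {V : Type*} [Fintype V] [DecidableEq V]
variable {Q : Type*} [LinearOrder Q] [Fintype Q] {β : Type*} [DecidableEq β] [Fintype β]

instance (b : Q → β) : Fintype {τ : Finset Q // MeetsAll b τ} := Fintype.ofFinite _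

/-- Passes to sums over all subsets, where the facts about `incidence` apply. -/
theorem sum_meetsAll {M : Type*} [AddCommMonoid M] (b : Q → β) (f : Finset Q → M)
    (hf : ∀ τ, ¬ MeetsAll b τ → f τ = 0) :
    ∑ τ : {τ : Finset Q // MeetsAll b τ}, f τ.1 = ∑ τ, f τ := by
  classical
  rw [← Finset.sum_subtype (Finset.univ.filter (MeetsAll b)) (by simp) f, Finset.sum_filter]
  refine Finset.sum_congr rfl fun τ _ => ?_
  split_ifs with h
  exacts [rfl, (hf τ h).symm]

theorem card_of_isCritical_univ {b : Q → β} {τ : Finset Q}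
    (h : IsCritical b Finset.univ τ) : τ.card = Fintype.card β := by
  rw [Finset.card_eq_sum_card_fiberwise (f := b) (t := Finset.univ) (fun _ _ => by simp),
    Finset.sum_congr rfl h.2]
  simp

theorem MeetsAll.card_le {b : Q → β} {τ : Finset Q} (h : MeetsAll b τ) :
    Fintype.card β ≤ τ.card := by
  rw [← Finset.card_univ]
  refine (Finset.card_le_card fun i _ => ?_).trans (Finset.card_image_le (s := τ) (f := b))
  obtain ⟨q, hq, hqi⟩ := h i
  exact Finset.mem_image.2 ⟨q, hq, hqi⟩

open Classical in
/-- The incidence numbers of the product of the Cech complexes of the blocks, augmented. -/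
def blockInc (b : Q → β) :
    Option {τ : Finset Q // MeetsAll b τ} → Option {τ : Finset Q // MeetsAll b τ} → ℤ
  | none, some τ => if IsCritical b Finset.univ τ.1 then 1 else 0
  | some σ, some τ => incidence σ.1 τ.1
  | _, none => 0

variable {b : Q → β} (x : Q → V)

/-- The product of the Cech complexes of the blocks, without the cochains that do not involve all
blocks, augmented by the polynomial ring. -/
def blockSystem (hb : Contiguous b) (hs : Function.Surjective b) :
    LocSystem (MvPolynomial V k) (Option {τ : Finset Q // MeetsAll b τ}) where
  el i := i.elim 1 fun τ => ∏ q ∈ τ.1, X (x q)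
  inc := blockInc b
  -- The subtraction does not truncate: a set that meets every block has at least `Fintype.card β`
  -- elements. The smallest such sets have degree 1, just after the augmentation term.
  deg i := i.elim 0 fun τ => τ.1.card + 1 - Fintype.card β
  dvd {i l} h := by
    rcases i with _ | σ
    · exact one_dvd _
    · rcases l with _ | τ
      · exact absurd rfl h
      · exact (cech fun q => (X (x q) : MvPolynomial V k)).dvd h
  deg_eq {i l} h := by
    rcases i with _ | σ <;> rcases l with _ | τ
    · exact absurd rfl h
    · have hτ : IsCritical b Finset.univ τ.1 := by
        by_contra h'
        exact h (if_neg h')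
      change τ.1.card + 1 - Fintype.card β = 0 + 1
      rw [card_of_isCritical_univ hτ]
      omega
    · exact absurd rfl h
    · have h1 : τ.1.card = σ.1.card + 1 :=
        (cech fun q => (X (x q) : MvPolynomial V k)).deg_eq h
      have := σ.2.card_le
      change τ.1.card + 1 - Fintype.card β = σ.1.card + 1 - Fintype.card β + 1
      omega
  sq i l := by
    classical
    rw [Fintype.sum_option]
    rcases l with _ | τ
    · simp [blockInc]
    rcases i with _ | σ
    · have h := bd_critical hb Finset.univ (1 : ℤ) τ.1
      rw [bd] at h
      have h2 := sum_incidence_smul (A := ℤ)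
        (fun σ : Finset Q => if IsCritical b Finset.univ σ then (1 : ℤ) else 0) τ.1
      simp only [Int.cast_id, smul_eq_mul] at h2 h
      simp only [blockInc, zero_mul, zero_add]
      rw [sum_meetsAll b (fun σ => (if IsCritical b Finset.univ σ then 1 else 0) *
        incidence σ τ.1) fun σ hσ => by
          rw [if_neg fun h => hσ (h.meetsAll hs), zero_mul]]
      simp only [mul_comm _ (incidence _ τ.1)]
      rw [h2, h]
    · simp only [blockInc, zero_mul, zero_add]
      rw [sum_meetsAll b (fun υ => incidence σ.1 υ * incidence υ τ.1), incidence_sq]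
      intro υ hυ
      have : incidence σ.1 υ = 0 := by
        by_contra h0
        obtain ⟨w, hw, h⟩ := exists_of_incidence_ne_zero h0
        exact hυ (σ.2.mono (h ▸ Finset.erase_subset _ _))
      rw [this, zero_mul]

variable {x} (hb : Contiguous b) (hs : Function.Surjective b)

/-- The exponent vector of a product of variables. -/
def finsetExp (x : Q → V) (τ : Finset Q) : V →₀ ℕ := ∑ q ∈ τ, Finsupp.single (x q) 1

theorem prod_X_eq_monomial (τ : Finset Q) :
    ∏ q ∈ τ, (X (x q) : MvPolynomial V k) = monomial (finsetExp x τ) 1 := by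
  rw [finsetExp, monomial_sum_one]
  rfl

theorem finsetExp_eq_zero_iff {τ : Finset Q} {v : V} : finsetExp x τ v = 0 ↔ ∀ q ∈ τ, x q ≠ v := by
  rw [finsetExp, Finsupp.finsetSum_apply, Finset.sum_eq_zero_iff]
  refine forall₂_congr fun q _ => ?_
  rw [Finsupp.single_apply]
  split_ifs with h <;> simp [h]

variable {k}

theorem exists_el_eq_monomial (i : Option {τ : Finset Q // MeetsAll b τ}) :
    ∃ m, (blockSystem k x hb hs).el i = monomial m 1 := by
  rcases i with _ | τ
  · exact ⟨0, rfl⟩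
  · exact ⟨_, prod_X_eq_monomial k τ.1⟩

theorem isUnit_toLaurent_el (i : Option {τ : Finset Q // MeetsAll b τ}) :
    IsUnit (toLaurent k V ((blockSystem k x hb hs).el i)) := by
  obtain ⟨m, hm⟩ := exists_el_eq_monomial (k := k) (x := x) hb hs i
  rw [hm]
  exact isUnit_toLaurent_monomial m

/-- The Laurent expansion of the augmentation component. -/
def expNone : (blockSystem k x hb hs).Cochain →ₗ[k] (V → ℤ) →₀ k :=
  expansion (isUnit_toLaurent_el hb hs none) ∘ₗ
    LinearMap.proj (φ := fun i => Localization.Away ((blockSystem k x hb hs).el i)) none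

open Classical in
/-- The Laurent expansion of the component at `τ`, extended by zero. -/
def expSome (τ : Finset Q) : (blockSystem k x hb hs).Cochain →ₗ[k] (V → ℤ) →₀ k :=
  if h : MeetsAll b τ then
    expansion (isUnit_toLaurent_el hb hs (some ⟨τ, h⟩)) ∘ₗ
      LinearMap.proj (φ := fun i => Localization.Away ((blockSystem k x hb hs).el i))
        (some ⟨τ, h⟩)
  else 0

variable {hb hs}

theorem expNone_apply (c : (blockSystem k x hb hs).Cochain) :
    expNone hb hs c = expansion (isUnit_toLaurent_el hb hs none) (c none) := rfl

theorem expSome_apply (c : (blockSystem k x hb hs).Cochain)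
    (τ : {τ : Finset Q // MeetsAll b τ}) :
    expSome hb hs τ.1 c = expansion (isUnit_toLaurent_el hb hs (some τ)) (c (some τ)) := by
  rw [expSome, dif_pos τ.2]
  rfl

theorem expSome_of_not {τ : Finset Q} (h : ¬ MeetsAll b τ) :
    expSome hb hs τ = (0 : (blockSystem k x hb hs).Cochain →ₗ[k] (V → ℤ) →₀ k) :=
  dif_neg h

theorem cochain_ext {c c' : (blockSystem k x hb hs).Cochain}
    (h0 : expNone hb hs c = expNone hb hs c')
    (h : ∀ τ, expSome hb hs τ c = expSome hb hs τ c') : c = c' := by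
  ext i
  rcases i with _ | τ
  · exact expansion_injective _ h0
  · have := h τ.1
    rw [expSome_apply, expSome_apply] at this
    exact expansion_injective _ this

theorem nonneg_of_expNone_ne_zero {c : (blockSystem k x hb hs).Cochain} {e : V → ℤ}
    (h : expNone hb hs c e ≠ 0) (v : V) : 0 ≤ e v :=
  nonneg_of_expansion_ne_zero (m := 0) _ rfl h rfl

theorem exists_of_expSome_ne_zero {c : (blockSystem k x hb hs).Cochain} {e : V → ℤ}
    {τ : Finset Q} (h : expSome hb hs τ c e ≠ 0) :
    MeetsAll b τ ∧ ∀ v, e v < 0 → ∃ q ∈ τ, x q = v := by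
  by_cases hτ : MeetsAll b τ
  · refine ⟨hτ, fun v hv => ?_⟩
    by_contra! hc
    rw [expSome_apply c ⟨τ, hτ⟩] at h
    exact absurd (nonneg_of_expansion_ne_zero _ (prod_X_eq_monomial k τ) h
      (finsetExp_eq_zero_iff.2 hc)) (not_le.2 hv)
  · rw [expSome_of_not hτ] at h
    exact absurd rfl h

/-- Cochains of the block system amount to families of Laurent polynomials with poles only along `τ`
(none at the augmentation term), so cochains can be constructed coefficientwise. -/
theorem exists_cochain (n : (V → ℤ) →₀ k) (hn : ∀ e, n e ≠ 0 → ∀ v, 0 ≤ e v)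
    (y : Finset Q → (V → ℤ) →₀ k)
    (hy : ∀ τ e, y τ e ≠ 0 → MeetsAll b τ ∧ ∀ v, e v < 0 → ∃ q ∈ τ, x q = v) :
    ∃ c : (blockSystem k x hb hs).Cochain, expNone hb hs c = n ∧
      ∀ τ, expSome hb hs τ c = y τ := by
  obtain ⟨z, hz⟩ := exists_expansion_eq (isUnit_toLaurent_el (k := k) (x := x) hb hs none) (m := 0)
    rfl n fun e he v _ => hn e he v
  have h : ∀ τ : {τ : Finset Q // MeetsAll b τ},
      ∃ z, expansion (isUnit_toLaurent_el (k := k) (x := x) hb hs (some τ)) z = y τ.1 := fun τ =>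
    exists_expansion_eq _ (prod_X_eq_monomial k τ.1) (y τ.1) fun e he v hv => by
      by_contra hlt
      obtain ⟨q, hq, hqv⟩ := (hy _ e he).2 v (not_le.1 hlt)
      exact finsetExp_eq_zero_iff.1 hv q hq hqv
  choose z' hz' using h
  refine ⟨fun i => match i with
    | none => z
    | some τ => z' τ, hz, fun τ => ?_⟩
  by_cases hτ : MeetsAll b τ
  · rw [expSome_apply _ ⟨τ, hτ⟩]
    exact hz' ⟨τ, hτ⟩
  · rw [expSome_of_not hτ, LinearMap.zero_apply]
    ext e
    by_contra h
    exact hτ (hy τ e (Ne.symm h)).1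

theorem expNone_d (c : (blockSystem k x hb hs).Cochain) :
    expNone hb hs ((blockSystem k x hb hs).d c) = 0 := by
  rw [expNone_apply, LocSystem.d_apply, Finset.sum_eq_zero, map_zero]
  intro i _
  have h : (blockSystem k x hb hs).inc i none = 0 := by rcases i with _ | _ <;> rfl
  rw [h, Int.cast_zero, zero_smul]

open Classical in
-- Expansion is unaffected by further localization, so the differential becomes the simplicial
-- coboundary with coefficients in Laurent polynomials, plus the augmentation.
theorem expSome_d (c : (blockSystem k x hb hs).Cochain) (τ : Finset Q) :
    expSome hb hs τ ((blockSystem k x hb hs).d c) =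
      bd (fun τ => expSome hb hs τ c) τ +
        if IsCritical b Finset.univ τ then expNone hb hs c else 0 := by
  by_cases hτ : MeetsAll b τ
  · have hint : ∀ (n : ℤ) (z : Localization.Away ((blockSystem k x hb hs).el (some ⟨τ, hτ⟩))),
        expansion (isUnit_toLaurent_el hb hs (some ⟨τ, hτ⟩)) ((n : MvPolynomial V k) • z) =
        n • expansion (isUnit_toLaurent_el hb hs (some ⟨τ, hτ⟩)) z := fun n z => by
      rw [Int.cast_smul_eq_zsmul, map_zsmul]
    rw [expSome_apply _ ⟨τ, hτ⟩, LocSystem.d_apply, map_sum, Fintype.sum_option, add_comm]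
    congr 1
    · have hbd : bd (fun τ => expSome hb hs τ c) τ =
          ∑ σ, incidence σ τ • expSome hb hs σ c := by
        have := sum_incidence_smul (A := ℤ) (fun τ => expSome hb hs τ c) τ
        simp only [Int.cast_id] at this
        rw [this, bd]
      rw [hbd, ← sum_meetsAll b (fun σ => incidence σ τ • expSome hb hs σ c) fun σ hσ => by
        rw [expSome_of_not hσ, LinearMap.zero_apply, smul_zero]]
      refine Finset.sum_congr rfl fun σ _ => ?_
      rw [hint, expSome_apply]
      rcases eq_or_ne (incidence σ.1 τ) 0 with h0 | h0
      · have h : (blockSystem k x hb hs).inc (some σ) (some ⟨τ, hτ⟩) = 0 := h0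
        rw [h0, h, zero_smul, zero_smul]
      · rw [expansion_tr (isUnit_toLaurent_el hb hs (some σ)) _ ((blockSystem k x hb hs).dvd (i := some σ) (j := some ⟨τ, hτ⟩) h0)]
        rfl
    · rw [hint, expansion_tr (isUnit_toLaurent_el hb hs none)
        (isUnit_toLaurent_el hb hs (some ⟨τ, hτ⟩)) (one_dvd _)]
      change (if IsCritical b Finset.univ τ then (1 : ℤ) else 0) • _ = _
      rw [ite_smul, one_smul, zero_smul]
      rfl
  · rw [expSome_of_not hτ, LinearMap.zero_apply, if_neg fun h => hτ (h.meetsAll hs), add_zero]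
    symm
    refine Finset.sum_eq_zero fun w _ => ?_
    simp only
    rw [expSome_of_not fun h => hτ (h.mono (Finset.erase_subset _ _)), LinearMap.zero_apply,
      smul_zero]

theorem expSome_monomial_smul (m : V →₀ ℕ) (c : (blockSystem k x hb hs).Cochain) (τ : Finset Q)
    (e : V → ℤ) : expSome hb hs τ ((monomial m 1 : MvPolynomial V k) • c) e =
      expSome hb hs τ c (e - castExp m) := by
  by_cases hτ : MeetsAll b τ
  · rw [expSome_apply _ ⟨τ, hτ⟩, expSome_apply _ ⟨τ, hτ⟩]
    exact expansion_monomial_smul _ _ _ _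
  · rw [expSome_of_not hτ]
    rfl

theorem expSome_comp (p : ℕ) (c : (blockSystem k x hb hs).Cochain) (τ : Finset Q) :
    expSome hb hs τ ((blockSystem k x hb hs).comp p c) =
      if τ.card + 1 - Fintype.card β = p then expSome hb hs τ c else 0 := by
  by_cases hτ : MeetsAll b τ
  · rw [expSome_apply _ ⟨τ, hτ⟩, expSome_apply _ ⟨τ, hτ⟩, LocSystem.comp_apply]
    change expansion _ (if τ.card + 1 - Fintype.card β = p then _ else 0) = _
    split_ifs
    · rfl
    · exact map_zero _
  · rw [expSome_of_not hτ]
    simp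

open Classical in
theorem expSome_projCochain {D : Type*} [AddCommGroup D] {w : V → D}
    (hX : ∀ j, ∃ c, IsWeightedHomogeneous w ((blockSystem k x hb hs).el j) c)
    (a : D) (c : (blockSystem k x hb hs).Cochain) (τ : Finset Q) (e : V → ℤ) :
    expSome hb hs τ (projCochain hX a c) e =
      if expDeg w e = a then expSome hb hs τ c e else 0 := by
  by_cases hτ : MeetsAll b τ
  · rw [expSome_apply _ ⟨τ, hτ⟩, expSome_apply _ ⟨τ, hτ⟩]
    exact expansion_proj _ _ (prod_X_eq_monomial k τ) _ a _ e
  · rw [expSome_of_not hτ]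
    simp

end BlockSystem

end LocComplex

end

noncomputable section

namespace LocComplex

open MvPolynomial

set_option linter.unusedSectionVars false

/-! ### Strands: exactness for partially contained blocks -/

section Strand

variable {Q : Type*} [LinearOrder Q] [Fintype Q] {β : Type*} [DecidableEq β] [Fintype β]
variable {W : Type*} [AddCommGroup W] {b : Q → β}

/-- The strand of a set that contains a block only partially is exact. -/
theorem exists_bd_eq_of_partial (hb : Contiguous b) {j : β → Q} (hj : ∀ i, b (j i) = i)
    {M : Finset Q} {q q' : Q} (hq : q ∈ M) (hq' : q' ∉ M) (hqq : b q' = b q)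
    {c : Finset Q → W} (hc : SupportedOn b M c) (hd : ∀ τ, bd c τ = 0) :
    ∃ y : Finset Q → W, SupportedOn b M y ∧ ∀ τ, c τ = bd y τ := by
  classical
  -- The blocks not contained in `M`; their representatives `j'` are chosen outside `M`.
  let D : Finset β := Finset.univ.filter fun i => ∃ q, b q = i ∧ q ∉ M
  have hsec : ∀ i, ∃ q, b q = i ∧ (i ∈ D → q ∉ M) := by
    intro i
    by_cases hi : i ∈ D
    · obtain ⟨q, hq, hqM⟩ := (Finset.mem_filter.1 hi).2
      exact ⟨q, hq, fun _ => hqM⟩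
    · exact ⟨j i, hj i, fun h => absurd h hi⟩
  choose j' hj' hjM using hsec
  obtain ⟨y, hy, h⟩ := exists_sub_bd_critical hb j' hj' D (N := M) hjM
    (fun q hq => by
      by_contra hqM
      exact hq (Finset.mem_filter.2 ⟨Finset.mem_univ _, q, rfl, hqM⟩)) hc hd
  refine ⟨y, hy, fun τ => ?_⟩
  -- In the block of `q` this set has only the representative, which is not in `M`; hence it does
  -- not contain `q`, and `c` vanishes there.
  have h0 : c (critical b j' D) = 0 := by
    refine hc _ fun hM => ?_
    have hqD : b q ∈ D := Finset.mem_filter.2 ⟨Finset.mem_univ _, q', hqq, hq'⟩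
    rcases Finset.mem_union.1 (hM.2 hq) with h1 | h1
    · exact (Finset.mem_filter.1 h1).2 hqD
    · obtain ⟨i, hi, rfl⟩ := Finset.mem_image.1 h1
      exact hjM i hi hq
  rw [← sub_eq_zero, h, h0, ite_self]

theorem partial_or_full (b : Q → β) (M : Finset Q) :
    (∃ q ∈ M, ∃ q' ∉ M, b q' = b q) ∨ ∃ D : Finset β, M = Finset.univ.filter (b · ∉ D) := by
  classical
  by_cases h : ∃ q ∈ M, ∃ q' ∉ M, b q' = b q
  · exact Or.inl h
  · push Not at h
    refine Or.inr ⟨Finset.univ.filter fun i => ∃ q, b q = i ∧ q ∉ M, ?_⟩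
    ext q
    simp only [Finset.mem_filter, Finset.mem_univ, true_and, not_exists, not_and, not_not]
    constructor
    · intro hq q' hq'
      by_contra hM
      exact h q hq q' hM hq'
    · intro hq
      exact hq q rfl

end Strand

/-! ### Cohomology of the block system by evaluation at critical sets -/

section Evaluation

variable {k : Type*} [CommRing k] {V : Type*} [Fintype V] [DecidableEq V]
variable {Q : Type*} [LinearOrder Q] [Fintype Q] {β : Type*} [DecidableEq β] [Fintype β]
variable {b : Q → β} {x : Q → V} {hb : Contiguous b} {hs : Function.Surjective b}

/-- The exponents that are negative exactly at the variables in `M`. -/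
def Stratum (x : Q → V) (M : Finset Q) (e : V → ℤ) : Prop := ∀ v, e v < 0 ↔ ∃ q ∈ M, x q = v

theorem Stratum.subset (hx : Function.Injective x) {M τ : Finset Q} {e : V → ℤ}
    (h : Stratum x M e) (hτ : ∀ v, e v < 0 → ∃ q ∈ τ, x q = v) : M ⊆ τ := by
  intro q hq
  obtain ⟨q', hq', h'⟩ := hτ (x q) ((h _).2 ⟨q, hq, rfl⟩)
  rwa [← hx h']

theorem Stratum.unique (hx : Function.Injective x) {M M' : Finset Q} {e : V → ℤ}
    (h : Stratum x M e) (h' : Stratum x M' e) : M = M' :=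
  (h.subset hx fun v => (h' v).1).antisymm (h'.subset hx fun v => (h v).1)

theorem exists_stratum {τ : Finset Q} {e : V → ℤ} (h : ∀ v, e v < 0 → ∃ q ∈ τ, x q = v) :
    ∃ M, Stratum x M e := by
  refine ⟨Finset.univ.filter fun q => e (x q) < 0, fun v => ⟨fun hv => ?_, ?_⟩⟩
  · obtain ⟨q, _, rfl⟩ := h v hv
    exact ⟨q, Finset.mem_filter.2 ⟨Finset.mem_univ _, hv⟩, rfl⟩
  · rintro ⟨q, hq, rfl⟩
    exact (Finset.mem_filter.1 hq).2

open Classical in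
/-- The restriction of a Laurent polynomial to a stratum. -/
def stratumPart (k : Type*) [CommRing k] (x : Q → V) (M : Finset Q) :
    ((V → ℤ) →₀ k) →+ ((V → ℤ) →₀ k) :=
  Finsupp.filterAddHom (Stratum x M)

open Classical in
theorem stratumPart_apply (M : Finset Q) (f : (V → ℤ) →₀ k) (e : V → ℤ) :
    stratumPart k x M f e = if Stratum x M e then f e else 0 :=
  Finsupp.filter_apply _ _ _

theorem stratumPart_ne_zero {M : Finset Q} {f : (V → ℤ) →₀ k} {e : V → ℤ}
    (h : stratumPart k x M f e ≠ 0) : Stratum x M e ∧ f e ≠ 0 := by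
  classical
  rw [stratumPart_apply] at h
  split_ifs at h with h'
  exacts [⟨h', h⟩, absurd rfl h]

theorem stratumPart_stratumPart (M : Finset Q) (f : (V → ℤ) →₀ k) :
    stratumPart k x M (stratumPart k x M f) = stratumPart k x M f := by
  classical
  ext e
  simp only [stratumPart_apply]
  split_ifs <;> rfl

theorem sum_stratumPart (hx : Function.Injective x) {f : (V → ℤ) →₀ k}
    (hf : ∀ e, f e ≠ 0 → ∃ M, Stratum x M e) : ∑ M, stratumPart k x M f = f := by
  classical
  ext e
  rw [Finsupp.finsetSum_apply]
  by_cases h0 : f e = 0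
  · rw [h0]
    refine Finset.sum_eq_zero fun M _ => ?_
    rw [stratumPart_apply, h0, ite_self]
  · obtain ⟨M, hM⟩ := hf e h0
    rw [Finset.sum_eq_single M]
    · rw [stratumPart_apply, if_pos hM]
    · intro M' _ hM'
      rw [stratumPart_apply, if_neg fun h => hM' (h.unique hx hM)]
    · exact fun h => absurd (Finset.mem_univ _) h

/-- A fraction in the component at `τ` has poles only along `τ`, so a term with pole set `M` needs
`M ⊆ τ`. -/
theorem supportedOn_stratumPart (hx : Function.Injective x) (M : Finset Q)
    (c : (blockSystem k x hb hs).Cochain) :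
    SupportedOn b M fun τ => stratumPart k x M (expSome hb hs τ c) := by
  intro τ hτ
  ext e
  by_contra h
  obtain ⟨h1, h2⟩ := stratumPart_ne_zero h
  obtain ⟨h3, h4⟩ := exists_of_expSome_ne_zero h2
  exact hτ ⟨h3, h1.subset hx h4⟩

/-- At a set with one element of each block, every face misses a block, so the cocycle condition
there involves only the augmentation term. -/
theorem expNone_eq_zero {j : β → Q} (hj : ∀ i, b (j i) = i)
    {c : (blockSystem k x hb hs).Cochain} (hc : (blockSystem k x hb hs).d c = 0) :
    expNone hb hs c = 0 := by
  have h := expSome_d c (critical b j Finset.univ)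
  rw [hc, map_zero, if_pos (isCritical_critical hj _),
    bd_eq_zero_of_isCritical (isCritical_critical hj Finset.univ) (N := ∅)
      (fun q hq => absurd (Finset.mem_univ _) hq) (fun τ hτ => by
        rw [expSome_of_not fun h => hτ ⟨h, Finset.empty_subset _⟩]; rfl), zero_add] at h
  exact h.symm

theorem bd_expSome_eq_zero {j : β → Q} (hj : ∀ i, b (j i) = i)
    {c : (blockSystem k x hb hs).Cochain} (hc : (blockSystem k x hb hs).d c = 0) (τ : Finset Q) :
    bd (fun τ => expSome hb hs τ c) τ = 0 := by
  classical
  have h := expSome_d c τ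
  rw [hc, map_zero, expNone_eq_zero hj hc, ite_self, add_zero] at h
  exact h.symm

theorem bd_stratumPart_eq_zero {j : β → Q} (hj : ∀ i, b (j i) = i)
    {c : (blockSystem k x hb hs).Cochain} (hc : (blockSystem k x hb hs).d c = 0) (M : Finset Q)
    (τ : Finset Q) : bd (fun τ => stratumPart k x M (expSome hb hs τ c)) τ = 0 := by
  rw [← map_bd, bd_expSome_eq_zero hj hc, map_zero]

/-- A cocycle is a coboundary if its expansions at the critical sets have no critical terms. -/
theorem exists_d_eq (hx : Function.Injective x) {j : β → Q} (hj : ∀ i, b (j i) = i)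
    {c : (blockSystem k x hb hs).Cochain} (hc : (blockSystem k x hb hs).d c = 0)
    (hcrit : ∀ D : Finset β, D ≠ Finset.univ → ∀ e,
      Stratum x (Finset.univ.filter (b · ∉ D)) e → expSome hb hs (critical b j D) c e = 0) :
    ∃ y, (blockSystem k x hb hs).d y = c := by
  classical
  -- The differential preserves exponents, so the equation is solved on each stratum; the finitely
  -- many solutions are added at the end.
  have key : ∀ M : Finset Q, ∃ (n : (V → ℤ) →₀ k) (y : Finset Q → (V → ℤ) →₀ k),
      (∀ e, n e ≠ 0 → ∀ v, 0 ≤ e v) ∧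
      (∀ τ e, y τ e ≠ 0 → MeetsAll b τ ∧ ∀ v, e v < 0 → ∃ q ∈ τ, x q = v) ∧
      ∀ τ, stratumPart k x M (expSome hb hs τ c) =
        bd y τ + if IsCritical b Finset.univ τ then n else 0 := by
    intro M
    have hsup : ∀ y : Finset Q → (V → ℤ) →₀ k, SupportedOn b M y →
        ∀ τ e, stratumPart k x M (y τ) e ≠ 0 →
          MeetsAll b τ ∧ ∀ v, e v < 0 → ∃ q ∈ τ, x q = v := by
      intro y hy τ e h
      obtain ⟨h1, h2⟩ := stratumPart_ne_zero h
      have h3 : MeetsAll b τ ∧ M ⊆ τ := by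
        by_contra h'
        rw [hy τ h'] at h2
        exact h2 rfl
      exact ⟨h3.1, fun v hv => ((h1 v).1 hv).imp fun q hq => ⟨h3.2 hq.1, hq.2⟩⟩
    rcases partial_or_full b M with ⟨q, hq, q', hq', hqq⟩ | ⟨D, rfl⟩
    · obtain ⟨y, hy, h⟩ := exists_bd_eq_of_partial hb hj hq hq' hqq
        (supportedOn_stratumPart hx M c) (bd_stratumPart_eq_zero hj hc M)
      -- The solution `y` comes from pure combinatorics with arbitrary coefficients and is cut down
      -- to the stratum, so that its poles are the permitted ones.
      refine ⟨0, fun τ => stratumPart k x M (y τ), fun e he => absurd rfl he, hsup y hy,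
        fun τ => ?_⟩
      rw [← map_bd, ← h, stratumPart_stratumPart, ite_self, add_zero]
    · set M := Finset.univ.filter (b · ∉ D) with hM
      obtain ⟨y, hy, h⟩ := exists_sub_bd_critical hb (N := M) j hj D
        (fun i hi hiM => (Finset.mem_filter.1 hiM).2 (by rwa [hj]))
        (fun q hq => Finset.mem_filter.2 ⟨Finset.mem_univ _, hq⟩)
        (supportedOn_stratumPart hx M c) (bd_stratumPart_eq_zero hj hc M)
      -- In this case `M` is empty and the remaining class is a polynomial, which the augmentation
      -- absorbs. Otherwise the class is zero by `hcrit`.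
      by_cases hD : D = Finset.univ
      · refine ⟨stratumPart k x M (expSome hb hs (critical b j D) c),
          fun τ => stratumPart k x M (y τ), fun e he v => ?_, hsup y hy, fun τ => ?_⟩
        · by_contra hv
          obtain ⟨q, hq, -⟩ := ((stratumPart_ne_zero he).1 v).1 (not_le.1 hv)
          exact (Finset.mem_filter.1 hq).2 (hD ▸ Finset.mem_univ _)
        · have h1 := congrArg (stratumPart k x M) (h τ)
          rw [map_sub, stratumPart_stratumPart, sub_eq_iff_eq_add', map_bd] at h1
          rw [h1, ← hD]
          congr 1
          split_ifs
          · exact stratumPart_stratumPart _ _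
          · exact map_zero _
      · have h0 : stratumPart k x M (expSome hb hs (critical b j D) c) = 0 := by
          ext e
          by_contra he
          obtain ⟨h1, h2⟩ := stratumPart_ne_zero he
          exact h2 (hcrit D hD e h1)
        refine ⟨0, fun τ => stratumPart k x M (y τ), fun e he => absurd rfl he, hsup y hy,
          fun τ => ?_⟩
        have h1 := h τ
        rw [h0, ite_self, sub_eq_zero] at h1
        rw [← map_bd, ← h1, stratumPart_stratumPart, ite_self, add_zero]
  choose n y hn hy h using key
  obtain ⟨z, hz0, hz⟩ := exists_cochain (hb := hb) (hs := hs) (∑ M, n M)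
    (fun e he v => by
      rw [Finsupp.finsetSum_apply] at he
      obtain ⟨M, _, hM⟩ := Finset.exists_ne_zero_of_sum_ne_zero he
      exact hn M e hM v)
    (fun τ => ∑ M, y M τ)
    (fun τ e he => by
      rw [Finsupp.finsetSum_apply] at he
      obtain ⟨M, _, hM⟩ := Finset.exists_ne_zero_of_sum_ne_zero he
      exact hy M τ e hM)
  refine ⟨z, cochain_ext ?_ fun τ => ?_⟩
  · rw [expNone_d, expNone_eq_zero hj hc]
  · rw [expSome_d, hz0, ← sum_stratumPart hx (f := expSome hb hs τ c) fun e he =>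
      exists_stratum (exists_of_expSome_ne_zero he).2]
    simp only [h, Finset.sum_add_distrib]
    congr 1
    · simp only [bd, hz, Finset.smul_sum]
      exact Finset.sum_comm
    · split_ifs
      · rfl
      · rw [Finset.sum_const_zero]

/-- The exponents that are negative on `S` and non-negative elsewhere. -/
def invExponents (S : Set V) : Set (V → ℤ) := {e | ∀ v, (v ∈ S → e v ≤ -1) ∧ (v ∉ S → 0 ≤ e v)}

/-- The variables in the blocks of `α`. -/
def blockVars (b : Q → β) (x : Q → V) (α : Finset β) : Set V := {v | ∃ q, x q = v ∧ b q ∈ α}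

theorem mem_invExponents_iff {S : Set V} {e : V → ℤ} :
    e ∈ invExponents S ↔ ∀ v, e v < 0 ↔ v ∈ S := by
  refine forall_congr' fun v => ?_
  by_cases hv : v ∈ S <;> simp only [hv, true_implies, not_true, not_false_eq_true, false_implies,
    and_true, true_and, iff_true, iff_false] <;> omega

theorem stratum_iff {α : Finset β} {e : V → ℤ} :
    Stratum x (Finset.univ.filter (b · ∉ αᶜ)) e ↔ e ∈ invExponents (blockVars b x α) := by
  rw [mem_invExponents_iff]
  refine forall_congr' fun v => iff_congr Iff.rfl ?_
  simp only [Finset.mem_filter, Finset.mem_univ, true_and, Finset.mem_compl, not_not, blockVars,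
    Set.mem_ofPred_eq]
  exact exists_congr fun q => and_comm

theorem blockVars_injective (hx : Function.Injective x) (hs : Function.Surjective b) :
    Function.Injective (blockVars b x) := by
  have : ∀ {α α' : Finset β}, blockVars b x α = blockVars b x α' → α ⊆ α' := by
    intro α α' h i hi
    obtain ⟨q, rfl⟩ := hs i
    have hq : x q ∈ blockVars b x α' := h ▸ ⟨q, rfl, hi⟩
    obtain ⟨q', hq', h'⟩ := hq
    rwa [← hx hq']
  exact fun α α' h => (this h).antisymm (this h.symm)

theorem eq_of_mem_invExponents {S S' : Set V} {e : V → ℤ} (h : e ∈ invExponents S)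
    (h' : e ∈ invExponents S') : S = S' := by
  ext v
  rw [← mem_invExponents_iff.1 h, mem_invExponents_iff.1 h']

variable (hb hs)

/-- The critical coefficients of a cochain for the blocks in `α`. -/
def evalAt (j : β → Q) (α : Finset β) :
    (blockSystem k x hb hs).Cochain →ₗ[k] invExponents (blockVars b x α) →₀ k :=
  Finsupp.lsubtypeDomain _ ∘ₗ expSome hb hs (critical b j αᶜ)

variable {hb hs}

theorem evalAt_apply (j : β → Q) (α : Finset β) (c : (blockSystem k x hb hs).Cochain)
    (e : invExponents (blockVars b x α)) :
    evalAt hb hs j α c e = expSome hb hs (critical b j αᶜ) c e.1 := rfl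

theorem evalAt_comp (j : β → Q) (α : Finset β) (p : ℕ) (c : (blockSystem k x hb hs).Cochain) :
    evalAt hb hs j α ((blockSystem k x hb hs).comp p c) =
      if (critical b j αᶜ).card + 1 - Fintype.card β = p then evalAt hb hs j α c else 0 := by
  ext e
  rw [evalAt_apply, expSome_comp]
  split_ifs <;> rfl

open Classical in
theorem evalAt_projCochain {D : Type*} [AddCommGroup D] {w : V → D}
    (hX : ∀ j, ∃ c, IsWeightedHomogeneous w ((blockSystem k x hb hs).el j) c) (j : β → Q)
    (α : Finset β) (a : D) (c : (blockSystem k x hb hs).Cochain)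
    (e : invExponents (blockVars b x α)) :
    evalAt hb hs j α (projCochain hX a c) e =
      if expDeg w e.1 = a then evalAt hb hs j α c e else 0 :=
  expSome_projCochain hX a c _ _

/-- The simplicial part vanishes because critical sets have no faces in the strand. The augmentation
part has no negative exponents, whereas a non-empty `α` requires some. -/
theorem evalAt_d (hx : Function.Injective x) {j : β → Q} (hj : ∀ i, b (j i) = i) {α : Finset β}
    (hα : α.Nonempty) (y : (blockSystem k x hb hs).Cochain) :
    evalAt hb hs j α ((blockSystem k x hb hs).d y) = 0 := by
  classical
  ext ⟨e, he⟩
  rw [evalAt_apply, expSome_d, Finsupp.add_apply]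
  have hst := stratum_iff.2 he
  set M := Finset.univ.filter (b · ∉ αᶜ)
  have h1 : bd (fun τ => expSome hb hs τ y) (critical b j αᶜ) e = 0 := by
    have h := bd_eq_zero_of_isCritical (isCritical_critical hj αᶜ)
      (fun q hq => Finset.mem_filter.2 ⟨Finset.mem_univ _, hq⟩) (supportedOn_stratumPart hx M y)
    rw [← map_bd] at h
    have h' := DFunLike.congr_fun h e
    rwa [stratumPart_apply, if_pos hst] at h'
  have h2 : expNone hb hs y e = 0 := by
    by_contra h
    obtain ⟨i, hi⟩ := hα
    have := (he (x (j i))).1 ⟨j i, rfl, by rwa [hj]⟩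
    have := nonneg_of_expNone_ne_zero h (x (j i))
    omega
  rw [h1, zero_add, Finsupp.coe_zero, Pi.zero_apply]
  split_ifs
  exacts [h2, rfl]

theorem mem_range_d_of_evalAt (hx : Function.Injective x) {j : β → Q} (hj : ∀ i, b (j i) = i)
    {c : (blockSystem k x hb hs).Cochain} (hc : (blockSystem k x hb hs).d c = 0)
    (h : ∀ α : Finset β, α.Nonempty → evalAt hb hs j α c = 0) :
    c ∈ LinearMap.range (blockSystem k x hb hs).d := by
  refine exists_d_eq hx hj hc fun D hD e he => ?_
  obtain ⟨α, rfl⟩ : ∃ α, D = αᶜ := ⟨Dᶜ, (compl_compl D).symm⟩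
  have hα : α.Nonempty := by
    rw [Finset.nonempty_iff_ne_empty]
    rintro rfl
    exact hD Finset.compl_empty
  exact DFunLike.congr_fun (h α hα) ⟨e, stratum_iff.1 he⟩

/-- The prescribed function for `α` is placed at all critical sets of `αᶜ` simultaneously, which is
a cocycle by `bd_critical`. Different `α` involve disjoint sets of exponents, so the sum has all the
required values. -/
theorem exists_cocycle_evalAt (hx : Function.Injective x) {j : β → Q} (hj : ∀ i, b (j i) = i)
    (y : ∀ α : Finset β, invExponents (blockVars b x α) →₀ k) :
    ∃ c : (blockSystem k x hb hs).Cochain, (blockSystem k x hb hs).d c = 0 ∧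
      ∀ α : Finset β, evalAt hb hs j α c = y α := by
  classical
  let Y : Finset β → (V → ℤ) →₀ k := fun α => (y α).extendDomain
  have hY : ∀ α e (he : e ∈ invExponents (blockVars b x α)), Y α e = y α ⟨e, he⟩ :=
    fun α e he => dif_pos he
  have hY0 : ∀ α e, Y α e ≠ 0 → e ∈ invExponents (blockVars b x α) := by
    intro α e h
    by_contra he
    exact h (dif_neg he)
  let f : Finset β → Finset Q → (V → ℤ) →₀ k := fun α τ => if IsCritical b αᶜ τ then Y α else 0
  obtain ⟨c, hc0, hc⟩ := exists_cochain (k := k) (x := x) (hb := hb) (hs := hs) 0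
    (fun e he => absurd rfl he) (fun τ => ∑ α, f α τ)
    (fun τ e he => by
      rw [Finsupp.finsetSum_apply] at he
      obtain ⟨α, _, h⟩ := Finset.exists_ne_zero_of_sum_ne_zero he
      simp only [f] at h
      split_ifs at h with hcr
      · refine ⟨hcr.meetsAll hs, fun v hv => ?_⟩
        obtain ⟨q, rfl, hq⟩ := (mem_invExponents_iff.1 (hY0 α e h) v).1 hv
        exact ⟨q, hcr.1 q (by simpa using hq), rfl⟩
      · exact absurd rfl h)
  refine ⟨c, cochain_ext ?_ fun τ => ?_, fun α => ?_⟩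
  · rw [expNone_d, map_zero]
  · rw [expSome_d, hc0, ite_self, add_zero, map_zero]
    have : (fun τ => expSome hb hs τ c) = fun τ => ∑ α, f α τ := funext hc
    rw [this, bd]
    simp only [Finset.smul_sum]
    rw [Finset.sum_comm]
    exact Finset.sum_eq_zero fun α _ => bd_critical hb αᶜ (Y α) τ
  · ext ⟨e, he⟩
    rw [evalAt_apply, hc, Finsupp.finsetSum_apply, Finset.sum_eq_single α]
    · simp only [f]
      rw [if_pos (isCritical_critical hj _), hY α e he]
    · intro α' _ hα'
      simp only [f]
      split_ifs
      · by_contra h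
        exact hα' (blockVars_injective hx hs (eq_of_mem_invExponents (hY0 α' e h) he))
      · rfl
    · exact fun h => absurd (Finset.mem_univ _) h

open Classical in
/-- The evaluations are linear over the polynomial ring if no block of several blocks has exactly
one element. -/
theorem evalAt_X_smul (hx : Function.Injective x) {j : β → Q} (hj : ∀ i, b (j i) = i)
    (hβ : Subsingleton β ∨ ∀ q, ∃ q', q' ≠ q ∧ b q' = b q) {α : Finset β}
    (hα : α.Nonempty) {c : (blockSystem k x hb hs).Cochain}
    (hc : (blockSystem k x hb hs).d c = 0) (v : V) (e : invExponents (blockVars b x α)) :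
    evalAt hb hs j α ((X v : MvPolynomial V k) • c) e =
      if h : e.1 - Pi.single v 1 ∈ invExponents (blockVars b x α) then
        evalAt hb hs j α c ⟨e.1 - Pi.single v 1, h⟩ else 0 := by
  obtain ⟨e, he⟩ := e
  have hcast : castExp (Finsupp.single v 1) = (Pi.single v 1 : V → ℤ) := by
    ext v'
    simp only [castExp, Finsupp.single_apply, Pi.single_apply, eq_comm]
    split_ifs <;> rfl
  rw [evalAt_apply]
  change expSome hb hs _ ((monomial (Finsupp.single v 1) 1 : MvPolynomial V k) • c) e = _
  rw [expSome_monomial_smul, hcast]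
  simp only
  split_ifs with h
  · rfl
  by_contra hne
  obtain ⟨-, hsub⟩ := exists_of_expSome_ne_zero hne
  obtain ⟨M, hM⟩ := exists_stratum hsub
  have hMτ := hM.subset hx hsub
  rw [mem_invExponents_iff] at he
  -- Lowering the exponent of `v` leaves the set of exponents of `α` only by creating a pole at a
  -- variable outside the blocks of `α`.
  have hv : v ∉ blockVars b x α ∧ e v - 1 < 0 := by
    by_contra hv
    refine h (mem_invExponents_iff.2 fun v' => ?_)
    rw [← he v', Pi.sub_apply]
    rcases eq_or_ne v' v with rfl | hv'
    · rw [Pi.single_eq_same]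
      constructor
      · intro h1
        by_contra h2
        exact hv ⟨fun h3 => h2 ((he v').2 h3), h1⟩
      · intro h1; omega
    · rw [Pi.single_eq_of_ne hv', sub_zero]
  obtain ⟨q, hq, hqv⟩ := hsub v (by rw [Pi.sub_apply, Pi.single_eq_same]; exact hv.2)
  have hbq : b q ∉ α := fun h => hv.1 ⟨q, hqv, h⟩
  have hqM : q ∈ M := by
    obtain ⟨q', hq', h'⟩ := (hM v).1 (by rw [Pi.sub_apply, Pi.single_eq_same]; exact hv.2)
    rwa [← hx (h'.trans hqv.symm)]
  rcases hβ with hβ | hβ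
  · obtain ⟨i, hi⟩ := hα
    exact hbq (Subsingleton.elim i (b q) ▸ hi)
  obtain ⟨q', hq', hbq'⟩ := hβ q
  have hcrit := isCritical_critical hj αᶜ
  -- The pole set `M` lies in the critical set, which has only `q` in this block.
  have hq'M : q' ∉ M := by
    intro hm
    obtain ⟨u, hu⟩ := Finset.card_eq_one.1 (hcrit.2 (b q) (by simpa using hbq))
    have e1 : q ∈ (critical b j αᶜ).filter (b · = b q) := Finset.mem_filter.2 ⟨hq, rfl⟩
    have e2 : q' ∈ (critical b j αᶜ).filter (b · = b q) := Finset.mem_filter.2 ⟨hMτ hm, hbq'⟩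
    rw [hu, Finset.mem_singleton] at e1 e2
    exact hq' (e2.trans e1.symm)
  -- So `c` is a coboundary on the stratum of `M`, and coboundaries vanish at critical sets.
  obtain ⟨y, hy, hcy⟩ := exists_bd_eq_of_partial hb hj hqM hq'M hbq'
    (supportedOn_stratumPart hx M c) (bd_stratumPart_eq_zero hj hc M)
  have h0 := hcy (critical b j αᶜ)
  rw [bd_eq_zero_of_isCritical hcrit (fun p hp => ?_) hy] at h0
  · have h1 := DFunLike.congr_fun h0 (e - Pi.single v 1)
    rw [stratumPart_apply, if_pos hM] at h1
    exact hne h1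
  · have hpα : b p ∈ α := by simpa using hp
    have hpe : e (x p) < 0 := (he _).2 ⟨p, rfl, hpα⟩
    have hpv : x p ≠ v := fun h => hv.1 ⟨p, h, hpα⟩
    obtain ⟨p', hp', h'⟩ := (hM (x p)).1 (by
      rw [Pi.sub_apply, Pi.single_eq_of_ne hpv, sub_zero]; exact hpe)
    rwa [← hx h']

/-- Cocycles are torsion modulo coboundaries for a product of one variable from each block. -/
theorem blockSystem_torsion (hx : Function.Injective x) {j : β → Q} (hj : ∀ i, b (j i) = i)
    {c : (blockSystem k x hb hs).Cochain} (hc : (blockSystem k x hb hs).d c = 0) (t : β → Q)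
    (ht : ∀ i, b (t i) = i) :
    ∃ n : ℕ, (∏ i, X (x (t i)) : MvPolynomial V k) ^ n • c ∈
      LinearMap.range (blockSystem k x hb hs).d := by
  -- A bound for all exponents that occur in `c`. After multiplication by the `n`-th power, no term
  -- has a pole at any `x (t i)`, while evaluation at a non-empty `α` sees only terms with such a
  -- pole.
  let n : ℕ := ∑ τ : Finset Q, ∑ e ∈ (expSome hb hs τ c).support, ∑ v, (e v).natAbs
  have hn : ∀ τ e v, expSome hb hs τ c e ≠ 0 → -(n : ℤ) ≤ e v := by
    intro τ e v he
    have h1 : (e v).natAbs ≤ ∑ v, (e v).natAbs :=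
      Finset.single_le_sum (f := fun v => (e v).natAbs) (fun _ _ => Nat.zero_le _)
        (Finset.mem_univ v)
    have h2 : ∑ v, (e v).natAbs ≤ ∑ e ∈ (expSome hb hs τ c).support, ∑ v, (e v).natAbs :=
      Finset.single_le_sum (f := fun e : V → ℤ => ∑ v, (e v).natAbs) (fun _ _ => Nat.zero_le _)
        (Finsupp.mem_support_iff.2 he)
    have h3 : ∑ e ∈ (expSome hb hs τ c).support, ∑ v, (e v).natAbs ≤ n :=
      Finset.single_le_sum
        (f := fun τ : Finset Q => ∑ e ∈ (expSome hb hs τ c).support, ∑ v, (e v).natAbs)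
        (fun _ _ => Nat.zero_le _) (Finset.mem_univ τ)
    omega
  refine ⟨n, mem_range_d_of_evalAt hx hj (by rw [map_smul, hc, smul_zero]) fun α hα => ?_⟩
  ext ⟨e, he⟩
  have hmon : (∏ i, X (x (t i)) : MvPolynomial V k) ^ n =
      monomial (n • ∑ i, Finsupp.single (x (t i)) 1) 1 := by
    rw [show (∏ i, X (x (t i)) : MvPolynomial V k) =
      monomial (∑ i, Finsupp.single (x (t i)) 1) 1 by rw [monomial_sum_one]; rfl,
      monomial_pow, one_pow]
  rw [evalAt_apply, hmon, expSome_monomial_smul, Finsupp.coe_zero, Pi.zero_apply]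
  by_contra h
  obtain ⟨i, hi⟩ := hα
  have h1 : -(n : ℤ) ≤ (e - castExp (n • ∑ i, Finsupp.single (x (t i)) 1) : V → ℤ) (x (t i)) :=
    hn _ _ (x (t i)) h
  have h2 : e (x (t i)) ≤ -1 := (he _).1 ⟨t i, rfl, by rwa [ht]⟩
  rw [Pi.sub_apply, castExp, Finsupp.smul_apply, Finsupp.finsetSum_apply] at h1
  have h3 : 1 ≤ ∑ i', Finsupp.single (x (t i')) 1 (x (t i)) := by
    refine le_trans ?_ (Finset.single_le_sum
      (f := fun i' => Finsupp.single (x (t i')) 1 (x (t i))) (fun _ _ => Nat.zero_le _)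
      (Finset.mem_univ i))
    simp
  rw [smul_eq_mul, Nat.cast_mul] at h1
  have h4 : (1 : ℤ) ≤ ((∑ i', Finsupp.single (x (t i')) 1 (x (t i)) : ℕ) : ℤ) := by
    exact_mod_cast h3
  have h5 : (n : ℤ) * 1 ≤ n * ((∑ i', Finsupp.single (x (t i')) 1 (x (t i)) : ℕ) : ℤ) :=
    mul_le_mul_of_nonneg_left h4 (Nat.cast_nonneg _)
  linarith

end Evaluation

end LocComplex

end

noncomputable section

namespace LocComplex

open MvPolynomial

set_option linter.unusedSectionVars false

/-! ### Comparison of Cech cohomology with inverse monomials -/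

theorem exists_linearEquiv_of_ker_eq {k W M M' : Type*} [CommRing k] [AddCommGroup W]
    [AddCommGroup M] [AddCommGroup M'] [Module k W] [Module k M] [Module k M'] (f : W →ₗ[k] M)
    (g : W →ₗ[k] M') (hf : Function.Surjective f) (hg : Function.Surjective g)
    (h : ∀ w, f w = 0 ↔ g w = 0) : ∃ E : M ≃ₗ[k] M', ∀ w, E (f w) = g w := by
  have hk : LinearMap.ker f = LinearMap.ker g := Submodule.ext h
  refine ⟨(f.quotKerEquivOfSurjective hf).symm ≪≫ₗ Submodule.quotEquivOfEq _ _ hk ≪≫ₗ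
    g.quotKerEquivOfSurjective hg, fun w => ?_⟩
  have : (f.quotKerEquivOfSurjective hf).symm (f w) = Submodule.Quotient.mk w := by
    rw [LinearEquiv.symm_apply_eq]
    rfl
  rw [LinearEquiv.trans_apply, LinearEquiv.trans_apply, this]
  rfl

section TotGrading

variable {k : Type*} [CommRing k] {V : Type*} {D : Type*} [AddCommGroup D] {w : V → D}

theorem proj_proj {u : MvPolynomial V k} (hu : ∃ c, IsWeightedHomogeneous w u c) (a : D)
    (z : Localization.Away u) : proj hu a (proj hu a z) = proj hu a z := by
  obtain ⟨n, c, x, hn, -, hz⟩ := exists_pow_smul_proj hu a z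
  have := proj_eq_self hu (weightedHomogeneousComponent_isWeightedHomogeneous (c + a) x) hn rfl hz
  rwa [add_sub_cancel_left] at this

theorem exists_isWeightedHomogeneous_prod {ι : Type*} {f : ι → MvPolynomial V k}
    (hf : ∀ i, ∃ c, IsWeightedHomogeneous w (f i) c) (σ : Finset ι) :
    ∃ c, IsWeightedHomogeneous w (∏ i ∈ σ, f i) c := by
  choose c hc using hf
  exact ⟨_, IsWeightedHomogeneous.prod σ f c fun i _ => hc i⟩

variable {N : ℕ} {f : Fin N → MvPolynomial V k} {I : Type*} [Fintype I]
  {X : LocSystem (MvPolynomial V k) I} {o : I}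

theorem exists_isWeightedHomogeneous_tot (hf : ∀ i, ∃ c, IsWeightedHomogeneous w (f i) c)
    (hX : ∀ i, ∃ c, IsWeightedHomogeneous w (X.el i) c) (i : Finset (Fin N) × I) :
    ∃ c, IsWeightedHomogeneous w ((tot f X).el i) c := by
  obtain ⟨c, hc⟩ := exists_isWeightedHomogeneous_prod hf i.1
  obtain ⟨c', hc'⟩ := hX i.2
  exact ⟨_, hc.mul hc'⟩

theorem prCoeff_projCochain (hT : ∀ i, ∃ c, IsWeightedHomogeneous w ((tot f X).el i) c)
    (hX : ∀ i, ∃ c, IsWeightedHomogeneous w (X.el i) c) (a : D) (c : (tot f X).Cochain) :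
    prCoeff f X (projCochain hT a c) = projCochain hX a (prCoeff f X c) := by
  ext i
  rw [prCoeff_apply, projCochain_apply, projCochain_apply, prCoeff_apply]
  exact (proj_tr (hT (∅, i)) (hX i) (prod_empty_mul_dvd _) a _).symm

/-- The projection of the Cech cochains to their part of multidegree `a`. -/
def cechProj (hf : ∀ i, ∃ c, IsWeightedHomogeneous w (f i) c) (p : ℕ) (a : D) :
    Cech.Cochain f p →ₗ[k] Cech.Cochain f p :=
  LinearMap.pi fun σ => proj (exists_isWeightedHomogeneous_prod hf σ.1) a ∘ₗ LinearMap.proj σ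

theorem cechProj_cechProj (hf : ∀ i, ∃ c, IsWeightedHomogeneous w (f i) c) (p : ℕ) (a : D)
    (c : Cech.Cochain f p) : cechProj hf p a (cechProj hf p a c) = cechProj hf p a c :=
  funext fun _ => proj_proj _ a _

theorem toCechCocycles_projCochain (h1 : X.el o = 1) (ho : X.deg o = 0)
    (hf : ∀ i, ∃ c, IsWeightedHomogeneous w (f i) c)
    (hT : ∀ i, ∃ c, IsWeightedHomogeneous w ((tot f X).el i) c) (a : D) {p : ℕ}
    (c : (tot f X).cocycles p) :
    (toCechCocycles h1 ho p ⟨projCochain hT a c.1, projCochain_mem_cocycles hT a c.2⟩).1 =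
      cechProj hf p a (toCechCocycles h1 ho p c).1 :=
  funext fun σ => (proj_tr (hT (σ.1, o)) (exists_isWeightedHomogeneous_prod hf σ.1)
    (by change _ * X.el o ∣ _; rw [h1, mul_one]) a _).symm

end TotGrading

section Comparison

variable {k : Type*} [CommRing k] {V : Type*} [Fintype V] [DecidableEq V]
variable {Q : Type*} [LinearOrder Q] [Fintype Q] {β : Type*} [DecidableEq β] [Fintype β]
variable {b : Q → β} {x : Q → V} (hb : Contiguous b) (hs : Function.Surjective b)
variable {N : ℕ} {g : Fin N → MvPolynomial V k}

/-- A set that meets every block contains one variable from each, and the product of these lies in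
the product ideal. -/
theorem el_mem_radical
    (hg : Ideal.span (Set.range g) = ∏ i, Ideal.span ((fun q => X (x q)) '' {q | b q = i}))
    (i : Option {τ : Finset Q // MeetsAll b τ}) (hi : i ≠ none) :
    (blockSystem k x hb hs).el i ∈ (Ideal.span (Set.range g)).radical := by
  classical
  rcases i with _ | τ
  · exact absurd rfl hi
  refine Ideal.le_radical ?_
  choose t ht hbt using τ.2
  have hinj : Function.Injective t := fun i i' h => by rw [← hbt i, ← hbt i', h]
  have h1 : ∏ i, (X (x (t i)) : MvPolynomial V k) ∣ ∏ q ∈ τ.1, X (x q) := by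
    rw [← Finset.prod_image (f := fun q => (X (x q) : MvPolynomial V k)) (g := t) hinj.injOn]
    exact Finset.prod_dvd_prod_of_subset _ _ _ (Finset.image_subset_iff.2 fun i _ => ht i)
  rw [hg]
  exact Ideal.mem_of_dvd _ h1
    (Ideal.prod_mem_prod fun i _ => Ideal.subset_span ⟨t i, hbt i, rfl⟩)

/-- The product ideal is generated by products of one variable from each block, for which
`blockSystem_torsion` applies; the elements with torsion property form a radical ideal. -/
theorem exists_pow_smul_mem_range_d (hx : Function.Injective x) {j : β → Q}
    (hj : ∀ i, b (j i) = i)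
    (hg : Ideal.span (Set.range g) = ∏ i, Ideal.span ((fun q => X (x q)) '' {q | b q = i}))
    (c : (blockSystem k x hb hs).Cochain) (hc : (blockSystem k x hb hs).d c = 0) (i : Fin N) :
    ∃ n : ℕ, g i ^ n • c ∈ LinearMap.range (blockSystem k x hb hs).d := by
  have hi : g i ∈ Ideal.span (Set.range g) := Ideal.subset_span ⟨i, rfl⟩
  rw [hg, Ideal.prod_span] at hi
  refine exists_pow_smul_mem_of_mem_radical _ c ?_ (Ideal.le_radical hi)
  intro a ha
  obtain ⟨y, hy, rfl⟩ := (Set.mem_fintype_prod _ _).1 ha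
  choose t ht hty using hy
  obtain ⟨n, hn⟩ := blockSystem_torsion hx hj hc t ht
  refine ⟨n, ?_⟩
  simpa only [hty] using hn

theorem exists_isWeightedHomogeneous_el {D : Type*} [AddCommGroup D] (w : V → D)
    (i : Option {τ : Finset Q // MeetsAll b τ}) :
    ∃ c, IsWeightedHomogeneous w ((blockSystem k x hb hs).el i) c := by
  obtain ⟨m, hm⟩ := exists_el_eq_monomial (k := k) (x := x) hb hs i
  exact ⟨_, hm ▸ isWeightedHomogeneous_monomial w m 1 rfl⟩

/-- The sets of blocks that contribute in cohomological degree `p`. -/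
abbrev Contribution (b : Q → β) (j : β → Q) (p : ℕ) : Type _ :=
  {α : Finset β // α.Nonempty ∧ (critical b j αᶜ).card + 1 - Fintype.card β = p}

include hb hs in
open Classical in
/-- The Cech cohomology of a polynomial ring for a product of ideals generated by disjoint sets
of variables, in terms of inverse monomials. -/
theorem exists_cohomology_equiv (hx : Function.Injective x) {j : β → Q} (hj : ∀ i, b (j i) = i)
    (hg : Ideal.span (Set.range g) = ∏ i, Ideal.span ((fun q => X (x q)) '' {q | b q = i}))
    {D : Type*} [AddCommGroup D] {w : V → D} (hw : ∀ i, ∃ c, IsWeightedHomogeneous w (g i) c)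
    (p : ℕ) :
    ∃ E : Cech.Cohomology g p ≃ₗ[k]
        ((α : Contribution b j p) → invExponents (blockVars b x α.1) →₀ k),
      (∀ a z, (∃ c : Cech.cocycles g p, cechProj hw p a c.1 = c.1 ∧ Submodule.mkQ _ c = z) ↔
        ∀ α e, E z α e ≠ 0 → expDeg w e.1 = a) ∧
      ((Subsingleton β ∨ ∀ q, ∃ q', q' ≠ q ∧ b q' = b q) → ∀ v z α e,
        E ((X v : MvPolynomial V k) • z) α e =
          if h : e.1 - Pi.single v 1 ∈ invExponents (blockVars b x α.1) then
            E z α ⟨e.1 - Pi.single v 1, h⟩ else 0) := by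
  have hrad := el_mem_radical (k := k) hb hs hg
  have htors := exists_pow_smul_mem_range_d (k := k) hb hs hx hj hg
  have h1 : (blockSystem k x hb hs).el none = 1 := rfl
  have ho : (blockSystem k x hb hs).deg none = 0 := rfl
  have hX := exists_isWeightedHomogeneous_el (k := k) (x := x) hb hs w
  have hT := exists_isWeightedHomogeneous_tot hw hX
  -- Both sides are quotients of the cocycles of the total complex: `f1` passes to Čech cohomology,
  -- `f2` reads critical coefficients, and the two kernels are the coboundaries in `W`.
  let W := (tot g (blockSystem k x hb hs)).cocycles p
  let f1 : W →ₗ[MvPolynomial V k] Cech.Cohomology g p :=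
    Submodule.mkQ _ ∘ₗ toCechCocycles h1 ho p
  have hf1 : Function.Surjective f1 :=
    (Submodule.mkQ_surjective _).comp (toCechCocycles_surjective h1 ho hrad p)
  let f2 : W →ₗ[k] ((α : Contribution b j p) → invExponents (blockVars b x α.1) →₀ k) :=
    LinearMap.pi fun α => evalAt hb hs j α.1 ∘ₗ
      (prCoeff g (blockSystem k x hb hs) ∘ₗ W.subtype).restrictScalars k
  have hf2 : Function.Surjective f2 := by
    intro y
    obtain ⟨c, hc, hcy⟩ := exists_cocycle_evalAt (k := k) (hb := hb) (hs := hs) hx hj fun α =>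
      if h : α.Nonempty ∧ (critical b j αᶜ).card + 1 - Fintype.card β = p then y ⟨α, h⟩ else 0
    -- Cutting down to degree `p` does not affect evaluation at the `α` that contribute there.
    obtain ⟨v, hv, hvc⟩ := prCoeff_surjective_on_cocycles htors (p := p)
      (z := (blockSystem k x hb hs).comp p c)
      ⟨LocSystem.d_comp_eq_zero _ _ hc, LocSystem.comp_comp _ _ _⟩
    refine ⟨⟨v, hv⟩, funext fun α => ?_⟩
    change evalAt hb hs j α.1 (prCoeff g _ v) = y α
    rw [hvc, evalAt_comp, if_pos α.2.2, hcy, dif_pos α.2]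
  have hker : ∀ v, f1.restrictScalars k v = 0 ↔ f2 v = 0 := by
    intro v
    have e1 : f1 v = 0 ↔ v.1 ∈ LinearMap.range (tot g (blockSystem k x hb hs)).d := by
      rw [← toCechCocycles_mem_coboundaries h1 ho hrad p v]
      exact Submodule.Quotient.mk_eq_zero _
    refine e1.trans ?_
    rw [← (prCoeff_quasiIso htors).2 v.1 v.2.1]
    have hv := prCoeff_mem_cocycles v.2
    constructor
    · rintro ⟨y, hy⟩
      ext1 α
      change evalAt hb hs j α.1 (prCoeff g _ v.1) = 0
      rw [← hy, evalAt_d hx hj α.2.1]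
    · intro h
      refine mem_range_d_of_evalAt hx hj hv.1 fun α hα => ?_
      by_cases hp : (critical b j αᶜ).card + 1 - Fintype.card β = p
      · exact congrFun h ⟨α, hα, hp⟩
      · rw [← (LocSystem.mem_cocycles.1 hv).2, evalAt_comp, if_neg hp]
  obtain ⟨E, hE⟩ := exists_linearEquiv_of_ker_eq (f1.restrictScalars k) f2 hf1 hf2 hker
  have hproj : ∀ a (v : W) α e,
      f2 ⟨projCochain hT a v.1, projCochain_mem_cocycles hT a v.2⟩ α e =
        if expDeg w e.1 = a then f2 v α e else 0 := by
    intro a v α e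
    change evalAt hb hs j α.1 (prCoeff g _ (projCochain hT a v.1)) e = _
    rw [prCoeff_projCochain hT hX, evalAt_projCochain]
    rfl
  refine ⟨E, fun a z => ⟨?_, fun h => ?_⟩, fun hβ v z α e => ?_⟩
  · rintro ⟨c, hc, rfl⟩ α e he
    obtain ⟨v, rfl⟩ := toCechCocycles_surjective h1 ho hrad p c
    have h2 : toCechCocycles h1 ho p ⟨projCochain hT a v.1, projCochain_mem_cocycles hT a v.2⟩ =
        toCechCocycles h1 ho p v := by
      refine Subtype.ext ?_
      rw [toCechCocycles_projCochain h1 ho hw hT, hc]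
    have h3 : E (Submodule.mkQ _ (toCechCocycles h1 ho p v)) = f2
        ⟨projCochain hT a v.1, projCochain_mem_cocycles hT a v.2⟩ := by
      rw [← hE, ← h2]
      rfl
    rw [h3, hproj] at he
    by_contra hne
    exact he (if_neg hne)
  · obtain ⟨v, rfl⟩ := hf1 z
    -- The degree `a` part of any representative represents the same class, since all its critical
    -- coefficients are unchanged.
    refine ⟨toCechCocycles h1 ho p
      ⟨projCochain hT a v.1, projCochain_mem_cocycles hT a v.2⟩, ?_, ?_⟩
    · rw [toCechCocycles_projCochain h1 ho hw hT, cechProj_cechProj]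
    · refine E.injective (((hE _).trans ?_).trans (hE v).symm)
      ext α e
      rw [hproj]
      split_ifs with he
      · rfl
      · by_contra hne
        exact he (h α e fun h0 => hne (by rw [← h0]; exact congrArg (· α e) (hE v)))
  · obtain ⟨u, rfl⟩ := hf1 z
    have h2 : (X v : MvPolynomial V k) • f1 u = f1 ((X v : MvPolynomial V k) • u) :=
      (map_smul f1 _ _).symm
    have h3 : ∀ u, E (f1 u) = f2 u := hE
    rw [h2, h3, h3]
    change evalAt hb hs j α.1 (prCoeff g _ ((X v : MvPolynomial V k) • u.1)) e = _
    rw [map_smul]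
    exact evalAt_X_smul hx hj hβ α.2.1 (prCoeff_mem_cocycles u.2).1 v e

end Comparison

end LocComplex

end

noncomputable section

namespace LocComplex

open MvPolynomial Multigraded

/-! ### Multigraded polynomial rings -/

section Multigrading

variable {k : Type*} [CommRing k] {s : ℕ} {r : Fin s → ℕ}

/-- The multidegrees of the variables. -/
abbrev varDeg (r : Fin s → ℕ) : Var r → Fin s → ℤ := fun v => Pi.single v.1 1

/-- A homogeneous fraction is fixed by the projection; conversely, the projection of a fraction over
a power of `g` is a homogeneous component of the numerator over that power. -/
theorem mem_locPart_iff {g : Ring k r} (hg : ∃ c, IsWeightedHomogeneous (varDeg r) g c)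
    {a : Fin s → ℤ} {z : Localization.Away g} : z ∈ locPart g a ↔ proj hg a z = z := by
  constructor
  · intro hz
    have hle : locPart g a ≤ LinearMap.eqLocus (proj hg a) LinearMap.id := by
      refine Submodule.span_le.2 ?_
      rintro _ ⟨b, c, x, ⟨u, n, rfl⟩, hx, hu, rfl, rfl⟩
      refine proj_eq_self hg (y := g ^ n) hx hu rfl ?_
      rw [Algebra.smul_def, ← Localization.mk_one_eq_algebraMap, ← Localization.mk_one_eq_algebraMap,
        Localization.mk_mul, one_mul]
      exact Localization.mk_eq_mk_iff.2 (Localization.r_of_eq (by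
        simp only [OneMemClass.coe_one, one_mul]))
    exact hle hz
  · intro hz
    obtain ⟨n, c, x, hn, -, h⟩ := exists_pow_smul_proj hg a z
    rw [hz] at h
    refine Submodule.subset_span ⟨c + a, c, _, ⟨g ^ n, n, rfl⟩,
      weightedHomogeneousComponent_isWeightedHomogeneous (c + a) x, hn,
      (add_sub_cancel_left c a).symm, ?_⟩
    refine pow_smul_injective dvd_rfl n (h.trans ?_)
    rw [Algebra.smul_def, ← Localization.mk_one_eq_algebraMap, ← Localization.mk_one_eq_algebraMap,
      Localization.mk_mul, one_mul]
    exact Localization.mk_eq_mk_iff.2 (Localization.r_of_eq (by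
      simp only [OneMemClass.coe_one, one_mul]))

theorem mem_cochainPart_iff {N : ℕ} {f : Fin N → Ring k r}
    (hf : ∀ i, ∃ c, IsWeightedHomogeneous (varDeg r) (f i) c) {p : ℕ} {a : Fin s → ℤ}
    {c : Cech.Cochain f p} : c ∈ cochainPart f p a ↔ cechProj hf p a c = c := by
  rw [cochainPart, Submodule.mem_pi, funext_iff]
  refine forall_congr' fun σ => ?_
  rw [forall_prop_of_true (Set.mem_univ σ)]
  exact mem_locPart_iff _

theorem mem_localCohomologyPart_iff {I : Ideal (Ring k r)} (G : HomogeneousGenerators k r I)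
    {p : ℕ} {a : Fin s → ℤ} {z : G.LocalCohomology p} :
    z ∈ G.localCohomologyPart p a ↔ ∃ c : Cech.cocycles G.gen p,
      cechProj (w := varDeg r) G.homogeneous p a c.1 = c.1 ∧ G.cls p c = z :=
  exists_congr fun _ => and_congr (mem_cochainPart_iff G.homogeneous) Iff.rfl

theorem expDeg_varDeg_eq_iff {e : Var r → ℤ} {a : Fin s → ℤ} :
    expDeg (varDeg r) e = a ↔ ∀ i, ∑ j : Fin (r i), e ⟨i, j⟩ = a i := by
  rw [funext_iff]
  refine forall_congr' fun i => ?_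
  rw [expDeg, Finset.sum_apply, Fintype.sum_sigma, Finset.sum_eq_single i]
  · simp
  · intro i' _ hi'
    simp [Pi.single_eq_of_ne hi'.symm]
  · exact fun h => absurd (Finset.mem_univ i) h

end Multigrading

/-! ### Inverse monomials -/

section InvModule

variable {k : Type*} [CommRing k] {s : ℕ} {r : Fin s → ℕ} {α : Finset (Fin s)}

/-- The coefficient of a monomial. -/
def invCoeff (e : {e : Var r → ℤ // IsInvExponent α e}) : InvModule k r α →ₗ[k] k :=
  Finsupp.lapply e

theorem invModule_ext {z z' : InvModule k r α} (h : ∀ e, invCoeff e z = invCoeff e z') : z = z' :=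
  Finsupp.ext h

theorem invModule_induction {P : InvModule k r α → Prop} (h0 : P 0)
    (hadd : ∀ z z', P z → P z' → P (z + z')) (hterm : ∀ e c, P (InvModule.term e c))
    (z : InvModule k r α) : P z :=
  Finsupp.induction_linear z h0 hadd hterm

theorem mem_invPart_iff {a : Fin s → ℤ} {z : InvModule k r α} :
    z ∈ InvModule.part k r α a ↔ ∀ e, invCoeff e z ≠ 0 → expDeg (varDeg r) e.1 = a := by
  have h : InvModule.part k r α a = Finsupp.supported k k
      {e : {e : Var r → ℤ // IsInvExponent α e} | expDeg (varDeg r) e.1 = a} := by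
    rw [Finsupp.supported_eq_span_single]
    refine congrArg (Submodule.span k) (Set.ext fun z => exists_congr fun e => ?_)
    exact and_congr expDeg_varDeg_eq_iff.symm eq_comm
  rw [h]
  exact (Finsupp.mem_supported k _).trans <| forall_congr' fun e => imp_congr Finsupp.mem_support_iff Iff.rfl

open Classical in
theorem invCoeff_monomialOrZero (e : {e : Var r → ℤ // IsInvExponent α e}) (e' : Var r → ℤ) :
    invCoeff e (InvModule.monomialOrZero k e' : InvModule k r α) = if e' = e.1 then 1 else 0 := by
  rw [InvModule.monomialOrZero]
  split_ifs with h h' h'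
  · subst h'
    exact Finsupp.single_eq_same
  · exact Finsupp.single_eq_of_ne fun h => h' (congrArg Subtype.val h).symm
  · exact absurd (h' ▸ e.2) h
  · exact map_zero _

open Classical in
-- Has the shape of `evalAt_X_smul`, so that the two actions can be compared coefficient by
-- coefficient.
theorem invCoeff_X_smul (v : Var r) (z : InvModule k r α)
    (e : {e : Var r → ℤ // IsInvExponent α e}) :
    invCoeff e ((X v : Ring k r) • z) =
      if h : IsInvExponent α (e.1 - Pi.single v 1) then invCoeff ⟨_, h⟩ z else 0 := by
  have h1 : (X v : Ring k r) • z = InvModule.mulMonomial k (Finsupp.single v 1) z := by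
    rw [X, InvModule.monomial_smul, one_smul]
  rw [h1]
  clear h1
  induction z using invModule_induction with
  | h0 => split_ifs <;> simp only [map_zero]
  | hadd f g hf hg =>
    rw [map_add, map_add, hf, hg]
    split_ifs
    · exact (map_add _ _ _).symm
    · exact add_zero _
  | hterm e' c =>
    rw [InvModule.mulMonomial_term, map_smul, InvModule.mulTerm, invCoeff_monomialOrZero, smul_eq_mul]
    have hiff : ((fun v' => e'.1 v' + ((Finsupp.single v 1 : Var r →₀ ℕ) v' : ℤ)) = e.1) ↔
        e'.1 = e.1 - Pi.single v 1 := by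
      have : (fun v' => e'.1 v' + ((Finsupp.single v 1 : Var r →₀ ℕ) v' : ℤ)) =
          e'.1 + Pi.single v 1 := by
        ext v'
        simp only [Finsupp.single_apply, Pi.add_apply, Pi.single_apply, eq_comm]
        split_ifs <;> rfl
      rw [this, eq_sub_iff_add_eq]
    rw [if_congr hiff rfl rfl]
    split_ifs with h2 h3 h3
    · rw [mul_one]
      have : e' = ⟨_, h3⟩ := Subtype.ext h2
      subst this
      exact Finsupp.single_eq_same.symm
    · exact absurd (h2 ▸ e'.2) h3
    · rw [mul_zero]
      exact (Finsupp.single_eq_of_ne fun h => h2 (congrArg Subtype.val h).symm).symm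
    · exact mul_zero _

/-- Finitely supported functions on a set of exponents, as inverse monomials. -/
def toInvModule {S : Set (Var r)} (hS : ∀ v, v ∈ S ↔ v.1 ∈ α) :
    (invExponents S →₀ k) ≃ₗ[k] InvModule k r α :=
  Finsupp.domLCongr (Equiv.subtypeEquivRight fun e => forall_congr' fun v => by rw [hS])

theorem mem_invExponents_of_iff {S : Set (Var r)} (hS : ∀ v, v ∈ S ↔ v.1 ∈ α) {e : Var r → ℤ} :
    e ∈ invExponents S ↔ IsInvExponent α e :=
  forall_congr' fun v => by rw [hS]

theorem invCoeff_toInvModule {S : Set (Var r)} (hS : ∀ v, v ∈ S ↔ v.1 ∈ α)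
    (y : invExponents S →₀ k) (e : {e : Var r → ℤ // IsInvExponent α e}) :
    invCoeff e (toInvModule hS y) = y ⟨e.1, (mem_invExponents_of_iff hS).2 e.2⟩ := rfl

theorem toInvModule_mem_part_iff {S : Set (Var r)} (hS : ∀ v, v ∈ S ↔ v.1 ∈ α) {a : Fin s → ℤ}
    {y : invExponents S →₀ k} : toInvModule hS y ∈ InvModule.part k r α a ↔
      ∀ e, y e ≠ 0 → expDeg (varDeg r) e.1 = a := by
  rw [mem_invPart_iff]
  exact ⟨fun h e => h ⟨e.1, (mem_invExponents_of_iff hS).1 e.2⟩, fun h e => h ⟨e.1, _⟩⟩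

open Classical in
theorem toInvModule_X_smul {S : Set (Var r)} (hS : ∀ v, v ∈ S ↔ v.1 ∈ α) (v : Var r)
    {y y' : invExponents S →₀ k} (h : ∀ e, y' e =
      if h : e.1 - Pi.single v 1 ∈ invExponents S then y ⟨e.1 - Pi.single v 1, h⟩ else 0) :
    toInvModule hS y' = (X v : Ring k r) • toInvModule hS y := by
  refine invModule_ext fun e => ?_
  rw [invCoeff_X_smul, invCoeff_toInvModule, h]
  by_cases h' : IsInvExponent α (e.1 - Pi.single v 1)
  · rw [dif_pos h', dif_pos ((mem_invExponents_of_iff hS).2 h'), invCoeff_toInvModule]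
  · rw [dif_neg h', dif_neg fun h => h' ((mem_invExponents_of_iff hS).1 h)]

/-- Maps that commute with the variables are linear over the polynomial ring. -/
theorem map_smul_of_map_X_smul {V M M' : Type*} [AddCommGroup M] [AddCommGroup M'] [Module k M]
    [Module k M'] [Module (MvPolynomial V k) M] [Module (MvPolynomial V k) M']
    [IsScalarTower k (MvPolynomial V k) M] [IsScalarTower k (MvPolynomial V k) M']
    (E : M →ₗ[k] M')
    (h : ∀ v z, E ((X v : MvPolynomial V k) • z) = (X v : MvPolynomial V k) • E z)
    (p : MvPolynomial V k) (z : M) : E (p • z) = p • E z := by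
  induction p using MvPolynomial.induction_on generalizing z with
  | C c =>
    rw [← MvPolynomial.algebraMap_eq, algebraMap_smul, algebraMap_smul, map_smul]
  | add p q hp hq => rw [add_smul, add_smul, map_add, hp, hq]
  | mul_X p v hp => rw [mul_smul, mul_smul, hp, h]

/-- The support of a module of inverse monomials. -/
theorem gradedSupport_invPart [Nontrivial k] (hr : ∀ i, 1 ≤ r i) (α : Finset (Fin s)) :
    gradedSupport (InvModule.part k r α) = orthant r α := by
  ext a
  constructor
  · intro ha
    obtain ⟨z, hz, hz0⟩ := Submodule.exists_mem_ne_zero_of_ne_bot ha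
    obtain ⟨e, he⟩ : ∃ e, invCoeff e z ≠ 0 := by
      by_contra! h
      exact hz0 (invModule_ext fun e => (h e).trans (map_zero _).symm)
    have hea := expDeg_varDeg_eq_iff.1 (mem_invPart_iff.1 hz e he)
    refine fun i => ⟨fun hi => ?_, fun hi => ?_⟩
    · rw [← hea i]
      refine (Finset.sum_le_sum fun j _ => (e.2 ⟨i, j⟩).1 hi).trans (le_of_eq ?_)
      simp
    · rw [← hea i]
      exact Finset.sum_nonneg fun j _ => (e.2 ⟨i, j⟩).2 hi
  · intro ha
    let c : Fin s → ℤ := fun i => if i ∈ α then -1 else 0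
    -- Exponent `-1` at the variables of `α` and `0` elsewhere, with the rest of the degree put on
    -- the first variable of each block.
    let e : Var r → ℤ := fun v => c v.1 + if v.2 = ⟨0, hr v.1⟩ then a v.1 - r v.1 * c v.1 else 0
    have he : IsInvExponent α e := by
      rintro ⟨i, j⟩
      refine ⟨fun hi => ?_, fun hi => ?_⟩
      · have := (ha i).1 hi
        simp only [e, c, if_pos hi]
        split_ifs <;> omega
      · have := (ha i).2 hi
        simp only [e, c, if_neg hi]
        split_ifs <;> omega
    have hz : (InvModule.term ⟨e, he⟩ 1 : InvModule k r α) ∈ InvModule.part k r α a := by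
      refine Submodule.subset_span ⟨⟨e, he⟩, fun i => ?_, rfl⟩
      have hei : ∀ j, e ⟨i, j⟩ = c i + if j = ⟨0, hr i⟩ then a i - r i * c i else 0 :=
        fun _ => rfl
      simp only [hei, Finset.sum_add_distrib, Finset.sum_ite_eq', Finset.mem_univ, if_true, Finset.sum_const, Finset.card_univ, Fintype.card_fin,
        nsmul_eq_mul]
      ring
    intro hbot
    rw [hbot, Submodule.mem_bot] at hz
    have h1 : invCoeff ⟨e, he⟩ (InvModule.term ⟨e, he⟩ 1 : InvModule k r α) = 1 :=
      Finsupp.single_eq_same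
    rw [hz, map_zero] at h1
    exact zero_ne_one h1

end InvModule

end LocComplex

end

noncomputable section

namespace LocComplex

open MvPolynomial Multigraded
open scoped DirectSum

/-! ### Local cohomology with support in the irrelevant ideal and in sums of blocks -/

section LocalCohomology

variable {k : Type*} [CommRing k] {s : ℕ} {r : Fin s → ℕ}

/-- The block of a variable. -/
def blockOf (r : Fin s → ℕ) (q : Lex (Var r)) : Fin s := (ofLex q).1

/-- The lexicographic order compares blocks first. -/
theorem contiguous_blockOf : Contiguous (blockOf r) := by
  have key : ∀ x q : Lex (Var r), blockOf r x ≠ blockOf r q →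
      (x < q ↔ blockOf r x < blockOf r q) := by
    intro x q h
    rw [Sigma.Lex.lt_def]
    exact or_iff_left fun h' => h h'.1
  intro q q' x h hx
  rw [key x q hx, key x q' (h ▸ hx), h]

theorem contiguous_of_subsingleton {Q β : Type*} [LinearOrder Q] [Subsingleton β] (b : Q → β) :
    Contiguous b := fun _ _ _ _ h => absurd (Subsingleton.elim _ _) h

theorem mem_blockVars_blockOf {α : Finset (Fin s)} (v : Var r) :
    v ∈ blockVars (blockOf r) ofLex α ↔ v.1 ∈ α :=
  ⟨fun ⟨_, h, h'⟩ => h ▸ h', fun h => ⟨toLex v, rfl, h⟩⟩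

theorem card_filter_blockOf (α : Finset (Fin s)) :
    (Finset.univ.filter (blockOf r · ∈ α)).card = ∑ i ∈ α, r i := by
  rw [Finset.card_filter]
  refine (Fintype.sum_equiv ofLex _ (fun v : Var r => if v.1 ∈ α then 1 else 0)
    fun _ => rfl).trans ?_
  rw [Fintype.sum_sigma, ← Finset.sum_filter_add_sum_filter_not Finset.univ (· ∈ α),
    Finset.sum_eq_zero (s := Finset.univ.filter (· ∉ α)) fun i hi => by
      simp [(Finset.mem_filter.1 hi).2], add_zero, Finset.filter_mem_eq_inter, Finset.univ_inter]
  exact Finset.sum_congr rfl fun i hi => by simp [hi]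

theorem span_blockOf (i : Fin s) :
    Ideal.span ((fun q => (X (ofLex q) : Ring k r)) '' {q | blockOf r q = i}) =
      blockIdeal k r i := by
  congr 1
  ext p
  constructor
  · rintro ⟨q, rfl, rfl⟩
    exact ⟨(ofLex q).2, rfl⟩
  · rintro ⟨j, rfl⟩
    exact ⟨toLex ⟨i, j⟩, rfl, rfl⟩

/-- Products of isomorphisms indexed by equivalent conditions. -/
def piCongrSubtype {ι : Type*} {p q : ι → Prop} (h : ∀ i, p i ↔ q i) {M M' : ι → Type*}
    [∀ i, AddCommGroup (M i)] [∀ i, AddCommGroup (M' i)] [∀ i, Module k (M i)]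
    [∀ i, Module k (M' i)] (φ : ∀ i, M i ≃ₗ[k] M' i) :
    ((i : {i // p i}) → M i.1) ≃ₗ[k] ((i : {i // q i}) → M' i.1) where
  toFun y i := φ i.1 (y ⟨i.1, (h i.1).2 i.2⟩)
  invFun y i := (φ i.1).symm (y ⟨i.1, (h i.1).1 i.2⟩)
  map_add' _ _ := funext fun i => map_add (φ i.1) _ _
  map_smul' _ _ := funext fun i => map_smul (φ i.1) _ _
  left_inv y := funext fun i => (φ i.1).symm_apply_apply (y i)
  right_inv y := funext fun i => (φ i.1).apply_symm_apply (y i)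

/-- A critical set has `|α| + (s - #α)` elements. Since `r i ≥ 1` gives `#α ≤ |α|`, the truncated
subtraction agrees with the integral one. -/
theorem contribution_iff (hr : ∀ i, 1 ≤ r i) {j : Fin s → Lex (Var r)}
    (hj : ∀ i, blockOf r (j i) = i) (ℓ : ℕ) (α : Finset (Fin s)) :
    (α.Nonempty ∧ (critical (blockOf r) j αᶜ).card + 1 - Fintype.card (Fin s) = ℓ) ↔
      (α.Nonempty ∧ (∑ i ∈ α, (r i : ℤ)) - ((α.card : ℤ) - 1) = (ℓ : ℤ)) := by
  refine and_congr_right fun hα => ?_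
  have h1 := card_filter_blockOf (r := r) α
  have h2 : α.card ≤ ∑ i ∈ α, r i := by
    simpa using Finset.sum_le_sum (s := α) fun i _ => hr i
  have h3 := α.card_compl
  have h4 := α.card_le_univ
  have h5 := hα.card_pos
  rw [card_critical hj]
  simp only [Finset.mem_compl, not_not]
  rw [h1, h3, ← Nat.cast_sum]
  omega

theorem exists_localCohomology_irrelevant_equiv (hr : ∀ i, 1 ≤ r i)
    (G : HomogeneousGenerators k r (irrelevantIdeal k r)) (ℓ : ℕ) :
    ∃ E : G.LocalCohomology ℓ ≃ₗ[k] ((α : Summand r ℓ) → InvModule k r α.1),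
      (∀ a z, z ∈ G.localCohomologyPart ℓ a ↔ ∀ α, E z α ∈ InvModule.part k r α.1 a) ∧
      ((s = 1 ∨ ∀ i, 2 ≤ r i) → ∀ (p : Ring k r) z, E (p • z) = p • E z) := by
  let j : Fin s → Lex (Var r) := fun i => toLex ⟨i, ⟨0, hr i⟩⟩
  have hj : ∀ i, blockOf r (j i) = i := fun _ => rfl
  have hg : Ideal.span (Set.range G.gen) = ∏ i,
      Ideal.span ((fun q => (X (ofLex q) : Ring k r)) '' {q | blockOf r q = i}) := by
    rw [G.span_eq, irrelevantIdeal]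
    exact Finset.prod_congr rfl fun i _ => (span_blockOf i).symm
  obtain ⟨E, hE, hX⟩ := exists_cohomology_equiv contiguous_blockOf (fun i => ⟨j i, hj i⟩)
    ofLex.injective hj hg (w := varDeg r) G.homogeneous ℓ
  let F : ((α : Contribution (blockOf r) j ℓ) → invExponents (blockVars (blockOf r) ofLex α.1) →₀ k)
      ≃ₗ[k] ((α : Summand r ℓ) → InvModule k r α.1) :=
    piCongrSubtype (M := fun α => invExponents (blockVars (blockOf r) ofLex α) →₀ k)
      (M' := fun α => InvModule k r α) (contribution_iff hr hj ℓ) fun α => toInvModule mem_blockVars_blockOf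
  let E' : G.LocalCohomology ℓ ≃ₗ[k]
      ((α : Contribution (blockOf r) j ℓ) → invExponents (blockVars (blockOf r) ofLex α.1) →₀ k) :=
    E
  refine ⟨E' ≪≫ₗ F, fun a z => ?_, fun hs => ?_⟩
  · rw [mem_localCohomologyPart_iff]
    refine (hE a z).trans ⟨fun h α => (toInvModule_mem_part_iff mem_blockVars_blockOf).2
      (h ⟨α.1, (contribution_iff hr hj ℓ α.1).2 α.2⟩), fun h α => ?_⟩
    exact (toInvModule_mem_part_iff mem_blockVars_blockOf).1
      (h ⟨α.1, (contribution_iff hr hj ℓ α.1).1 α.2⟩)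
  · have hβ : Subsingleton (Fin s) ∨ ∀ q, ∃ q', q' ≠ q ∧ blockOf r q' = blockOf r q := by
      rcases hs with rfl | hs
      · exact Or.inl inferInstance
      · refine Or.inr fun q => ?_
        have : Nontrivial (Fin (r (ofLex q).1)) := Fin.nontrivial_iff_two_le.2 (hs _)
        obtain ⟨l, hl⟩ := exists_ne (ofLex q).2
        refine ⟨toLex ⟨(ofLex q).1, l⟩, fun h => hl ?_, rfl⟩
        have h' : (⟨(ofLex q).1, l⟩ : Var r) = ⟨(ofLex q).1, (ofLex q).2⟩ := h
        exact eq_of_heq (Sigma.mk.inj h').2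
    refine map_smul_of_map_X_smul (E' ≪≫ₗ F).toLinearMap fun v z => funext fun α => ?_
    exact toInvModule_X_smul mem_blockVars_blockOf v fun e =>
      hX hβ v z ⟨α.1, (contribution_iff hr hj ℓ α.1).2 α.2⟩ e

theorem sumIdeal_eq_span (α : Finset (Fin s)) :
    sumIdeal k r α = Ideal.span
      (Set.range fun q : {q : Lex (Var r) // blockOf r q ∈ α} => (X (ofLex q.1) : Ring k r)) := by
  rw [sumIdeal, Ideal.sum_eq_sup]
  refine le_antisymm (Finset.sup_le fun i hi => Ideal.span_le.2 ?_) (Ideal.span_le.2 ?_)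
  · rintro _ ⟨j, rfl⟩
    exact Ideal.subset_span ⟨⟨toLex ⟨i, j⟩, hi⟩, rfl⟩
  · rintro _ ⟨⟨q, hq⟩, rfl⟩
    exact Finset.le_sup (f := blockIdeal k r) hq (Ideal.subset_span ⟨(ofLex q).2, rfl⟩)

/-- An ideal generated by variables is a product with one factor: all variables of `α` form a single
block indexed by `Unit`. The only non-empty set of blocks then contributes in degree `|α|`, and
linearity over the polynomial ring needs no condition on block sizes. -/
theorem exists_localCohomology_sum_equiv (hr : ∀ i, 1 ≤ r i) {α : Finset (Fin s)}
    (hα : α.Nonempty) (H : HomogeneousGenerators k r (sumIdeal k r α)) :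
    ∃ E : H.LocalCohomology (∑ i ∈ α, r i) ≃ₗ[Ring k r] InvModule k r α,
      ∀ a z, z ∈ H.localCohomologyPart (∑ i ∈ α, r i) a ↔ E z ∈ InvModule.part k r α a := by
  let Q := {q : Lex (Var r) // blockOf r q ∈ α}
  let b : Q → Unit := fun _ => ()
  let x : Q → Var r := fun q => ofLex q.1
  obtain ⟨i, hi⟩ := hα
  let j : Unit → Q := fun _ => ⟨toLex ⟨i, ⟨0, hr i⟩⟩, hi⟩
  have hj : ∀ u, b (j u) = u := fun _ => rfl
  have hg : Ideal.span (Set.range H.gen) = ∏ u,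
      Ideal.span ((fun q => (X (x q) : Ring k r)) '' {q | b q = u}) := by
    rw [H.span_eq, sumIdeal_eq_span, Fintype.prod_unique, ← Set.image_univ,
      show {q | b q = default} = Set.univ from Set.eq_univ_of_forall fun _ => rfl]
  obtain ⟨E, hE, hX⟩ := exists_cohomology_equiv (contiguous_of_subsingleton b)
    (fun u => ⟨j u, hj u⟩) (x := x) (ofLex.injective.comp Subtype.val_injective) (j := j) hj hg
    (w := varDeg r) H.homogeneous (∑ i ∈ α, r i)
  have hvars : ∀ v, v ∈ blockVars b x Finset.univ ↔ v.1 ∈ α := fun v =>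
    ⟨fun ⟨q, h, _⟩ => h ▸ q.2, fun h => ⟨⟨toLex v, h⟩, rfl, Finset.mem_univ _⟩⟩
  have hdeg : (critical b j (Finset.univ : Finset Unit)ᶜ).card + 1 - Fintype.card Unit =
      ∑ i ∈ α, r i := by
    have hQ : Fintype.card Q = ∑ i ∈ α, r i := by
      rw [Fintype.card_subtype, card_filter_blockOf]
    rw [card_critical hj, Finset.compl_univ,
      Finset.filter_true_of_mem fun _ _ => Finset.notMem_empty _, Finset.card_univ, hQ]
    rfl
  let u : Contribution b j (∑ i ∈ α, r i) := ⟨Finset.univ, Finset.univ_nonempty, hdeg⟩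
  have hu : ∀ u', u' = u := fun u' => Subtype.ext (Finset.eq_univ_iff_forall.2 fun y => by
    obtain ⟨y', hy'⟩ := u'.2.1
    exact Subsingleton.elim y' y ▸ hy')
  let _ : Unique (Contribution b j (∑ i ∈ α, r i)) := ⟨⟨u⟩, hu⟩
  let F : ((α' : Contribution b j (∑ i ∈ α, r i)) → invExponents (blockVars b x α'.1) →₀ k)
      ≃ₗ[k] InvModule k r α :=
    LinearEquiv.piUnique k _ ≪≫ₗ toInvModule hvars
  let E' : H.LocalCohomology (∑ i ∈ α, r i) ≃ₗ[k] InvModule k r α := LinearEquiv.trans E F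
  refine ⟨{ E' with map_smul' := map_smul_of_map_X_smul E'.toLinearMap fun v z => ?_ },
    fun a z => ?_⟩
  · exact toInvModule_X_smul hvars v fun e => hX (Or.inl inferInstance) v z u e
  · rw [mem_localCohomologyPart_iff]
    refine (hE a z).trans (Iff.trans ⟨fun h => h u, fun h u' => ?_⟩
      (toInvModule_mem_part_iff hvars).symm)
    rw [hu u']
    exact h

end LocalCohomology

/-! ### Graded isomorphisms of direct sums -/

section GradedIso

variable {S : Type*} [Semiring S] {D : Type*} {k : Type*} [CommRing k] {M M' M'' : Type*}
  [AddCommGroup M] [AddCommGroup M'] [AddCommGroup M''] [Module k M] [Module k M'] [Module k M'']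
  [Module S M] [Module S M'] [Module S M''] {P : D → Submodule k M} {P' : D → Submodule k M'}
  {P'' : D → Submodule k M''}

theorem gradedIso_symm (h : GradedIso S P P') : GradedIso S P' P := by
  obtain ⟨φ, hφ⟩ := h
  exact ⟨φ.symm, fun a z => by rw [hφ, φ.apply_symm_apply]⟩

theorem gradedIso_trans (h : GradedIso S P P') (h' : GradedIso S P' P'') : GradedIso S P P'' := by
  obtain ⟨φ, hφ⟩ := h
  obtain ⟨ψ, hψ⟩ := h'
  exact ⟨φ ≪≫ₗ ψ, fun a z => by rw [hφ, hψ]; rfl⟩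

end GradedIso

theorem gradedIso_directSum {S : Type*} [Semiring S] {D : Type*} {k : Type*} [CommRing k]
    {ι : Type*} {M M' : ι → Type*} [∀ i, AddCommGroup (M i)] [∀ i, AddCommGroup (M' i)]
    [∀ i, Module k (M i)] [∀ i, Module k (M' i)] [∀ i, Module S (M i)] [∀ i, Module S (M' i)]
    {P : ∀ i, D → Submodule k (M i)} {P' : ∀ i, D → Submodule k (M' i)} (E : ∀ i, M i ≃ₗ[S] M' i)
    (hE : ∀ i a z, z ∈ P i a ↔ E i z ∈ P' i a) :
    GradedIso S (M := ⨁ i, M i) (M' := ⨁ i, M' i) (directSumPart P) (directSumPart P') :=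
  ⟨DFinsupp.mapRange.linearEquiv E, fun a z => forall_congr' fun i => hE i a (z i)⟩

theorem gradedIso_directSum_of_pi {S : Type*} [Semiring S] {D : Type*} {k : Type*} [CommRing k]
    {ι : Type*} [Fintype ι] [DecidableEq ι] {N : Type*} [AddCommGroup N] [Module k N] [Module S N]
    {M : ι → Type*} [∀ i, AddCommGroup (M i)] [∀ i, Module k (M i)] [∀ i, Module S (M i)]
    {P : D → Submodule k N} {P' : ∀ i, D → Submodule k (M i)} (E : N ≃ₗ[S] ∀ i, M i)
    (hE : ∀ a z, z ∈ P a ↔ ∀ i, E z i ∈ P' i a) :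
    GradedIso S (M' := ⨁ i, M i) P (directSumPart P') := by
  refine ⟨E ≪≫ₗ (DirectSum.linearEquivFunOnFintype S ι M).symm, fun a z => (hE a z).trans ?_⟩
  have h : (DirectSum.linearEquivFunOnFintype S ι M)
      ((E ≪≫ₗ (DirectSum.linearEquivFunOnFintype S ι M).symm) z) = E z :=
    LinearEquiv.apply_symm_apply _ _
  rw [← h]
  rfl

end LocComplex
end

/-! ### The theorem -/

open scoped DirectSum in
open Multigraded in
theorem mainTheorem12 {k : Type*} [CommRing k] {s : ℕ} (r : Fin s → ℕ) (hr : ∀ i, 1 ≤ r i)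
    (G : HomogeneousGenerators k r (irrelevantIdeal k r))
    (H : ∀ α : Finset (Fin s), HomogeneousGenerators k r (sumIdeal k r α)) :
    (∀ ℓ : ℕ,
      -- isomorphisms of graded `k`-modules
      (GradedIso k (M' := ⨁ α : Summand r ℓ, (H α.1).LocalCohomology (∑ i ∈ α.1, r i))
          (G.localCohomologyPart ℓ)
          (directSumPart fun α : Summand r ℓ =>
            (H α.1).localCohomologyPart (∑ i ∈ α.1, r i))) ∧
      -- graded `R`-linear isomorphism between the two direct sums
      (GradedIso (Ring k r)
          (M := ⨁ α : Summand r ℓ, (H α.1).LocalCohomology (∑ i ∈ α.1, r i))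
          (M' := ⨁ α : Summand r ℓ, InvModule k r α.1)
          (directSumPart fun α : Summand r ℓ =>
            (H α.1).localCohomologyPart (∑ i ∈ α.1, r i))
          (directSumPart fun α : Summand r ℓ => InvModule.part k r α.1)) ∧
      -- the first isomorphism can be taken `R`-linear if no block has exactly one variable
      (s = 1 ∨ (∀ i, 2 ≤ r i) →
        GradedIso (Ring k r)
          (M' := ⨁ α : Summand r ℓ, (H α.1).LocalCohomology (∑ i ∈ α.1, r i))
          (G.localCohomologyPart ℓ)
          (directSumPart fun α : Summand r ℓ =>
            (H α.1).localCohomologyPart (∑ i ∈ α.1, r i)))) ∧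
    (Nontrivial k → ∀ α : Finset (Fin s),
      gradedSupport (InvModule.part k r α) = orthant r α) := by
  refine ⟨fun ℓ => ?_, fun _ α => LocComplex.gradedSupport_invPart hr α⟩
  obtain ⟨E, hE, hlin⟩ := LocComplex.exists_localCohomology_irrelevant_equiv hr G ℓ
  choose F hF using fun α : Summand r ℓ =>
    LocComplex.exists_localCohomology_sum_equiv hr α.2.1 (H α.1)
  have hR := LocComplex.gradedIso_directSum F hF
  refine ⟨?_, hR, fun hs => ?_⟩
  · exact LocComplex.gradedIso_trans (LocComplex.gradedIso_directSum_of_pi E hE)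
      (LocComplex.gradedIso_symm
        (LocComplex.gradedIso_directSum (fun α => (F α).restrictScalars k) hF))
  · exact LocComplex.gradedIso_trans
      (LocComplex.gradedIso_directSum_of_pi { E with map_smul' := hlin hs } hE)
      (LocComplex.gradedIso_symm hR)
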